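/- **Setting.** Let $\Omega=\mathbb T^2\times(0,1)$, where $\mathbb T^2$ is the unit square with periodic boundary conditions, $\Gamma=\{x_3=1\}$, $D=(\partial_1,\partial_2,\partial_3)$, $\bar\partial=(\partial_1,\partial_2)$, $e(x)=x$. Repeated indices are summed, $F,_k=\partial F/\partial x_k$, and $\|\cdot\|_s$ is the norm of $H^s(\Omega)$, which for half-integers $s=k+\frac12$ is defined by interpolation (derivatives of order less than $k$ are measured in $L^2$, those of order $k$ in $[L^2(\Omega),H^1(\Omega)]_{1/2}$); norms of maps such as $e$ and $\eta$, whose first derivatives are periodic, are taken over the unit cell. Let $\rho_0$ be a smooth function on $\overline\Omega$ with $\rho_0=0$ on $\Gamma$ and $\rho_0(x)\ge c\,(1-x_3)$ for some $c>0$. A smooth solution on $[0,T]$, $T>0$, with initial velocity $u_0$ is a map $\eta$, smooth on $[0,T]\times\overline\Omega$, with $\eta(t,x)-x$ periodic in $(x_1,x_2)$, such that, with $$v=\eta_t,\quad A=[D\eta]^{-1},\quad J=\det D\eta,\quad a=JA,$$ one has $$\rho_0 v^i_t+a^k_i(\rho_0^2J^{-2}),_k=0\ \text{ in }\Omega\times(0,T],\qquad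 (\eta,v)|_{t=0}=(e,u_0),\qquad v^3=0\ \text{ on }\{x_3=0\}\times[0,T].$$ Let $(\operatorname{curl}_\eta v)_i=\varepsilon_{ijk}A^s_jv^k,_s$ and $$\begin{aligned}E(t)={}&\sum_{m=0}^4\|\partial_t^{2m}\eta\|_{4-m}^2+\sum_{m=0}^4\Bigl[\|\rho_0\bar\partial^{4-m}\partial_t^{2m}D\eta\|_0^2+\|\sqrt{\rho_0}\,\bar\partial^{4-m}\partial_t^{2m}v\|_0^2\Bigr]\\&+\sum_{m=0}^3\|\rho_0\partial_t^{2m}J^{-2}\|_{4-m}^2+\|\operatorname{curl}_\eta v\|_3^2+\|\rho_0\bar\partial^4\operatorname{curl}_\eta v\|_0^2 .\end{aligned}$$ Assume that $T$ is so small that for all $t\in[0,T]$ $$\tfrac12\le J(t)\le\tfrac32,\qquad\|\eta(t)\|_{3.5}^2\le2\|e\|_{3.5}^2+1,\qquad\|\partial_t^mv(t)\|_{3-m/2}^2\le2\|\partial_t^mv(0)\|_{3-m/2}^2+1\quad(m=0,\dots,6).$$ **Proposition.** For every $\rho_0$ as above there is a polynomial $P$, for every $K$ there is a constant $C>0$,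 and for every $K$ and every $\delta>0$ there is a polynomial $M_{\delta}$ (whose coefficients depend on $\rho_0,K,\delta$ only) such that every smooth solution on any $[0,T]$ that satisfies these assumptions and $\|\partial_t^mv(0)\|^2_{3-m/2}\le K$ for $m=0,\dots,6$ obeys, with $M_0(\delta)=M_\delta(E(0))$ and with both suprema finite, $$\sup_{t\in[0,T]}\Bigl(\int_\Omega\rho_0|\bar\partial^4v|^2dx+\int_\Omega\rho_0^2|\bar\partial^4D\eta|^2dx\Bigr)\le M_0(\delta)+\delta\sup_{[0,T]}E+C\,T\,P\Bigl(\sup_{[0,T]}E\Bigr).$$ -/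

import Mathlib

open Set
open scoped ContDiff

namespace VacuumEuler

noncomputable section

/-- Points of `ℝ³`. The coordinates `x₁, x₂, x₃` are `x 0, x 1, x 2`. -/
abbrev Point : Type := Fin 3 → ℝ

/-- Vectors of `ℝ³`. -/
abbrev Vec : Type := Fin 3 → ℝ

/-! ### The reference domain

The domain is `Ω = 𝕋² × (0,1)`. Functions on `Ω` are functions on the slab `0 < x₃ < 1` of `ℝ³`
that are 1-periodic in `x₁` and `x₂`; they are integrated over the fundamental cell `(0,1)³`.
As usual, a function is smooth on a closed set if it is the restriction of a smooth
function on the whole space. The values of that extension off the closed set are never used. -/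

/-- The open slab, the periodic cover of `Ω`. -/
def slab : Set Point := {x | 0 < x 2 ∧ x 2 < 1}

/-- The closed slab, the periodic cover of the closure of `Ω`. -/
def closedSlab : Set Point := {x | 0 ≤ x 2 ∧ x 2 ≤ 1}

/-- The fundamental cell. -/
def cell : Set Point := Set.pi Set.univ (fun _ => Ioo (0 : ℝ) 1)

/-- The integral over `Ω`. -/
def integ (f : Point → ℝ) : ℝ := ∫ x in cell, f x

/-- The unit vector in the horizontal direction `α`. -/
def hvec (α : Fin 2) : Point := Pi.single α.castSucc 1

/-- Horizontal periodicity on the closed slab. -/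
def HPeriodic (f : Point → ℝ) : Prop :=
  ∀ x ∈ closedSlab, ∀ α : Fin 2, f (x + hvec α) = f x

/-! ### Derivatives and norms -/

/-- The partial derivative `f,ₖ`. -/
def pd (k : Fin 3) (f : Point → ℝ) : Point → ℝ :=
  fun x => fderiv ℝ f x (Pi.single k 1)

/-- The partial derivative of multi-index `a`. -/
def pdMulti (a : Fin 3 → ℕ) (f : Point → ℝ) : Point → ℝ :=
  (pd 0)^[a 0] ((pd 1)^[a 1] ((pd 2)^[a 2] f))

/-- The `n`-th time derivative of a scalar function. -/
def dt (n : ℕ) (F : ℝ → Point → ℝ) : ℝ → Point → ℝ :=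
  fun t x => iteratedDeriv n (fun s => F s x) t

/-- The square of the Euclidean length of the tensor of all horizontal derivatives of order `m`:
`|∂̄ᵐ f|² = ∑ |∂_{α₁} ⋯ ∂_{αₘ} f|²`, summed over all `α₁, …, αₘ ∈ {1, 2}`. -/
def hderivSq : ℕ → (Point → ℝ) → Point → ℝ
  | 0, f => fun x => f x ^ 2
  | m + 1, f => fun x => ∑ α : Fin 2, hderivSq m (pd α.castSucc f) x

/-- The squared `L²(Ω)` norm. -/
def l2Sq (f : Point → ℝ) : ℝ := integ (fun x => f x ^ 2)

/-- The squared Sobolev norm `‖f‖ₖ²` of integer order `k`. -/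
def sobSq (k : ℕ) (f : Point → ℝ) : ℝ :=
  ∑ n ∈ Finset.range (k + 1), ∑ a ∈ Finset.piAntidiag Finset.univ n, l2Sq (pdMulti a f)

/-- The square of the K-functional of the couple `(L²(Ω), H¹(Ω))`, taken over the smooth functions,
which are dense in `H¹(Ω)`. -/
def kFunctionalSq (s : ℝ) (f : Point → ℝ) : ℝ :=
  sInf {r | ∃ w : Point → ℝ, ContDiff ℝ ∞ w ∧ HPeriodic w ∧
    r = sobSq 0 (fun x => f x - w x) + s ^ 2 * sobSq 1 w}

/-- The squared norm of `H^{1/2}(Ω) = [L²(Ω), H¹(Ω)]_{1/2}` (real interpolation, with the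
normalization that agrees with the spectral definition for a couple of Hilbert spaces). -/
def halfSq (f : Point → ℝ) : ℝ :=
  (2 / Real.pi) * ∫ s in Ioi (0 : ℝ), kFunctionalSq s f / s ^ 2

/-- The squared Sobolev norm of order `k + 1/2`: the derivatives of order less than `k` are measured
in `L²`, those of order `k` in the interpolation space `H^{1/2}`. -/
def sobPlusHalfSq (k : ℕ) (f : Point → ℝ) : ℝ :=
  (∑ n ∈ Finset.range k, ∑ a ∈ Finset.piAntidiag Finset.univ n, l2Sq (pdMulti a f))
    + ∑ a ∈ Finset.piAntidiag Finset.univ k, halfSq (pdMulti a f)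

/-- The squared Sobolev norm of order `n / 2`. -/
def sobHalvesSq (n : ℕ) (f : Point → ℝ) : ℝ :=
  if Even n then sobSq (n / 2) f else sobPlusHalfSq (n / 2) f

/-! ### Lagrangian quantities of a flow map `η` -/

/-- The Lagrangian velocity `v = ∂ₜ η`, component `i`. -/
def vel (η : ℝ → Point → Vec) (i : Fin 3) : ℝ → Point → ℝ :=
  fun t x => deriv (fun s => η s x i) t

/-- The deformation tensor `Dη`: row `i` and column `k` hold `ηⁱ,ₖ`. -/
def defGrad (η : ℝ → Point → Vec) (t : ℝ) (x : Point) : Matrix (Fin 3) (Fin 3) ℝ :=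
  Matrix.of fun i k => pd k (fun y => η t y i) x

/-- `J = det Dη`. -/
def jac (η : ℝ → Point → Vec) (t : ℝ) (x : Point) : ℝ := (defGrad η t x).det

/-- `A = [Dη]⁻¹`; row `k` and column `i` hold `Aᵏᵢ`. -/
def invGrad (η : ℝ → Point → Vec) (t : ℝ) (x : Point) : Matrix (Fin 3) (Fin 3) ℝ :=
  (defGrad η t x)⁻¹

/-- The transpose `a = J A` of the cofactor matrix; row `k` and column `i` hold `aᵏᵢ`. -/
def cof (η : ℝ → Point → Vec) (t : ℝ) (x : Point) : Matrix (Fin 3) (Fin 3) ℝ :=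
  (defGrad η t x).adjugate

/-- `J⁻²`. -/
def jacInvSq (η : ℝ → Point → Vec) : ℝ → Point → ℝ :=
  fun t x => ((jac η t x) ^ 2)⁻¹

/-- The Lagrangian derivative `Aˢⱼ vᵏ,ₛ` of the velocity. -/
def lagGrad (η : ℝ → Point → Vec) (t : ℝ) (x : Point) (j k : Fin 3) : ℝ :=
  ∑ s : Fin 3, invGrad η t x s j * pd s (vel η k t) x

/-- The Lagrangian curl of the velocity, `(curl_η v)ᵢ = ε_{ijk} Aˢⱼ vᵏ,ₛ`. -/
def curlEta (η : ℝ → Point → Vec) (i : Fin 3) (t : ℝ) (x : Point) : ℝ :=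
  ![lagGrad η t x 1 2 - lagGrad η t x 2 1,
    lagGrad η t x 2 0 - lagGrad η t x 0 2,
    lagGrad η t x 0 1 - lagGrad η t x 1 0] i

/-! ### The initial density and the Euler equations -/

/-- A smooth initial density on the closure of `Ω` that vanishes on the vacuum boundary
`Γ = {x₃ = 1}` and is bounded below by a multiple of the distance `1 - x₃` to `Γ`. -/
structure IsVacuumDensity (ρ₀ : Point → ℝ) : Prop where
  smooth : ContDiff ℝ ∞ ρ₀
  periodic : HPeriodic ρ₀
  vanishes : ∀ x : Point, x 2 = 1 → ρ₀ x = 0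
  physical : ∃ c : ℝ, 0 < c ∧ ∀ x ∈ closedSlab, c * (1 - x 2) ≤ ρ₀ x

/-- `η` is a smooth solution on `[0,T]`, up to the boundary of `Ω`, of the compressible Euler
equations (with `γ = 2`) in Lagrangian variables. The map `η t` of `𝕋² × [0,1]` to `𝕋² × ℝ` is
represented by its lift, so that `η t x - x` is periodic. -/
structure IsSmoothSolution (ρ₀ : Point → ℝ) (u₀ : Point → Vec) (T : ℝ)
    (η : ℝ → Point → Vec) : Prop where
  smooth : ContDiff ℝ ∞ (fun p : ℝ × Point => η p.1 p.2)
  periodic : ∀ t ∈ Icc 0 T, ∀ x ∈ closedSlab, ∀ α : Fin 2, η t (x + hvec α) = η t x + hvec α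
  momentum : ∀ t ∈ Ioc 0 T, ∀ x ∈ slab, ∀ i : Fin 3,
    ρ₀ x * deriv (fun s => vel η i s x) t
      + ∑ k : Fin 3, cof η t x k i * pd k (fun y => ρ₀ y ^ 2 * jacInvSq η t y) x = 0
  init_position : ∀ x ∈ closedSlab, η 0 x = x
  init_velocity : ∀ x ∈ closedSlab, ∀ i : Fin 3, vel η i 0 x = u₀ x i
  bottom : ∀ t ∈ Icc 0 T, ∀ x : Point, x 2 = 0 → vel η 2 t x = 0

/-- `‖η(t)‖²_{7/2}`. -/
def flowNormSq (η : ℝ → Point → Vec) (t : ℝ) : ℝ :=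
  ∑ i : Fin 3, sobHalvesSq 7 (fun x => η t x i)

/-- `‖∂ₜᵐ v(t)‖²_{3 - m/2}`, for `m ≤ 6`. -/
def velNormSq (η : ℝ → Point → Vec) (m : ℕ) (t : ℝ) : ℝ :=
  ∑ i : Fin 3, sobHalvesSq (6 - m) (dt m (vel η i) t)

/-- The standing smallness assumptions on the time interval `[0,T]`. -/
structure SmallTime (T : ℝ) (η : ℝ → Point → Vec) : Prop where
  jac_bounds : ∀ t ∈ Icc 0 T, ∀ x ∈ closedSlab, 1 / 2 ≤ jac η t x ∧ jac η t x ≤ 3 / 2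
  flow_bound : ∀ t ∈ Icc 0 T, flowNormSq η t ≤ 2 * flowNormSq (fun _ x => x) 0 + 1
  vel_bound : ∀ m : ℕ, m ≤ 6 → ∀ t ∈ Icc 0 T, velNormSq η m t ≤ 2 * velNormSq η m 0 + 1

/-! ### The energy function -/

/-- The higher-order energy function `E(t)`. -/
def energy (ρ₀ : Point → ℝ) (η : ℝ → Point → Vec) (t : ℝ) : ℝ :=
  (∑ m ∈ Finset.range 5, ∑ i : Fin 3, sobSq (4 - m) (dt (2 * m) (fun s x => η s x i) t))
  + (∑ m ∈ Finset.range 5,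
      (integ (fun x => ρ₀ x ^ 2 * ∑ i : Fin 3, ∑ k : Fin 3,
          hderivSq (4 - m) (pd k (dt (2 * m) (fun s y => η s y i) t)) x)
        + integ (fun x => ρ₀ x * ∑ i : Fin 3, hderivSq (4 - m) (dt (2 * m) (vel η i) t) x)))
  + (∑ m ∈ Finset.range 4, sobSq (4 - m) (fun x => ρ₀ x * dt (2 * m) (jacInvSq η) t x))
  + (∑ i : Fin 3, sobSq 3 (curlEta η i t))
  + integ (fun x => ρ₀ x ^ 2 * ∑ i : Fin 3, hderivSq 4 (curlEta η i t) x)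

/-- The horizontal energy `∫ ρ₀ |∂̄⁴ v|² dx + ∫ ρ₀² |∂̄⁴ Dη|² dx` at time `t`. -/
def horizontalEnergy (ρ₀ : Point → ℝ) (η : ℝ → Point → Vec) (t : ℝ) : ℝ :=
  integ (fun x => ρ₀ x * ∑ i : Fin 3, hderivSq 4 (vel η i t) x)
  + integ (fun x => ρ₀ x ^ 2 * ∑ i : Fin 3, ∑ k : Fin 3,
      hderivSq 4 (pd k (fun y => η t y i)) x)

/-- The supremum over `[0,T]`. -/
def supOn (T : ℝ) (f : ℝ → ℝ) : ℝ := sSup (f '' Icc 0 T)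

end

end VacuumEuler

open VacuumEuler

/-! ### Smooth functions on space-time, in families, with their commuting derivations. -/

namespace VacuumEuler

open MeasureTheory

/-! The proof is an energy estimate for four horizontal derivatives. Fix four horizontal directions
and put y = ∂̄⁴η, w = y_t = ∂̄⁴v. By the Piola identity the equation has the divergence form ρ₀ vⁱ_t
= -∂ₖ(ρ₀² τᵏᵢ) with τ = aJ⁻² = J⁻¹A. Since τ is minus the gradient of J⁻¹ as a function of Dη, its
derivative with respect to Dη (`stiff`, here c) is symmetric. Apply ∂̄⁴, write ∂̄⁴(ρ₀²τ) = ρ₀² c:Dy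
+ r, and test with w. No boundary term survives: ρ₀ = 0 on Γ, and on the bottom w³ = 0 and a³₁ = a³₂
= 0. As w = y_t, the time derivative can be moved off Dw: the integral of ψ = ½ρ₀|w|² -
½ρ₀²(c:Dy):Dy - r:Dy (`psiF`) has a time derivative that contains only c_t, r_t and the commutator
[∂̄⁴,ρ₀]v_t, and no ∂̄⁴Dv (`Flow.integ_Dt_psiF`).

Since τ_t = c:Dv, r_t is a commutator up to a term with c_t. It involves ρ₀∂̄³Dv, which is not
bounded at each time by the available norms but is bounded in L²(0,T) (`Flow.int_velGrad3`). The
middle terms of the commutator need an anisotropic product estimate, because a weighted top-order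
factor can be differentiated only horizontally (`L2.mul_of_horizontal`, `Mid.commutator_weight`).
Horizontal derivatives of ρ₀ vanish on Γ and so are O(ρ₀), which lets the weights pass through the
Leibniz formula. A rate of change that is square integrable in time gives increments of order √T
(`growth_aux`).

For the lower bound, -(c:Dy):Dy equals J⁻¹ times |div_η y|² + |∇_η y|² - ½|curl_η y|², and J⁻¹|∇_η
y|² differs from |Dy|² by a metric that is the identity at t = 0 (`Flow.coercive`). The metric
deviation and the curl of y both start from zero and stay O(√T); for the curl this uses the norm of
ρ₀∂̄⁴curl_η v in E. In ∫ r:Dy, r may be replaced by r(0) up to O(√T); r(0) = ∂̄⁴(ρ₀²)·Id is O(ρ₀),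
so Young's inequality gives ε∫ρ₀²|Dy|² + C/ε. This is the origin of δ sup E and of M_δ.

Uniformity of the constants is obtained by estimating all solutions at once. An element of `Fam ι`
is a family of smooth functions on all of space-time indexed by solutions, and every bound has the
form C·Bⁿ with B = (1+|K|)(1+sup E) and C, n common to the family. For T ≤ 1 the factor √T is
exchanged for T by X√T ≤ 1 + TX². For T ≥ 1 the horizontal energy is at most sup E ≤ T sup E, so the
term X in P suffices. -/

/-- Points of space-time. -/
abbrev SpaceTime : Type := ℝ × Point

/-- The algebra of families of smooth functions on space-time. -/
def Fam (ι : Type*) : Subalgebra ℝ (ι → SpaceTime → ℝ) where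
  carrier := {f | ∀ c, ContDiff ℝ ∞ (f c)}
  mul_mem' hf hg c := (hf c).mul (hg c)
  add_mem' hf hg c := (hf c).add (hg c)
  algebraMap_mem' _ _ := contDiff_const

noncomputable section

variable {ι : Type*}

namespace Fam

theorem differentiable (f : Fam ι) (c : ι) : Differentiable ℝ (f.1 c) :=
  (f.2 c).differentiable (by simp)

theorem continuous (f : Fam ι) (c : ι) : Continuous (f.1 c) := (f.2 c).continuous

/-- The value of a family at a member, a time and a position. -/
def ev (f : Fam ι) (c : ι) (t : ℝ) (x : Point) : ℝ := f.1 c (t, x)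

@[simp] theorem ev_add (f g : Fam ι) (c t x) : ev (f + g) c t x = ev f c t x + ev g c t x := rfl
@[simp] theorem ev_sub (f g : Fam ι) (c t x) : ev (f - g) c t x = ev f c t x - ev g c t x := rfl
@[simp] theorem ev_neg (f : Fam ι) (c t x) : ev (-f) c t x = -ev f c t x := rfl
@[simp] theorem ev_mul (f g : Fam ι) (c t x) : ev (f * g) c t x = ev f c t x * ev g c t x := rfl
@[simp] theorem ev_zero (c t x) : ev (0 : Fam ι) c t x = 0 := rfl
@[simp] theorem ev_one (c t x) : ev (1 : Fam ι) c t x = 1 := rfl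
@[simp] theorem ev_pow (f : Fam ι) (n : ℕ) (c t x) : ev (f ^ n) c t x = ev f c t x ^ n := rfl
@[simp] theorem ev_smul (r : ℝ) (f : Fam ι) (c t x) : ev (r • f) c t x = r * ev f c t x := rfl

/-- Evaluation as a ring homomorphism. -/
def evHom (c : ι) (t : ℝ) (x : Point) : Fam ι →+* ℝ where
  toFun f := ev f c t x
  map_zero' := rfl
  map_one' := rfl
  map_add' _ _ := rfl
  map_mul' _ _ := rfl

@[simp] theorem ev_sum {κ : Type*} (s : Finset κ) (f : κ → Fam ι) (c t x) :
    ev (∑ j ∈ s, f j) c t x = ∑ j ∈ s, ev (f j) c t x :=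
  map_sum (evHom c t x) f s

theorem ext_ev {f g : Fam ι} (h : ∀ c t x, ev f c t x = ev g c t x) : f = g :=
  Subtype.ext (funext fun c => funext fun p => h c p.1 p.2)

theorem contDiff_ev (f : Fam ι) (c t) : ContDiff ℝ ∞ (ev f c t) :=
  (f.2 c).comp (contDiff_const.prodMk contDiff_id)

theorem continuous_ev (f : Fam ι) (c t) : Continuous (ev f c t) := (contDiff_ev f c t).continuous

theorem contDiff_ev_time (f : Fam ι) (c x) : ContDiff ℝ ∞ (fun t => ev f c t x) :=
  (f.2 c).comp (contDiff_id.prodMk contDiff_const)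

theorem continuous_ev_uncurry (f : Fam ι) (c) :
    Continuous (fun p : ℝ × Point => ev f c p.1 p.2) := (f.2 c).continuous

/-- The derivation of the algebra in a fixed direction of space-time. -/
def dir (w : SpaceTime) : Derivation ℝ (Fam ι) (Fam ι) :=
  Derivation.mk'
    { toFun := fun f => ⟨fun c p => fderiv ℝ (f.1 c) p w, fun c =>
        ((f.2 c).fderiv_right (m := ∞) (by simp)).clm_apply contDiff_const⟩
      map_add' := fun f g => by
        refine Subtype.ext (funext fun c => funext fun p => ?_)
        exact congrArg (fun L => L w)
          (fderiv_add (differentiable f c p) (differentiable g c p))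
      map_smul' := fun r f => by
        refine Subtype.ext (funext fun c => funext fun p => ?_)
        exact congrArg (fun L => L w) (fderiv_const_smul (differentiable f c p) r) }
    (fun f g => by
      refine Subtype.ext (funext fun c => funext fun p => ?_)
      exact congrArg (fun L => L w) (fderiv_mul (differentiable f c p) (differentiable g c p)))

theorem dir_apply (w : SpaceTime) (f : Fam ι) (c p) : (dir w f).1 c p = fderiv ℝ (f.1 c) p w := rfl

theorem dir_comm (w w' : SpaceTime) (f : Fam ι) : dir w (dir w' f) = dir w' (dir w f) := by
  refine Subtype.ext (funext fun c => funext fun p => ?_)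
  have hd : Differentiable ℝ (fderiv ℝ (f.1 c)) :=
    ((f.2 c).fderiv_right (m := ∞) (by simp)).differentiable (by simp)
  have key : ∀ a b : SpaceTime, (dir a (dir b f)).1 c p = fderiv ℝ (fderiv ℝ (f.1 c)) p a b := by
    intro a b
    have : (dir b f).1 c = fun q => fderiv ℝ (f.1 c) q b := rfl
    rw [dir_apply, this, fderiv_clm_apply (hd p) (differentiableAt_const b)]
    simp
  rw [key, key]
  exact ((f.2 c).contDiffAt.isSymmSndFDerivAt (by simp; exact ENat.LEInfty.out)).eq w w'

/-- The spatial partial derivatives. -/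
def D (k : Fin 3) : Derivation ℝ (Fam ι) (Fam ι) := dir (0, Pi.single k 1)

/-- The time derivative. -/
def Dt : Derivation ℝ (Fam ι) (Fam ι) := dir (1, 0)

theorem D_comm (j k : Fin 3) (f : Fam ι) : D j (D k f) = D k (D j f) := dir_comm _ _ _
theorem Dt_D (k : Fin 3) (f : Fam ι) : Dt (D k f) = D k (Dt f) := dir_comm _ _ _

theorem D_mul (k : Fin 3) (f g : Fam ι) : D k (f * g) = D k f * g + f * D k g := by
  rw [Derivation.leibniz, smul_eq_mul, smul_eq_mul]; ring

theorem Dt_mul (f g : Fam ι) : Dt (f * g) = Dt f * g + f * Dt g := by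
  rw [Derivation.leibniz, smul_eq_mul, smul_eq_mul]; ring

theorem pd_ev (k : Fin 3) (f : Fam ι) (c t) : pd k (ev f c t) = ev (D k f) c t := by
  funext x
  have h : HasFDerivAt (ev f c t) ((fderiv ℝ (f.1 c) (t, x)).comp
      (ContinuousLinearMap.inr ℝ ℝ Point)) x :=
    (differentiable f c (t, x)).hasFDerivAt.comp x (hasFDerivAt_prodMk_right t x)
  simp [pd, h.fderiv, ev, D, dir_apply]

theorem hasDerivAt_ev (f : Fam ι) (c t x) :
    HasDerivAt (fun s => ev f c s x) (ev (Dt f) c t x) t := by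
  have h := (differentiable f c (t, x)).hasFDerivAt.comp_hasDerivAt t
    (hasFDerivAt_prodMk_left t x).hasDerivAt
  exact h

theorem iteratedDeriv_ev (n : ℕ) (f : Fam ι) (c t x) :
    iteratedDeriv n (fun s => ev f c s x) t = ev (Dt^[n] f) c t x := by
  induction n generalizing t with
  | zero => simp
  | succ n ih =>
    rw [iteratedDeriv_succ, Function.iterate_succ_apply']
    rw [funext ih]
    exact (hasDerivAt_ev _ c t x).deriv

theorem pd_iterate_ev (k : Fin 3) (n : ℕ) (f : Fam ι) (c t) :
    (pd k)^[n] (ev f c t) = ev ((D k)^[n] f) c t := by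
  induction n with
  | zero => rfl
  | succ n ih => rw [Function.iterate_succ_apply', ih, pd_ev, Function.iterate_succ_apply' (⇑(D k))]

theorem pdMulti_ev (a : Fin 3 → ℕ) (f : Fam ι) (c t) :
    pdMulti a (ev f c t) = ev ((D 0)^[a 0] ((D 1)^[a 1] ((D 2)^[a 2] f))) c t := by
  simp only [pdMulti, pd_iterate_ev]

theorem dt_ev (n : ℕ) (f : Fam ι) (c) : dt n (ev f c) = ev (Dt^[n] f) c :=
  funext fun _ => funext fun _ => iteratedDeriv_ev n f c _ _

/-- Composition with a smooth function of one variable. -/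
def comp (θ : ℝ → ℝ) (hθ : ContDiff ℝ ∞ θ) (f : Fam ι) : Fam ι :=
  ⟨fun c p => θ (f.1 c p), fun c => hθ.comp (f.2 c)⟩

@[simp] theorem ev_comp (θ : ℝ → ℝ) (hθ : ContDiff ℝ ∞ θ) (f : Fam ι) (c t x) :
    ev (comp θ hθ f) c t x = θ (ev f c t x) := rfl

theorem iterate_D_comm (j k : Fin 3) (n : ℕ) (f : Fam ι) :
    D j ((D k)^[n] f) = (D k)^[n] (D j f) :=
  (Function.Semiconj.iterate_right (fun g => D_comm j k g) n).eq f

/-- Every iterated partial derivative is the one of a multi-index. -/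
theorem exists_multiIndex (L : List (Fin 3)) :
    ∃ a ∈ Finset.piAntidiag (Finset.univ : Finset (Fin 3)) L.length, ∀ f : Fam ι,
      L.foldr (fun k g => D k g) f = (D 0)^[a 0] ((D 1)^[a 1] ((D 2)^[a 2] f)) := by
  induction L with
  | nil => exact ⟨0, by simp, fun f => rfl⟩
  | cons j L ih =>
    obtain ⟨a, ha, h⟩ := ih
    refine ⟨a + Pi.single j 1, ?_, fun f => ?_⟩
    · simp only [Finset.mem_piAntidiag, Finset.sum_add_distrib, Pi.add_apply] at ha ⊢
      simp [ha.1]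
    · rw [List.foldr_cons, h f]
      fin_cases j
      · simp [← Function.iterate_succ_apply' (fun g => D 0 g)]
      · simp [iterate_D_comm, ← Function.iterate_succ_apply' (fun g => D 1 g)]
      · simp [iterate_D_comm, ← Function.iterate_succ_apply' (fun g => D 2 g)]

end Fam

end

end VacuumEuler

/-! ### Calculus on the cell: divergence theorem, time derivatives of integrals, Sobolev
inequalities. -/

namespace VacuumEuler

open MeasureTheory

theorem measurableSet_cell : MeasurableSet cell :=
  MeasurableSet.univ_pi fun _ => measurableSet_Ioo

theorem mem_cell {x : Point} : x ∈ cell ↔ ∀ i, 0 < x i ∧ x i < 1 := by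
  simp [cell]

theorem cell_subset_Icc : cell ⊆ Icc (0 : Point) 1 := fun _ hx =>
  ⟨fun i => (mem_cell.1 hx i).1.le, fun i => (mem_cell.1 hx i).2.le⟩

theorem cell_subset_slab : cell ⊆ slab := fun _ hx => mem_cell.1 hx 2

theorem slab_subset_closedSlab : slab ⊆ closedSlab := fun _ hx => ⟨hx.1.le, hx.2.le⟩

theorem volume_cell : volume cell = 1 := by
  simp [cell, Real.volume_pi_Ioo]

instance : IsProbabilityMeasure (volume.restrict cell) :=
  ⟨by rw [Measure.restrict_apply_univ, volume_cell]⟩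

theorem restrict_cell_eq_pi :
    (volume.restrict cell : Measure Point)
      = Measure.pi fun _ => (volume : Measure ℝ).restrict (Ioo 0 1) := by
  rw [cell, volume_pi, Measure.restrict_pi_pi]

theorem _root_.Continuous.integrableOn_cell {f : Point → ℝ} (hf : Continuous f) :
    IntegrableOn f cell :=
  (hf.continuousOn.integrableOn_compact isCompact_Icc).mono_set cell_subset_Icc

theorem integral_const_cell (r : ℝ) : ∫ _ in cell, r = r := by
  rw [integral_const, probReal_univ, one_smul]

/-! ### Integration by parts -/

/-- Opposite lateral faces of the cell cancel by periodicity, so only the normal component on the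
top and the bottom has to vanish. -/
theorem integ_divergence_eq_zero (W : Fin 3 → Point → ℝ) (hW : ∀ k, ContDiff ℝ ∞ (W k))
    (hper : ∀ α : Fin 2, HPeriodic (W α.castSucc))
    (hbot : ∀ x : Point, x 2 = 0 → W 2 x = 0) (htop : ∀ x : Point, x 2 = 1 → W 2 x = 0) :
    integ (fun x => ∑ k, pd k (W k) x) = 0 := by
  have hd : ∀ k, Differentiable ℝ (W k) := fun k => (hW k).differentiable (by simp)
  have hc : ∀ k, Continuous fun x => fderiv ℝ (W k) x (Pi.single k 1) := fun k =>
    ((hW k).continuous_fderiv (by simp)).clm_apply continuous_const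
  have hae : (cell : Set Point) =ᵐ[volume] Icc (0 : Point) 1 := by
    have := (Measure.univ_pi_Ioo_ae_eq_Icc (μ := fun _ : Fin 3 => (volume : Measure ℝ))
      (f := (0 : Point)) (g := 1))
    simpa [cell, volume_pi] using this
  have key := integral_divergence_of_hasFDerivAt_off_countable' (n := 2) (0 : Point) 1
    (by intro i; simp) W (fun k x => fderiv ℝ (W k) x) ∅ countable_empty
    (fun k => (hd k).continuous.continuousOn) (fun x _ k => (hd k x).hasFDerivAt)
    ((continuous_finsetSum _ fun k _ => hc k).continuousOn.integrableOn_compact isCompact_Icc)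
  have : integ (fun x => ∑ k, pd k (W k) x)
      = ∫ x in Icc (0 : Point) 1, ∑ k, fderiv ℝ (W k) x (Pi.single k 1) := by
    rw [integ, setIntegral_congr_set hae]; rfl
  rw [this, key]
  refine Finset.sum_eq_zero fun k _ => ?_
  rw [sub_eq_zero]
  refine setIntegral_congr_fun measurableSet_Icc fun z hz => ?_
  simp only [Pi.one_apply, Pi.zero_apply]
  have hz' : ∀ j, 0 ≤ z j ∧ z j ≤ 1 := fun j => ⟨hz.1 j, hz.2 j⟩
  have hface : ∀ α : Fin 2, W α.castSucc (α.castSucc.insertNth (α := fun _ => ℝ) 1 z)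
      = W α.castSucc (α.castSucc.insertNth (α := fun _ => ℝ) 0 z) := by
    intro α
    rw [← hper α (α.castSucc.insertNth (α := fun _ => ℝ) 0 z) ?_ α]
    · congr 1
      funext j
      fin_cases α <;> fin_cases j <;> simp [hvec] <;> rfl
    · have e : (α.castSucc.insertNth (α := fun _ => ℝ) 0 z : Point) 2 = z 1 := by
        fin_cases α <;> rfl
      exact ⟨by rw [e]; exact (hz' 1).1, by rw [e]; exact (hz' 1).2⟩
  fin_cases k
  · exact hface 0
  · exact hface 1
  · have e : ∀ r : ℝ, ((2 : Fin 3).insertNth (α := fun _ => ℝ) r z : Point) 2 = r := fun r =>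
      Fin.insertNth_apply_same (α := fun _ => ℝ) 2 r z
    exact (htop _ (e 1)).trans (hbot _ (e 0)).symm

/-! ### Differentiation under the integral sign -/

namespace Fam

variable {ι : Type*}

theorem hasDerivAt_integ (f : Fam ι) (c : ι) (t : ℝ) :
    HasDerivAt (fun s => integ (ev f c s)) (integ (ev (Dt f) c t)) t := by
  obtain ⟨C, hC⟩ := ((isCompact_Icc (a := t - 1) (b := t + 1)).prod
    (isCompact_Icc (a := (0 : Point)) (b := 1))).exists_bound_of_continuousOn
      (continuous_ev_uncurry (Dt f) c).continuousOn
  refine (hasDerivAt_integral_of_dominated_loc_of_deriv_le (F := fun s x => ev f c s x)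
    (F' := fun s x => ev (Dt f) c s x) (bound := fun _ => C)
    (Icc_mem_nhds (show t - 1 < t by linarith) (show t < t + 1 by linarith))
    (Filter.Eventually.of_forall fun s => (continuous_ev f c s).aestronglyMeasurable)
    (continuous_ev f c t).integrableOn_cell (continuous_ev (Dt f) c t).aestronglyMeasurable
    ?_ (integrable_const C) ?_).2
  · refine (ae_restrict_iff' measurableSet_cell).2 (Filter.Eventually.of_forall ?_)
    intro x hx s hs
    exact hC (s, x) ⟨hs, cell_subset_Icc hx⟩
  · exact Filter.Eventually.of_forall fun x s _ => hasDerivAt_ev f c s x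

theorem continuous_integ (f : Fam ι) (c : ι) : Continuous fun t => integ (ev f c t) :=
  continuous_iff_continuousAt.2 fun t => (hasDerivAt_integ f c t).continuousAt

end Fam

/-! ### Sobolev inequalities on the cell -/

/-- Average ψ(s) ≤ |ψ(r)| + ∫|ψ'| over r. The term |ψ| takes the place of the compact support that
is usual in Gagliardo-Nirenberg arguments. -/
theorem le_lintegral_add_deriv {ψ ψ' : ℝ → ℝ} (h : ∀ s, HasDerivAt ψ (ψ' s) s)
    (hc : Continuous ψ') {s : ℝ} (hs : s ∈ Ioo (0 : ℝ) 1) :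
    ENNReal.ofReal (ψ s) ≤ ∫⁻ r in Ioo (0 : ℝ) 1, ENNReal.ofReal (|ψ r| + |ψ' r|) := by
  have hψ : Continuous ψ := continuous_iff_continuousAt.2 fun r => (h r).continuousAt
  have hi : IntegrableOn (fun r => |ψ' r|) (Ioo 0 1) :=
    (hc.abs.continuousOn.integrableOn_compact isCompact_Icc).mono_set Ioo_subset_Icc_self
  have hi' : IntegrableOn (fun r => |ψ r|) (Ioo 0 1) :=
    (hψ.abs.continuousOn.integrableOn_compact isCompact_Icc).mono_set Ioo_subset_Icc_self
  have h1 : ∀ r ∈ Ioo (0 : ℝ) 1, ψ s ≤ |ψ r| + ∫ q in Ioo (0 : ℝ) 1, |ψ' q| := by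
    intro r hr
    have e : ∫ q in r..s, ψ' q = ψ s - ψ r :=
      intervalIntegral.integral_eq_sub_of_hasDerivAt (fun q _ => h q) (hc.intervalIntegrable _ _)
    have e2 : |∫ q in r..s, ψ' q| ≤ ∫ q in Ioo (0 : ℝ) 1, |ψ' q| := by
      have e3 : |∫ q in r..s, ψ' q| ≤ ∫ q in uIoc r s, |ψ' q| :=
        intervalIntegral.norm_integral_le_integral_norm_uIoc (f := ψ') (μ := volume)
      refine e3.trans ?_
      refine setIntegral_mono_set hi (Filter.Eventually.of_forall fun _ => abs_nonneg _) ?_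
      refine LE.le.eventuallyLE fun q hq => ?_
      rcases le_total r s with h | h
      · rw [uIoc_of_le h] at hq; exact ⟨hr.1.trans hq.1, hq.2.trans_lt hs.2⟩
      · rw [uIoc_of_ge h] at hq; exact ⟨hs.1.trans hq.1, hq.2.trans_lt hr.2⟩
    rw [e] at e2
    have := (abs_le.1 e2).2
    linarith [le_abs_self (ψ r)]
  rw [← ofReal_integral_eq_lintegral_ofReal (f := fun r => |ψ r| + |ψ' r|) (hi'.add hi)
    (Filter.Eventually.of_forall fun _ => by positivity)]
  refine ENNReal.ofReal_le_ofReal ?_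
  have h2 : ∫ _ in Ioo (0 : ℝ) 1, ψ s ≤ ∫ r in Ioo (0 : ℝ) 1, (|ψ r| + ∫ q in Ioo (0 : ℝ) 1, |ψ' q|) :=
    setIntegral_mono_on (by simp) (hi'.add (by simp)) measurableSet_Ioo h1
  rw [integral_add hi' (by simp)] at h2
  rw [integral_add hi' hi]
  simpa using h2

theorem hasDerivAt_update_comp {f : Point → ℝ} (hf : ContDiff ℝ ∞ f) (x : Point) (i : Fin 3)
    (s : ℝ) : HasDerivAt (fun r => f (Function.update x i r)) (pd i f (Function.update x i s)) s :=
  ((hf.differentiable (by simp) _).hasFDerivAt.comp_hasDerivAt s (hasDerivAt_update x i s))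

theorem contDiff_pd {f : Point → ℝ} (hf : ContDiff ℝ ∞ f) (k : Fin 3) : ContDiff ℝ ∞ (pd k f) :=
  (hf.fderiv_right (m := ∞) (by simp)).clm_apply contDiff_const

theorem continuous_pd {f : Point → ℝ} (hf : ContDiff ℝ ∞ f) (k : Fin 3) : Continuous (pd k f) :=
  (contDiff_pd hf k).continuous

theorem ofReal_le_lintegral_line {f : Point → ℝ} (hf : ContDiff ℝ ∞ f) (i : Fin 3) {x : Point}
    (hx : x ∈ cell) :
    ENNReal.ofReal (f x) ≤ ∫⁻ r in Ioo (0 : ℝ) 1,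
      ENNReal.ofReal (|f (Function.update x i r)| + |pd i f (Function.update x i r)|) := by
  have := le_lintegral_add_deriv (s := x i) (hasDerivAt_update_comp hf x i)
    ((continuous_pd hf i).comp (continuous_const.update i continuous_id)) (mem_cell.1 hx i)
  simpa using this

/-- The Loomis-Whitney inequality on the cell. -/
theorem loomis_whitney_cell (a : Fin 3 → Point → ℝ) (ha : ∀ i, ContDiff ℝ ∞ (a i))
    (ha0 : ∀ i x, 0 ≤ a i x) (φ : Point → ℝ) (hφ : Continuous φ)
    (hle : ∀ i x, |a i x| + |pd i (a i) x| ≤ φ x) {u : Point → ℝ} (hu : Continuous u)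
    (hu0 : ∀ x, 0 ≤ u x) (hua : ∀ x, u x ^ 2 = ∏ i, a i x) :
    (∫ x in cell, u x) ^ 2 ≤ (∫ x in cell, φ x) ^ 3 := by
  have hφ0 : ∀ x, 0 ≤ φ x := fun x => le_trans (by positivity) (hle 0 x)
  have hp : Real.HolderConjugate (Fintype.card (Fin 3) : ℝ) (3 / 2) := by
    rw [Real.holderConjugate_iff]; norm_num
  -- The grid-line inequality in dimension 3: the integral of the product of the square roots of the
  -- three line integrals of φ is at most (∫φ)^(3/2). Each `a i` is bounded by the line integral in
  -- direction i.
  have key := lintegral_prod_lintegral_pow_le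
    (fun _ : Fin 3 => (volume : Measure ℝ).restrict (Ioo 0 1)) hp
    (f := fun x => ENNReal.ofReal (φ x)) hφ.measurable.ennreal_ofReal
  have h1 : ∫⁻ x in cell, ENNReal.ofReal (u x)
      ≤ (∫⁻ x in cell, ENNReal.ofReal (φ x)) ^ (3 / 2 : ℝ) := by
    rw [restrict_cell_eq_pi]
    refine le_trans ?_ key
    rw [← restrict_cell_eq_pi]
    refine setLIntegral_mono_ae' measurableSet_cell (Filter.Eventually.of_forall fun x hx => ?_)
    have : ENNReal.ofReal (u x) = ∏ i, ENNReal.ofReal (a i x) ^ (1 / 2 : ℝ) := by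
      rw [ENNReal.prod_rpow_of_nonneg (by norm_num), ← ENNReal.ofReal_prod_of_nonneg
        (fun i _ => ha0 i x), ← hua, ENNReal.ofReal_rpow_of_nonneg (sq_nonneg _) (by norm_num),
        ← Real.sqrt_eq_rpow, Real.sqrt_sq (hu0 x)]
    rw [this]
    refine Finset.prod_le_prod' fun i _ => ?_
    have e : (1 : ℝ) / ((Fintype.card (Fin 3) : ℝ) - 1) = 1 / 2 := by norm_num
    rw [e]
    refine ENNReal.rpow_le_rpow ?_ (by norm_num)
    refine (ofReal_le_lintegral_line (ha i) i hx).trans (lintegral_mono fun r => ?_)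
    exact ENNReal.ofReal_le_ofReal (hle i _)
  rw [← ofReal_integral_eq_lintegral_ofReal hu.integrableOn_cell (Filter.Eventually.of_forall hu0),
    ← ofReal_integral_eq_lintegral_ofReal hφ.integrableOn_cell (Filter.Eventually.of_forall hφ0)] at h1
  have i0 : 0 ≤ ∫ x in cell, φ x := integral_nonneg hφ0
  have j0 : 0 ≤ ∫ x in cell, u x := integral_nonneg hu0
  rw [ENNReal.ofReal_rpow_of_nonneg i0 (by norm_num),
    ENNReal.ofReal_le_ofReal_iff (by positivity)] at h1
  calc (∫ x in cell, u x) ^ 2 ≤ ((∫ x in cell, φ x) ^ (3 / 2 : ℝ)) ^ 2 := by gcongr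
    _ = (∫ x in cell, φ x) ^ 3 := by
      rw [← Real.rpow_natCast, ← Real.rpow_mul i0]; norm_num

theorem pd_pow {f : Point → ℝ} (hf : ContDiff ℝ ∞ f) (i : Fin 3) (n : ℕ) (x : Point) :
    pd i (fun y => f y ^ n) x = n * f x ^ (n - 1) * pd i f x := by
  have := ((hf.differentiable (by simp) x).hasFDerivAt.pow n).fderiv
  simp only [pd, this]
  simp

theorem integral_mul_sq_le {μ : Measure Point} {f g : Point → ℝ} (hf : Integrable (fun x => f x ^ 2) μ)
    (hg : Integrable (fun x => g x ^ 2) μ) (hfg : Integrable (fun x => f x * g x) μ) :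
    (∫ x, f x * g x ∂μ) ^ 2 ≤ (∫ x, f x ^ 2 ∂μ) * ∫ x, g x ^ 2 ∂μ := by
  have h : ∀ r : ℝ, 0 ≤ (∫ x, f x ^ 2 ∂μ) * (r * r) + (2 * ∫ x, f x * g x ∂μ) * r
      + ∫ x, g x ^ 2 ∂μ := by
    intro r
    have e : (∫ x, f x ^ 2 ∂μ) * (r * r) + (2 * ∫ x, f x * g x ∂μ) * r + ∫ x, g x ^ 2 ∂μ
        = ∫ x, (r * f x + g x) ^ 2 ∂μ := by
      rw [← integral_mul_const, ← integral_const_mul, ← integral_mul_const,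
        ← integral_add (hf.mul_const _) ((hfg.const_mul 2).mul_const r), ← integral_add _ hg]
      · exact integral_congr_ae (Filter.Eventually.of_forall fun x => by ring)
      · exact (hf.mul_const _).add ((hfg.const_mul 2).mul_const r)
    rw [e]; exact integral_nonneg fun x => sq_nonneg _
  have := discrim_le_zero h
  rw [discrim] at this
  nlinarith

/-- The embedding of `H¹` of the cell into `L⁶`. -/
theorem integral_pow_six_le {f : Point → ℝ} (hf : ContDiff ℝ ∞ f) :
    ∫ x in cell, f x ^ 6
      ≤ (∫ x in cell, (|f x| + 4 * ∑ j, |pd j f x|) ^ 2) ^ 3 := by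
  have hfc := hf.continuous
  have hpc : ∀ j, Continuous (pd j f) := continuous_pd hf
  set q : Point → ℝ := fun x => |f x| + 4 * ∑ j, |pd j f x| with hq
  have hqc : Continuous q := by fun_prop
  -- The choice aᵢ = f⁴ gives u = f⁶, while |f⁴| + |∂ᵢ(f⁴)| ≤ |f|³ q, and |f|³ is again the square
  -- root of f⁶.
  have h1 := loomis_whitney_cell (fun _ x => f x ^ 4) (fun _ => hf.pow 4) (fun _ x => by positivity)
    (fun x => |f x| ^ 3 * q x) (by fun_prop) (fun i x => by
      rw [pd_pow hf, abs_mul, abs_mul, abs_pow, abs_pow]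
      have h := Finset.single_le_sum (f := fun j => |pd j f x|) (fun j _ => abs_nonneg _)
        (Finset.mem_univ i)
      have h3 : (0 : ℝ) ≤ |f x| ^ 3 := by positivity
      simp only [hq]
      norm_num
      nlinarith [mul_le_mul_of_nonneg_left h h3]) (u := fun x => f x ^ 6) (by fun_prop)
    (fun x => by positivity) (fun x => by simp; ring)
  have h2 := integral_mul_sq_le (μ := volume.restrict cell) (f := fun x => |f x| ^ 3) (g := q)
    (Continuous.integrableOn_cell (by fun_prop)) (Continuous.integrableOn_cell (by fun_prop))
    (Continuous.integrableOn_cell (by fun_prop))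
  have e : ∀ x, (|f x| ^ 3) ^ 2 = f x ^ 6 := fun x => by
    rw [← pow_mul, show 3 * 2 = 6 from rfl, Even.pow_abs (by decide)]
  simp only [e] at h2
  set X := ∫ x in cell, f x ^ 6
  set Z := ∫ x in cell, |f x| ^ 3 * q x
  set Q := ∫ x in cell, q x ^ 2
  have hX : 0 ≤ X := integral_nonneg fun x => by positivity
  have hQ : 0 ≤ Q := integral_nonneg fun x => by positivity
  -- X² ≤ Z³ from Loomis-Whitney and Z² ≤ XQ from Cauchy-Schwarz; X³ then cancels.
  have h3 : X ^ 4 ≤ X ^ 3 * Q ^ 3 := by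
    calc X ^ 4 = (X ^ 2) ^ 2 := by ring
      _ ≤ (Z ^ 3) ^ 2 := by gcongr
      _ = (Z ^ 2) ^ 3 := by ring
      _ ≤ (X * Q) ^ 3 := by gcongr
      _ = X ^ 3 * Q ^ 3 := by ring
  rcases hX.eq_or_lt with h0 | h0
  · rw [← h0]; positivity
  · exact le_of_mul_le_mul_left (by linarith [h3]) (pow_pos h0 3)

/-- An anisotropic product inequality. -/
theorem integral_sq_mul_sq_le {F g : Point → ℝ} (hF : ContDiff ℝ ∞ F) (hg : ContDiff ℝ ∞ g) :
    (∫ x in cell, F x ^ 2 * g x ^ 2) ^ 2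
      ≤ (∫ x in cell, (3 * F x ^ 2 + pd 0 F x ^ 2 + pd 1 F x ^ 2
          + (g x ^ 4 + 2 * g x ^ 6 + 2 * pd 2 g x ^ 2))) ^ 3 := by
  have h1 := hF.continuous
  have h2 := hg.continuous
  have h3 := continuous_pd hF
  have h4 := continuous_pd hg
  -- F² is controlled along the two horizontal directions and g⁴ along the vertical one, so F is
  -- never differentiated vertically and g only vertically. The product of the three is (F²g²)².
  refine loomis_whitney_cell ![fun x => F x ^ 2, fun x => F x ^ 2, fun x => g x ^ 4] ?_ ?_ _
    (by fun_prop) ?_ (u := fun x => F x ^ 2 * g x ^ 2) (by fun_prop) (fun x => by positivity)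
    (fun x => by simp [Fin.prod_univ_three]; ring)
  · intro i; fin_cases i
    · exact hF.pow 2
    · exact hF.pow 2
    · exact hg.pow 4
  · intro i x; fin_cases i <;> simp <;> positivity
  · have hy : ∀ a b : ℝ, |a ^ 2| + |2 * a * b| ≤ 2 * a ^ 2 + b ^ 2 := fun a b => by
      have : |2 * a * b| ≤ a ^ 2 + b ^ 2 := by
        rw [abs_le]; constructor <;> nlinarith [sq_nonneg (a + b), sq_nonneg (a - b)]
      rw [abs_of_nonneg (sq_nonneg a)]; linarith
    have hz : ∀ a b : ℝ, |a ^ 4| + |4 * a ^ 3 * b| ≤ a ^ 4 + 2 * a ^ 6 + 2 * b ^ 2 := fun a b => by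
      have : |4 * a ^ 3 * b| ≤ 2 * a ^ 6 + 2 * b ^ 2 := by
        rw [abs_le]; constructor <;> nlinarith [sq_nonneg (a ^ 3 + b), sq_nonneg (a ^ 3 - b)]
      rw [abs_of_nonneg (by positivity : 0 ≤ a ^ 4)]; linarith
    intro i x
    have p2 : ∀ j, pd j (fun x => F x ^ 2) x = 2 * F x * pd j F x := fun j => by
      rw [pd_pow hF]; simp
    have p4 : pd 2 (fun x => g x ^ 4) x = 4 * g x ^ 3 * pd 2 g x := by
      rw [pd_pow hg]; simp
    have n1 : 0 ≤ F x ^ 2 := by positivity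
    have n2 : 0 ≤ pd 0 F x ^ 2 := by positivity
    have n3 : 0 ≤ pd 1 F x ^ 2 := by positivity
    have n4 : 0 ≤ g x ^ 4 + 2 * g x ^ 6 + 2 * pd 2 g x ^ 2 := by positivity
    fin_cases i
    · show |F x ^ 2| + |pd 0 (fun x => F x ^ 2) x| ≤ _
      rw [p2]; linarith [hy (F x) (pd 0 F x)]
    · show |F x ^ 2| + |pd 1 (fun x => F x ^ 2) x| ≤ _
      rw [p2]; linarith [hy (F x) (pd 1 F x)]
    · show |g x ^ 4| + |pd 2 (fun x => g x ^ 4) x| ≤ _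
      rw [p4]; linarith [hz (g x) (pd 2 g x)]

/-- The embedding of `W^{1,6}` of the cell into `L^∞`. -/
theorem abs_le_integral_add {f : Point → ℝ} (hf : ContDiff ℝ ∞ f) {x : Point} (hx : x ∈ cell) :
    |f x| ≤ (∫ y in cell, |f y|) + 2 * (1 + ∫ y in cell, (∑ j, |pd j f y|) ^ 6) := by
  have hfc := hf.continuous
  have hpc : ∀ j, Continuous (pd j f) := continuous_pd hf
  set G : Point → ℝ := fun y => ∑ j, |pd j f y| with hG
  have hGc : Continuous G := by fun_prop
  have hG0 : ∀ y, 0 ≤ G y := fun y => Finset.sum_nonneg fun _ _ => abs_nonneg _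
  -- The segment from x to y is parametrized by r². Its speed is at most 2r in each coordinate, and
  -- z ≤ 1 + z⁶ with z = rG produces the factor r⁶, exactly the Jacobian of y ↦ γ y r. Hence no
  -- singular kernel has to be integrated.
  let γ : Point → ℝ → Point := fun y r => x + r ^ 2 • (y - x)
  have hγc : Continuous fun p : Point × ℝ => γ p.1 p.2 := by fun_prop
  have h1 : ∀ y ∈ cell, |f x| ≤ |f y| + ∫ r in Ioo (0 : ℝ) 1, 2 * (1 + r ^ 6 * G (γ y r) ^ 6) := by
    intro y hy
    have hd : ∀ r : ℝ, HasDerivAt (fun r => f (γ y r))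
        (∑ j, pd j f (γ y r) * (2 * r * (y j - x j))) r := by
      intro r
      have hγ : HasDerivAt (γ y) ((2 * r) • (y - x)) r := by
        have := ((hasDerivAt_pow 2 r).smul_const (y - x)).const_add x
        simpa only [Nat.cast_ofNat, Nat.add_one_sub_one, pow_one] using this
      have h := (hf.differentiable (by simp) (γ y r)).hasFDerivAt.comp_hasDerivAt r hγ
      convert! h using 1
      conv_rhs => rw [pi_eq_sum_univ' ((2 * r) • (y - x)), map_sum]
      refine Finset.sum_congr rfl fun j _ => ?_
      rw [map_smul, smul_eq_mul, mul_comm]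
      congr 2
    have hc : Continuous fun r : ℝ => ∑ j, pd j f (γ y r) * (2 * r * (y j - x j)) := by fun_prop
    have e : ∫ r in (0 : ℝ)..1, ∑ j, pd j f (γ y r) * (2 * r * (y j - x j)) = f y - f x := by
      rw [intervalIntegral.integral_eq_sub_of_hasDerivAt (fun r _ => hd r)
        (hc.intervalIntegrable _ _)]
      simp [γ]
    have hb : |∫ r in (0 : ℝ)..1, ∑ j, pd j f (γ y r) * (2 * r * (y j - x j))|
        ≤ ∫ r in Ioo (0 : ℝ) 1, 2 * (1 + r ^ 6 * G (γ y r) ^ 6) := by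
      rw [intervalIntegral.integral_of_le zero_le_one, integral_Ioc_eq_integral_Ioo]
      have hi : ∀ ψ : ℝ → ℝ, Continuous ψ → IntegrableOn ψ (Ioo 0 1) := fun ψ hψ =>
        (hψ.continuousOn.integrableOn_compact isCompact_Icc).mono_set Ioo_subset_Icc_self
      refine (abs_integral_le_integral_abs).trans
        (setIntegral_mono_on (hi _ hc.abs) (hi _ (by fun_prop)) measurableSet_Ioo fun r hr => ?_)
      have hyx : ∀ j, |y j - x j| ≤ 1 := fun j => by
        have a := mem_cell.1 hx j
        have b := mem_cell.1 hy j
        rw [abs_le]; constructor <;> linarith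
      have s1 : |∑ j, pd j f (γ y r) * (2 * r * (y j - x j))| ≤ 2 * (r * G (γ y r)) := by
        refine (Finset.abs_sum_le_sum_abs _ _).trans ?_
        rw [hG, Finset.mul_sum, Finset.mul_sum]
        refine Finset.sum_le_sum fun j _ => ?_
        rw [abs_mul, abs_mul, abs_of_pos (by linarith [hr.1] : 0 < 2 * r)]
        have := mul_le_mul_of_nonneg_left (hyx j) (mul_nonneg (abs_nonneg (pd j f (γ y r))) hr.1.le)
        nlinarith
      have s2 : ∀ z : ℝ, 0 ≤ z → z ≤ 1 + z ^ 6 := fun z hz => by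
        rcases le_total z 1 with h | h
        · nlinarith [pow_nonneg hz 6]
        · nlinarith [le_self_pow₀ h (show 6 ≠ 0 by norm_num)]
      have s3 := s2 _ (mul_nonneg hr.1.le (hG0 (γ y r)))
      rw [mul_pow] at s3
      linarith
    rw [e] at hb
    have := abs_sub_abs_le_abs_sub (f x) (f y)
    rw [abs_sub_comm] at this
    linarith
  set I6 := ∫ y in cell, G y ^ 6 with hI6
  -- The dilation about x by r² maps the convex cell into itself, and its determinant (r²)³ absorbs
  -- r⁶.
  have hI : ∀ r ∈ Ioo (0 : ℝ) 1, ∫ y in cell, r ^ 6 * G (γ y r) ^ 6 ≤ I6 := by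
    intro r hr
    have hr2 : 0 < r ^ 2 := pow_pos hr.1 2
    set E : Set Point := (fun y => γ y r) '' cell with hE
    have hsub : E ⊆ cell := by
      rintro _ ⟨y, hy, rfl⟩
      rw [mem_cell]
      intro i
      have a := mem_cell.1 hx i
      have b := mem_cell.1 hy i
      have hr3 : r ^ 2 < 1 := pow_lt_one₀ hr.1.le hr.2 (by norm_num)
      simp only [γ, Pi.add_apply, Pi.smul_apply, Pi.sub_apply, smul_eq_mul]
      constructor <;> nlinarith
    have hcv := integral_image_eq_integral_abs_det_fderiv_smul volume measurableSet_cell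
      (f := fun y => γ y r) (f' := fun _ => r ^ 2 • ContinuousLinearMap.id ℝ Point)
      (fun y _ => (((hasFDerivAt_id y).sub_const x).const_smul (r ^ 2)).const_add x
        |>.hasFDerivWithinAt)
      (fun y _ z _ h => by simpa [γ, hr2.ne'] using h) (fun z => G z ^ 6)
    have hdet : (r ^ 2 • ContinuousLinearMap.id ℝ Point).det = r ^ 6 := by
      simp [ContinuousLinearMap.det, LinearMap.det_smul]; ring
    rw [hdet, abs_of_pos (pow_pos hr.1 6)] at hcv
    simp only [smul_eq_mul] at hcv
    rw [← hcv]
    exact setIntegral_mono_set (Continuous.integrableOn_cell (by fun_prop))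
      (Filter.Eventually.of_forall fun z => by positivity) hsub.eventuallyLE
  have hint : Integrable (fun p : Point × ℝ => 2 * (1 + p.2 ^ 6 * G (γ p.1 p.2) ^ 6))
      ((volume.restrict cell).prod (volume.restrict (Ioo (0 : ℝ) 1))) := by
    rw [Measure.prod_restrict]
    refine IntegrableOn.mono_set (t := Icc (0 : Point) 1 ×ˢ Icc (0 : ℝ) 1) ?_
      (prod_mono cell_subset_Icc Ioo_subset_Icc_self)
    exact ContinuousOn.integrableOn_compact (isCompact_Icc.prod isCompact_Icc)
      (Continuous.continuousOn (by fun_prop))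
  have h2 : ∫ _ in cell, |f x| ≤ ∫ y in cell,
      (|f y| + ∫ r in Ioo (0 : ℝ) 1, 2 * (1 + r ^ 6 * G (γ y r) ^ 6)) :=
    setIntegral_mono_on (integrable_const _) ((Continuous.integrableOn_cell hfc.abs).add
      hint.integral_prod_left) measurableSet_cell h1
  rw [integral_add (Continuous.integrableOn_cell hfc.abs) hint.integral_prod_left,
    integral_integral_swap hint] at h2
  have h3 : ∫ r in Ioo (0 : ℝ) 1, ∫ y in cell, 2 * (1 + r ^ 6 * G (γ y r) ^ 6)
      ≤ ∫ _ in Ioo (0 : ℝ) 1, 2 * (1 + I6) := by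
    refine setIntegral_mono_on hint.integral_prod_right (integrable_const _) measurableSet_Ioo fun r hr => ?_
    rw [integral_const_mul, integral_add (integrable_const _) (Continuous.integrableOn_cell (by fun_prop)),
      integral_const_cell]
    have := hI r hr
    linarith
  rw [integral_const_cell] at h2
  simp only [integral_const, measureReal_restrict_apply_univ, Real.volume_real_Ioo, smul_eq_mul]
    at h3
  norm_num at h3
  linarith

end VacuumEuler

/-! ### Bounds that are polynomial in the scale, and the calculus of L², L⁶ and L^∞ for families. -/

namespace VacuumEuler

open MeasureTheory Fam

/-- A family of time intervals `[0, T c]` and of scales `B c ≥ 1`. All bounds below are polynomial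
in the scale and uniform over the family and over the time interval. -/
structure Scale (ι : Type*) where
  T : ι → ℝ
  B : ι → ℝ
  pos : ∀ c, 0 < T c
  one_le : ∀ c, 1 ≤ B c

variable {ι : Type*} {σ : Scale ι} {w : ι → ℝ → ℝ}

/-- `X ≤ C Bⁿ w`, uniformly. -/
def PolyBdd (σ : Scale ι) (w X : ι → ℝ → ℝ) : Prop :=
  ∃ C : ℝ, 0 ≤ C ∧ ∃ n : ℕ, ∀ c, ∀ t ∈ Icc 0 (σ.T c), X c t ≤ C * σ.B c ^ n * w c t

theorem Scale.pow_pos (σ : Scale ι) (c : ι) (n : ℕ) : 0 < σ.B c ^ n :=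
  _root_.pow_pos (zero_lt_one.trans_le (σ.one_le c)) n

theorem Scale.pow_le_pow (σ : Scale ι) (c : ι) {m n : ℕ} (h : m ≤ n) : σ.B c ^ m ≤ σ.B c ^ n :=
  pow_le_pow_right₀ (σ.one_le c) h

/-- Since B ≥ 1, different exponents can be raised to a common one; this keeps the bounds C·Bⁿ
closed under sums. -/
theorem Scale.add_le (σ : Scale ι) (c : ι) {C₁ C₂ : ℝ} (h₁ : 0 ≤ C₁) (h₂ : 0 ≤ C₂) (m n : ℕ) :
    C₁ * σ.B c ^ m + C₂ * σ.B c ^ n ≤ (C₁ + C₂) * σ.B c ^ (m + n) := by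
  have a := mul_le_mul_of_nonneg_left (σ.pow_le_pow c (Nat.le_add_right m n)) h₁
  have b := mul_le_mul_of_nonneg_left (σ.pow_le_pow c (Nat.le_add_left n m)) h₂
  linarith

namespace PolyBdd

variable {X Y : ι → ℝ → ℝ}

theorem mono (hY : PolyBdd σ w Y) (h : ∀ c, ∀ t ∈ Icc 0 (σ.T c), X c t ≤ Y c t) :
    PolyBdd σ w X := by
  obtain ⟨C, hC, n, hn⟩ := hY
  exact ⟨C, hC, n, fun c t ht => (h c t ht).trans (hn c t ht)⟩

theorem mono_weight {w' : ι → ℝ → ℝ} (hX : PolyBdd σ w X) (h : ∀ c t, w c t ≤ w' c t) :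
    PolyBdd σ w' X := by
  obtain ⟨C, hC, n, hn⟩ := hX
  refine ⟨C, hC, n, fun c t ht => (hn c t ht).trans ?_⟩
  exact mul_le_mul_of_nonneg_left (h c t) (mul_nonneg hC (σ.pow_pos c n).le)

theorem add (hw : ∀ c t, 0 ≤ w c t) (hX : PolyBdd σ w X) (hY : PolyBdd σ w Y) :
    PolyBdd σ w (fun c t => X c t + Y c t) := by
  obtain ⟨C, hC, n, hn⟩ := hX
  obtain ⟨C', hC', n', hn'⟩ := hY
  refine ⟨C + C', add_nonneg hC hC', n + n', fun c t ht => ?_⟩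
  have := mul_le_mul_of_nonneg_right (σ.add_le c hC hC' n n') (hw c t)
  have := hn c t ht
  have := hn' c t ht
  linarith

theorem mul {w' : ι → ℝ → ℝ} (hw : ∀ c t, 0 ≤ w c t) (hY0 : ∀ c t, 0 ≤ Y c t)
    (hX : PolyBdd σ w X) (hY : PolyBdd σ w' Y) :
    PolyBdd σ (fun c t => w c t * w' c t) (fun c t => X c t * Y c t) := by
  obtain ⟨C, hC, n, hn⟩ := hX
  obtain ⟨C', hC', n', hn'⟩ := hY
  refine ⟨C * C', mul_nonneg hC hC', n + n', fun c t ht => ?_⟩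
  have a : 0 ≤ C * σ.B c ^ n * w c t := mul_nonneg (mul_nonneg hC (σ.pow_pos c n).le) (hw c t)
  calc X c t * Y c t ≤ (C * σ.B c ^ n * w c t) * (C' * σ.B c ^ n' * w' c t) :=
        mul_le_mul (hn c t ht) (hn' c t ht) (hY0 c t) a
    _ = _ := by rw [pow_add]; ring

theorem const {r : ℝ} (hr : 0 ≤ r) : PolyBdd σ (fun _ _ => 1) (fun _ _ => r) :=
  ⟨r, hr, 0, fun c t _ => by simp⟩

theorem pow {X : ι → ℝ → ℝ} (hX0 : ∀ c t, 0 ≤ X c t) (hX : PolyBdd σ (fun _ _ => 1) X) (n : ℕ) :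
    PolyBdd σ (fun _ _ => 1) (fun c t => X c t ^ n) := by
  induction n with
  | zero => simpa using const (σ := σ) zero_le_one
  | succ n ih =>
    have := ih.mul (fun _ _ => zero_le_one) hX0 hX
    simpa [pow_succ] using this

theorem const_mul {r : ℝ} (hr : 0 ≤ r) (hX : PolyBdd σ w X) :
    PolyBdd σ w (fun c t => r * X c t) := by
  obtain ⟨C, hC, n, hn⟩ := hX
  refine ⟨r * C, mul_nonneg hr hC, n, fun c t ht => ?_⟩
  have := mul_le_mul_of_nonneg_left (hn c t ht) hr
  calc _ ≤ _ := this
    _ = _ := by ring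

end PolyBdd

/-- The integrals over the cell are bounded. -/
def IntBdd (σ : Scale ι) (w : ι → ℝ → ℝ) (G : ι → ℝ → Point → ℝ) : Prop :=
  (∀ c, ∀ t ∈ Icc 0 (σ.T c), IntegrableOn (G c t) cell)
    ∧ PolyBdd σ w (fun c t => ∫ x in cell, G c t x)

namespace IntBdd

variable {G H : ι → ℝ → Point → ℝ}

theorem add (hw : ∀ c t, 0 ≤ w c t) (hG : IntBdd σ w G) (hH : IntBdd σ w H) :
    IntBdd σ w (fun c t x => G c t x + H c t x) :=
  ⟨fun c t ht => (hG.1 c t ht).add (hH.1 c t ht), (hG.2.add hw hH.2).mono fun c t ht =>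
    (integral_add (hG.1 c t ht) (hH.1 c t ht)).le⟩

theorem mono (hH : IntBdd σ w H) (hm : ∀ c t, Measurable (G c t)) {C : ℝ} (hC : 0 ≤ C) (n : ℕ)
    (h : ∀ c, ∀ t ∈ Icc 0 (σ.T c), ∀ x ∈ cell, |G c t x| ≤ C * σ.B c ^ n * H c t x) :
    IntBdd σ w G := by
  have hi : ∀ c, ∀ t ∈ Icc 0 (σ.T c), IntegrableOn (fun x => C * σ.B c ^ n * H c t x) cell :=
    fun c t ht => (hH.1 c t ht).const_mul _
  have hi' : ∀ c, ∀ t ∈ Icc 0 (σ.T c), IntegrableOn (G c t) cell := fun c t ht =>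
    (hi c t ht).mono' (hm c t).aestronglyMeasurable
      ((ae_restrict_iff' measurableSet_cell).2 (Filter.Eventually.of_forall (h c t ht)))
  refine ⟨hi', ?_⟩
  obtain ⟨C', hC', n', hn'⟩ := hH.2
  refine ⟨C * C', mul_nonneg hC hC', n + n', fun c t ht => ?_⟩
  calc ∫ x in cell, G c t x ≤ ∫ x in cell, C * σ.B c ^ n * H c t x :=
        setIntegral_mono_on (hi' c t ht) (hi c t ht) measurableSet_cell
          fun x hx => (le_abs_self _).trans (h c t ht x hx)
    _ = C * σ.B c ^ n * ∫ x in cell, H c t x := integral_const_mul _ _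
    _ ≤ C * σ.B c ^ n * (C' * σ.B c ^ n' * w c t) :=
        mul_le_mul_of_nonneg_left (hn' c t ht) (mul_nonneg hC (σ.pow_pos c n).le)
    _ = _ := by rw [pow_add]; ring

theorem const {r : ℝ} (hr : 0 ≤ r) : IntBdd σ (fun _ _ => 1) (fun _ _ _ => r) :=
  ⟨fun _ _ _ => integrable_const r, (PolyBdd.const hr).mono fun _ _ _ => (integral_const_cell r).le⟩

theorem mono_weight {w' : ι → ℝ → ℝ} (hG : IntBdd σ w G) (h : ∀ c t, w c t ≤ w' c t) :
    IntBdd σ w' G := ⟨hG.1, hG.2.mono_weight h⟩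

end IntBdd

/-! ### Bounds for families -/

/-- Uniform bounds in `L^∞(Ω)`. -/
def Linf (σ : Scale ι) (f : Fam ι) : Prop :=
  ∃ C : ℝ, 0 ≤ C ∧ ∃ n : ℕ, ∀ c, ∀ t ∈ Icc 0 (σ.T c), ∀ x ∈ cell, |ev f c t x| ≤ C * σ.B c ^ n

/-- Bounds in `L⁶(Ω)`. -/
def L6 (σ : Scale ι) (f : Fam ι) : Prop :=
  IntBdd σ (fun _ _ => 1) (fun c t x => ev f c t x ^ 6)

/-- Bounds in `L²(Ω)`. -/
def L2 (σ : Scale ι) (w : ι → ℝ → ℝ) (f : Fam ι) : Prop :=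
  IntBdd σ w (fun c t x => ev f c t x ^ 2)

/-- Bounds in `L²(Ω)` of the quotient by a weight. -/
def L2div (σ : Scale ι) (w : ι → ℝ → ℝ) (ρ f : Fam ι) : Prop :=
  IntBdd σ w (fun c t x => (ev f c t x / ev ρ c t x) ^ 2)

variable {f g : Fam ι}

@[fun_prop]
theorem measurable_ev (f : Fam ι) (c t) : Measurable (ev f c t) := (continuous_ev f c t).measurable

namespace Linf

theorem add (hf : Linf σ f) (hg : Linf σ g) : Linf σ (f + g) := by
  obtain ⟨C, hC, n, hn⟩ := hf
  obtain ⟨C', hC', n', hn'⟩ := hg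
  refine ⟨C + C', add_nonneg hC hC', n + n', fun c t ht x hx => ?_⟩
  exact (abs_add_le _ _).trans ((add_le_add (hn c t ht x hx) (hn' c t ht x hx)).trans
    (σ.add_le c hC hC' n n'))

theorem mul (hf : Linf σ f) (hg : Linf σ g) : Linf σ (f * g) := by
  obtain ⟨C, hC, n, hn⟩ := hf
  obtain ⟨C', hC', n', hn'⟩ := hg
  refine ⟨C * C', mul_nonneg hC hC', n + n', fun c t ht x hx => ?_⟩
  rw [ev_mul, abs_mul]
  calc _ ≤ (C * σ.B c ^ n) * (C' * σ.B c ^ n') :=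
        mul_le_mul (hn c t ht x hx) (hn' c t ht x hx) (abs_nonneg _)
          (mul_nonneg hC (σ.pow_pos c n).le)
    _ = _ := by rw [pow_add]; ring

theorem neg (hf : Linf σ f) : Linf σ (-f) := by simpa [Linf] using hf

theorem zero : Linf σ (0 : Fam ι) := ⟨0, le_rfl, 0, by simp⟩

theorem sum {κ : Type*} {s : Finset κ} {f : κ → Fam ι} (h : ∀ j, Linf σ (f j)) :
    Linf σ (∑ j ∈ s, f j) := by
  classical
  induction s using Finset.induction_on with
  | empty => simpa using zero
  | insert a s ha ih => rw [Finset.sum_insert ha]; exact (h a).add ih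

end Linf

theorem Linf.l6 (hf : Linf σ f) : L6 σ f := by
  obtain ⟨C, hC, n, hn⟩ := hf
  refine (IntBdd.const (σ := σ) zero_le_one).mono (fun c t => by fun_prop)
    (pow_nonneg hC 6) (n * 6) fun c t ht x hx => ?_
  rw [abs_pow, pow_mul, ← mul_pow, mul_one]
  exact pow_le_pow_left₀ (abs_nonneg _) (hn c t ht x hx) 6

theorem sq_le_one_add_pow_six (z : ℝ) : z ^ 2 ≤ 1 + z ^ 6 := by
  have : z ^ 6 = (z ^ 2) ^ 3 := by ring
  rw [this]
  have h := sq_nonneg z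
  set y := z ^ 2
  rcases le_total y 1 with h1 | h1
  · nlinarith [pow_nonneg h 3]
  · nlinarith [le_self_pow₀ h1 (show 3 ≠ 0 by norm_num)]

theorem L6.l2 (hf : L6 σ f) : L2 σ (fun _ _ => 1) f := by
  refine (hf.add (fun _ _ => zero_le_one) (IntBdd.const zero_le_one)).mono
    (fun c t => by fun_prop) zero_le_one 0 fun c t ht x hx => ?_
  rw [abs_of_nonneg (sq_nonneg _)]
  linarith [sq_le_one_add_pow_six (ev f c t x)]

theorem Linf.l2 (hf : Linf σ f) : L2 σ (fun _ _ => 1) f := hf.l6.l2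

theorem add_pow_six_le (a b : ℝ) : (a + b) ^ 6 ≤ 32 * (a ^ 6 + b ^ 6) := by
  have h6 : Even 6 := by decide
  rw [← h6.pow_abs (a + b), ← h6.pow_abs a, ← h6.pow_abs b]
  have := add_pow_le (abs_nonneg a) (abs_nonneg b) 6
  norm_num at this
  exact (pow_le_pow_left₀ (abs_nonneg _) (abs_add_le a b) 6).trans this

namespace L6

theorem add (hf : L6 σ f) (hg : L6 σ g) : L6 σ (f + g) := by
  refine (IntBdd.add (fun _ _ => zero_le_one) hf hg).mono (fun c t => by fun_prop)
    (show (0 : ℝ) ≤ 32 by norm_num) 0 fun c t ht x hx => ?_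
  rw [abs_of_nonneg (by positivity), ev_add]
  have h := add_pow_six_le (ev f c t x) (ev g c t x)
  linarith

theorem neg (hf : L6 σ f) : L6 σ (-f) := by
  simpa [L6, Even.neg_pow (show Even 6 by decide)] using hf

theorem linf_mul (hf : Linf σ f) (hg : L6 σ g) : L6 σ (f * g) := by
  obtain ⟨C, hC, n, hn⟩ := hf
  refine hg.mono (fun c t => by fun_prop) (pow_nonneg hC 6) (n * 6) fun c t ht x hx => ?_
  rw [ev_mul, mul_pow, abs_mul, abs_of_nonneg (by positivity : 0 ≤ ev g c t x ^ 6), abs_pow]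
  refine mul_le_mul_of_nonneg_right ?_ (by positivity)
  rw [pow_mul, ← mul_pow]
  exact pow_le_pow_left₀ (abs_nonneg _) (hn c t ht x hx) 6

theorem mul_linf (hf : L6 σ f) (hg : Linf σ g) : L6 σ (f * g) := by
  rw [mul_comm]; exact linf_mul hg hf

end L6

namespace L2

theorem add (hw : ∀ c t, 0 ≤ w c t) (hf : L2 σ w f) (hg : L2 σ w g) : L2 σ w (f + g) := by
  refine (IntBdd.add hw hf hg).mono (fun c t => by fun_prop)
    (show (0 : ℝ) ≤ 2 by norm_num) 0 fun c t ht x hx => ?_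
  rw [abs_of_nonneg (sq_nonneg _), ev_add]
  nlinarith [sq_nonneg (ev f c t x - ev g c t x)]

theorem neg (hf : L2 σ w f) : L2 σ w (-f) := by simpa [L2] using hf

theorem sub (hw : ∀ c t, 0 ≤ w c t) (hf : L2 σ w f) (hg : L2 σ w g) : L2 σ w (f - g) := by
  rw [sub_eq_add_neg]; exact hf.add hw hg.neg

theorem zero : L2 σ w (0 : Fam ι) :=
  ⟨fun c t _ => by simp, 0, le_rfl, 0, fun c t _ => by simp⟩

theorem sum (hw : ∀ c t, 0 ≤ w c t) {κ : Type*} {s : Finset κ} {f : κ → Fam ι}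
    (h : ∀ j, L2 σ w (f j)) : L2 σ w (∑ j ∈ s, f j) := by
  classical
  induction s using Finset.induction_on with
  | empty => simpa using zero
  | insert a s ha ih => rw [Finset.sum_insert ha]; exact (h a).add hw ih

theorem linf_mul (hf : Linf σ f) (hg : L2 σ w g) : L2 σ w (f * g) := by
  obtain ⟨C, hC, n, hn⟩ := hf
  refine hg.mono (fun c t => by fun_prop) (pow_nonneg hC 2) (n * 2) fun c t ht x hx => ?_
  rw [ev_mul, mul_pow, abs_mul, abs_of_nonneg (sq_nonneg (ev g c t x)), abs_pow]
  refine mul_le_mul_of_nonneg_right ?_ (by positivity)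
  rw [pow_mul, ← mul_pow]
  exact pow_le_pow_left₀ (abs_nonneg _) (hn c t ht x hx) 2

theorem mul_linf (hf : L2 σ w f) (hg : Linf σ g) : L2 σ w (f * g) := by
  rw [mul_comm]; exact linf_mul hg hf

theorem of_one (hw : ∀ c t, 1 ≤ w c t) (hf : L2 σ (fun _ _ => 1) f) : L2 σ w f :=
  hf.mono_weight hw

/-- The cell has measure one, so L⁶ controls L⁴, and 2f²g² ≤ f⁴ + g⁴. -/
theorem mul_l6 (hf : L6 σ f) (hg : L6 σ g) : L2 σ (fun _ _ => 1) (f * g) := by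
  have hw : ∀ (_ : ι) (_ : ℝ), (0 : ℝ) ≤ 1 := fun _ _ => zero_le_one
  refine (IntBdd.add hw (IntBdd.add hw hf hg) (IntBdd.const zero_le_one)).mono
    (fun c t => by fun_prop) zero_le_one 0 fun c t ht x hx => ?_
  rw [abs_of_nonneg (sq_nonneg _), ev_mul, mul_pow, pow_zero, one_mul, one_mul]
  have h4 : ∀ z : ℝ, (z ^ 2) ^ 2 ≤ 1 + z ^ 6 := fun z => by
    have : z ^ 6 = (z ^ 2) ^ 3 := by ring
    rw [this]
    have h := sq_nonneg z
    set y := z ^ 2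
    rcases le_total y 1 with h1 | h1
    · nlinarith [pow_nonneg h 3, mul_nonneg h h]
    · nlinarith [mul_nonneg (mul_nonneg h h) (sub_nonneg.2 h1)]
  nlinarith [h4 (ev f c t x), h4 (ev g c t x), sq_nonneg (ev f c t x ^ 2 - ev g c t x ^ 2)]

/-- `H¹(Ω) ⊂ L⁶(Ω)`. -/
theorem l6 (hf : L2 σ (fun _ _ => 1) f) (hD : ∀ j, L2 σ (fun _ _ => 1) (D j f)) : L6 σ f := by
  have hw : ∀ (_ : ι) (_ : ℝ), (0 : ℝ) ≤ 1 := fun _ _ => zero_le_one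
  have h := (IntBdd.add hw hf (IntBdd.add hw (hD 0) (IntBdd.add hw (hD 1) (hD 2)))).2
  refine ⟨fun c t _ => Continuous.integrableOn_cell ((continuous_ev f c t).pow 6), ?_⟩
  refine ((h.const_mul (show (0 : ℝ) ≤ 64 by norm_num)).mono
    (X := fun c t => ∫ x in cell, (|ev f c t x| + 4 * ∑ j, |pd j (ev f c t) x|) ^ 2) ?_ |>.pow
      (fun c t => integral_nonneg fun x => sq_nonneg _) 3).mono
    fun c t _ => integral_pow_six_le (contDiff_ev f c t)
  intro c t _
  have hc := continuous_ev f c t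
  have hcD := fun j => continuous_ev (D j f) c t
  rw [← integral_const_mul]
  simp only [pd_ev]
  refine setIntegral_mono_on (Continuous.integrableOn_cell (by fun_prop))
    (Continuous.integrableOn_cell (by fun_prop)) measurableSet_cell fun x _ => ?_
  rw [Fin.sum_univ_three, ← sq_abs (ev f c t x), ← sq_abs (ev (D 0 f) c t x),
    ← sq_abs (ev (D 1 f) c t x), ← sq_abs (ev (D 2 f) c t x)]
  generalize |ev f c t x| = p
  generalize |ev (D 0 f) c t x| = q
  generalize |ev (D 1 f) c t x| = r
  generalize |ev (D 2 f) c t x| = s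
  nlinarith [sq_nonneg (p - 4 * q), sq_nonneg (p - 4 * r), sq_nonneg (p - 4 * s),
    sq_nonneg (q - r), sq_nonneg (q - s), sq_nonneg (r - s), sq_nonneg p, sq_nonneg q,
    sq_nonneg r, sq_nonneg s]

/-- `W^{1,6}(Ω) ⊂ L^∞(Ω)`. -/
theorem linf (hf : L2 σ (fun _ _ => 1) f) (hD : ∀ j, L6 σ (D j f)) : Linf σ f := by
  have hw : ∀ (_ : ι) (_ : ℝ), (0 : ℝ) ≤ 1 := fun _ _ => zero_le_one
  have h1 : IntBdd σ (fun _ _ => 1) (fun c t x => |ev f c t x|) := by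
    refine (IntBdd.add hw hf (IntBdd.const zero_le_one)).mono (fun c t => by fun_prop)
      zero_le_one 0 fun c t _ x _ => ?_
    rw [abs_abs]; nlinarith [sq_abs (ev f c t x), sq_nonneg (|ev f c t x| - 1)]
  have h2 : IntBdd σ (fun _ _ => 1) (fun c t x => (∑ j, |ev (D j f) c t x|) ^ 6) := by
    refine (IntBdd.add hw (hD 0) (IntBdd.add hw (hD 1) (hD 2))).mono (fun c t => by fun_prop)
      (show (0 : ℝ) ≤ 1024 by norm_num) 0 fun c t _ x _ => ?_
    rw [Fin.sum_univ_three, abs_of_nonneg (by positivity), add_assoc]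
    have h6 : Even 6 := by decide
    have e1 := add_pow_six_le |ev (D 0 f) c t x| (|ev (D 1 f) c t x| + |ev (D 2 f) c t x|)
    have e2 := add_pow_six_le |ev (D 1 f) c t x| |ev (D 2 f) c t x|
    simp only [h6.pow_abs] at e1 e2
    have := h6.pow_nonneg (ev (D 0 f) c t x)
    linarith
  have h3 := (h1.2.add hw (((PolyBdd.const zero_le_one).add hw h2.2).const_mul zero_le_two))
  obtain ⟨C, hC, n, hn⟩ := h3
  refine ⟨C, hC, n, fun c t ht x hx => ?_⟩
  have := abs_le_integral_add (contDiff_ev f c t) hx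
  simp only [pd_ev] at this
  simpa using this.trans (hn c t ht)

/-- The anisotropic product estimate. -/
theorem mul_of_horizontal (hw : ∀ c t, 1 ≤ w c t) (hf : L2 σ (fun _ _ => 1) f)
    (h0 : L2 σ w (D 0 f)) (h1 : L2 σ w (D 1 f)) (hg : L6 σ g)
    (h2 : L2 σ (fun _ _ => 1) (D 2 g)) : L2 σ w (f * g) := by
  have hw0 : ∀ c t, 0 ≤ w c t := fun c t => zero_le_one.trans (hw c t)
  have hu : ∀ (_ : ι) (_ : ℝ), (0 : ℝ) ≤ 1 := fun _ _ => zero_le_one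
  refine ⟨fun c t _ => Continuous.integrableOn_cell ((continuous_ev _ c t).pow 2), ?_⟩
  -- Dividing f by √w makes all terms of order one. The nonlinear inequality is then harmless, and
  -- the result is linear in w after multiplying back, as integrability of w in time demands.
  have key : PolyBdd σ (fun _ _ => 1) (fun c t => ∫ x in cell,
      (3 * (ev f c t x / √(w c t)) ^ 2 + (ev (D 0 f) c t x / √(w c t)) ^ 2
        + (ev (D 1 f) c t x / √(w c t)) ^ 2
        + (ev g c t x ^ 4 + 2 * ev g c t x ^ 6 + 2 * ev (D 2 g) c t x ^ 2))) := by
    have a := hf.of_one hw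
    have q : ∀ {u : Fam ι}, L2 σ w u →
        IntBdd σ (fun _ _ => 1) (fun c t x => (ev u c t x / √(w c t)) ^ 2) := by
      intro u hu
      refine ⟨fun c t ht => ?_, ?_⟩
      · exact Continuous.integrableOn_cell (((continuous_ev u c t).div_const _).pow 2)
      · obtain ⟨C, hC, n, hn⟩ := hu.2
        refine ⟨C, hC, n, fun c t ht => ?_⟩
        have hw1 : 0 < w c t := zero_lt_one.trans_le (hw c t)
        simp only [div_pow, Real.sq_sqrt hw1.le]
        rw [integral_div, div_le_iff₀ hw1, mul_one]
        exact hn c t ht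
    refine ((IntBdd.add hu (IntBdd.add hu (q a) (IntBdd.add hu (q h0) (q h1)))
      (IntBdd.add hu (IntBdd.const zero_le_one) (IntBdd.add hu hg h2))).mono
      (fun c t => by fun_prop) (show (0 : ℝ) ≤ 3 by norm_num) 0 fun c t _ x _ => ?_).2
    rw [abs_of_nonneg (by positivity), pow_zero, mul_one]
    have e4 : ev g c t x ^ 4 ≤ 1 + ev g c t x ^ 6 := by
      have e := sq_nonneg (ev g c t x)
      have e6 : ev g c t x ^ 6 = (ev g c t x ^ 2) ^ 3 := by ring
      have e4 : ev g c t x ^ 4 = (ev g c t x ^ 2) ^ 2 := by ring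
      rw [e6, e4]
      set y := ev g c t x ^ 2
      rcases le_total y 1 with h1 | h1
      · nlinarith [pow_nonneg e 3, mul_nonneg e e]
      · nlinarith [mul_nonneg (mul_nonneg e e) (sub_nonneg.2 h1)]
    nlinarith [sq_nonneg (ev (D 0 f) c t x / √(w c t)), sq_nonneg (ev (D 1 f) c t x / √(w c t)),
      sq_nonneg (ev (D 2 g) c t x)]
  have hnn : ∀ c t, 0 ≤ ∫ x in cell,
      (3 * (ev f c t x / √(w c t)) ^ 2 + (ev (D 0 f) c t x / √(w c t)) ^ 2
        + (ev (D 1 f) c t x / √(w c t)) ^ 2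
        + (ev g c t x ^ 4 + 2 * ev g c t x ^ 6 + 2 * ev (D 2 g) c t x ^ 2)) := fun c t =>
    integral_nonneg fun x => by positivity
  have k3 := (PolyBdd.const (σ := σ) zero_le_one).add hu (key.pow hnn 3)
  obtain ⟨C, hC, n, hn⟩ := k3
  refine ⟨C, hC, n, fun c t ht => ?_⟩
  have hw1 : 0 < w c t := zero_lt_one.trans_le (hw c t)
  have hF : ContDiff ℝ ∞ fun x => ev f c t x / √(w c t) := (contDiff_ev f c t).div_const _
  have hpd : ∀ j x, pd j (fun x => ev f c t x / √(w c t)) x = ev (D j f) c t x / √(w c t) := by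
    intro j x
    rw [← pd_ev]
    simp only [pd, div_eq_mul_inv]
    rw [fderiv_mul_const ((contDiff_ev f c t).differentiable (by simp) x)]
    simp [mul_comm]
  have h := integral_sq_mul_sq_le hF (contDiff_ev g c t)
  simp only [hpd, pd_ev] at h
  have e : ∫ x in cell, (ev f c t x / √(w c t)) ^ 2 * ev g c t x ^ 2
      = (∫ x in cell, ev (f * g) c t x ^ 2) / w c t := by
    rw [← integral_div]
    refine integral_congr_ae (Filter.Eventually.of_forall fun x => ?_)
    simp only [ev_mul, div_pow, Real.sq_sqrt hw1.le]; ring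
  rw [e] at h
  have h' := hn c t ht
  rw [mul_one] at h'
  rw [← div_le_iff₀ hw1]
  set z := (∫ x in cell, ev (f * g) c t x ^ 2) / w c t
  refine le_trans ?_ h'
  -- Only z² is bounded by the product inequality; z ≤ 1 + z².
  nlinarith [sq_nonneg (z - 1)]

end L2

end VacuumEuler

/-! ### Regular coefficients, their products and inverses, and commutators with four horizontal
derivatives. -/

namespace VacuumEuler

open MeasureTheory Fam

variable {ι : Type*} {σ : Scale ι} {w : ι → ℝ → ℝ}

/-! ### Equality on the space-time domain -/

/-- Equality of two families on `[0,T] × closedSlab`. -/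
def EqQ (σ : Scale ι) (f g : Fam ι) : Prop :=
  ∀ c, ∀ t ∈ Icc 0 (σ.T c), ∀ x ∈ closedSlab, ev f c t x = ev g c t x

theorem isOpen_slab : IsOpen slab :=
  (isOpen_lt continuous_const (continuous_apply 2)).inter
    (isOpen_lt (continuous_apply 2) continuous_const)

theorem closedSlab_subset_closure : closedSlab ⊆ closure slab := by
  have : slab = (fun x : Point => x 2) ⁻¹' Ioo 0 1 := rfl
  rw [this, ← (isOpenMap_eval 2).preimage_closure_eq_closure_preimage (continuous_apply 2),
    closure_Ioo (by norm_num)]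
  exact fun x hx => hx

/-- Continuous functions that agree on `(0,T) × slab` agree on `[0,T] × closedSlab`. -/
theorem eqOn_closed_of_open {T : ℝ} (hT : 0 < T) {u v : SpaceTime → ℝ} (hu : Continuous u)
    (hv : Continuous v) (h : EqOn u v (Ioo 0 T ×ˢ slab)) : EqOn u v (Icc 0 T ×ˢ closedSlab) := by
  refine (h.closure hu hv).mono ?_
  rw [closure_prod_eq, closure_Ioo hT.ne]
  exact prod_mono le_rfl closedSlab_subset_closure

theorem eqQ_of_open {f g : Fam ι} (h : ∀ c, ∀ t ∈ Ioo 0 (σ.T c), ∀ x ∈ slab,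
    ev f c t x = ev g c t x) : EqQ σ f g := fun c t ht x hx =>
  eqOn_closed_of_open (σ.pos c) (continuous f c) (continuous g c)
    (fun p hp => h c p.1 hp.1 p.2 hp.2) (show (t, x) ∈ Icc 0 (σ.T c) ×ˢ closedSlab from ⟨ht, hx⟩)

namespace EqQ

variable {f g f' g' : Fam ι}

/-- The derivatives agree on the open set (0,T) × slab and hence, by continuity, up to its closure.
Thus identities that hold only on the closed domain may still be differentiated, also in time at t =
0. -/
theorem dir (h : EqQ σ f g) (v : SpaceTime) : EqQ σ (Fam.dir v f) (Fam.dir v g) := by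
  refine eqQ_of_open fun c t ht x hx => ?_
  have ho : IsOpen (Ioo 0 (σ.T c) ×ˢ slab) := isOpen_Ioo.prod isOpen_slab
  have he : f.1 c =ᶠ[nhds (t, x)] g.1 c := by
    filter_upwards [ho.mem_nhds (show (t, x) ∈ Ioo 0 (σ.T c) ×ˢ slab from ⟨ht, hx⟩)] with p hp
    exact h c p.1 (Ioo_subset_Icc_self hp.1) p.2 (slab_subset_closedSlab hp.2)
  exact congrArg (fun L : SpaceTime →L[ℝ] ℝ => L v) he.fderiv_eq

theorem D (h : EqQ σ f g) (k : Fin 3) : EqQ σ (Fam.D k f) (Fam.D k g) := h.dir _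
theorem Dt (h : EqQ σ f g) : EqQ σ (Fam.Dt f) (Fam.Dt g) := h.dir _

theorem mul (h : EqQ σ f g) (h' : EqQ σ f' g') : EqQ σ (f * f') (g * g') :=
  fun c t ht x hx => by rw [ev_mul, ev_mul, h c t ht x hx, h' c t ht x hx]

theorem add (h : EqQ σ f g) (h' : EqQ σ f' g') : EqQ σ (f + f') (g + g') :=
  fun c t ht x hx => by rw [ev_add, ev_add, h c t ht x hx, h' c t ht x hx]

end EqQ

theorem cell_subset_closedSlab : cell ⊆ closedSlab :=
  cell_subset_slab.trans slab_subset_closedSlab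

variable {f g h r s ρ : Fam ι}

theorem Linf.congr (hf : Linf σ f) (e : EqQ σ g f) : Linf σ g := by
  obtain ⟨C, hC, n, hn⟩ := hf
  refine ⟨C, hC, n, fun c t ht x hx => ?_⟩
  rw [e c t ht x (cell_subset_closedSlab hx)]; exact hn c t ht x hx

theorem L6.congr (hf : L6 σ f) (e : EqQ σ g f) : L6 σ g :=
  hf.mono (fun c t => by fun_prop) zero_le_one 0 fun c t ht x hx => by
    rw [e c t ht x (cell_subset_closedSlab hx), abs_of_nonneg (by positivity)]; simp

theorem L2.congr (hf : L2 σ w f) (e : EqQ σ g f) : L2 σ w g :=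
  hf.mono (fun c t => by fun_prop) zero_le_one 0 fun c t ht x hx => by
    rw [e c t ht x (cell_subset_closedSlab hx), abs_of_nonneg (by positivity)]; simp

/-! ### Domination -/

/-- `|r| ≤ C Bⁿ |s|`. -/
def Dom (σ : Scale ι) (r s : Fam ι) : Prop :=
  ∃ C : ℝ, 0 ≤ C ∧ ∃ n : ℕ, ∀ c, ∀ t ∈ Icc 0 (σ.T c), ∀ x ∈ cell,
    |ev r c t x| ≤ C * σ.B c ^ n * |ev s c t x|

namespace Dom

variable {r' s' : Fam ι}

theorem refl (r : Fam ι) : Dom σ r r := ⟨1, zero_le_one, 0, fun c t _ x _ => by simp⟩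

theorem add (hr : Dom σ r s) (hr' : Dom σ r' s) : Dom σ (r + r') s := by
  obtain ⟨C, hC, n, hn⟩ := hr
  obtain ⟨C', hC', n', hn'⟩ := hr'
  refine ⟨C + C', add_nonneg hC hC', n + n', fun c t ht x hx => ?_⟩
  refine (abs_add_le _ _).trans ((add_le_add (hn c t ht x hx) (hn' c t ht x hx)).trans ?_)
  rw [← add_mul]
  exact mul_le_mul_of_nonneg_right (σ.add_le c hC hC' n n') (abs_nonneg _)

theorem mul (hr : Dom σ r s) (hr' : Dom σ r' s') : Dom σ (r * r') (s * s') := by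
  obtain ⟨C, hC, n, hn⟩ := hr
  obtain ⟨C', hC', n', hn'⟩ := hr'
  refine ⟨C * C', mul_nonneg hC hC', n + n', fun c t ht x hx => ?_⟩
  rw [ev_mul, ev_mul, abs_mul, abs_mul]
  calc _ ≤ (C * σ.B c ^ n * |ev s c t x|) * (C' * σ.B c ^ n' * |ev s' c t x|) :=
        mul_le_mul (hn c t ht x hx) (hn' c t ht x hx) (abs_nonneg _)
          (mul_nonneg (mul_nonneg hC (σ.pow_pos c n).le) (abs_nonneg _))
    _ = _ := by rw [pow_add]; ring

end Dom

theorem L2.of_dom (hf : L2 σ w (s * f)) (hr : Dom σ r s) : L2 σ w (r * f) := by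
  obtain ⟨C, hC, n, hn⟩ := hr
  refine hf.mono (fun c t => by fun_prop) (pow_nonneg hC 2) (n * 2) fun c t ht x hx => ?_
  rw [abs_of_nonneg (sq_nonneg _), ev_mul, ev_mul, mul_pow, mul_pow, ← mul_assoc]
  refine mul_le_mul_of_nonneg_right ?_ (sq_nonneg _)
  rw [← sq_abs (ev r c t x), ← sq_abs (ev s c t x), pow_mul, ← mul_pow, ← mul_pow]
  exact pow_le_pow_left₀ (abs_nonneg _) (hn c t ht x hx) 2

namespace L2div

theorem add (hw : ∀ c t, 0 ≤ w c t) (hf : L2div σ w ρ f) (hg : L2div σ w ρ g) :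
    L2div σ w ρ (f + g) := by
  refine (IntBdd.add hw hf hg).mono (fun c t => by fun_prop)
    (show (0 : ℝ) ≤ 2 by norm_num) 0 fun c t ht x hx => ?_
  rw [abs_of_nonneg (sq_nonneg _), ev_add, add_div]
  nlinarith [sq_nonneg (ev f c t x / ev ρ c t x - ev g c t x / ev ρ c t x)]

theorem of_dom (hρ : ∀ c, ∀ t ∈ Icc 0 (σ.T c), ∀ x ∈ cell, 0 < ev ρ c t x)
    (hf : L2 σ w (s * f)) (hr : Dom σ r (ρ * s)) : L2div σ w ρ (r * f) := by
  obtain ⟨C, hC, n, hn⟩ := hr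
  refine hf.mono (fun c t => by fun_prop) (pow_nonneg hC 2) (n * 2) fun c t ht x hx => ?_
  have h0 := hρ c t ht x hx
  have h1 := hn c t ht x hx
  rw [ev_mul, abs_mul, abs_of_pos h0] at h1
  rw [abs_of_nonneg (sq_nonneg _), ev_mul, ev_mul, mul_pow, mul_div_right_comm, mul_pow, ← mul_assoc]
  refine mul_le_mul_of_nonneg_right ?_ (sq_nonneg _)
  rw [← sq_abs (ev r c t x / ev ρ c t x), ← sq_abs (ev s c t x), pow_mul, ← mul_pow, ← mul_pow]
  refine pow_le_pow_left₀ (abs_nonneg _) ?_ 2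
  rw [abs_div, abs_of_pos h0, div_le_iff₀ h0]
  linarith

theorem neg (hf : L2div σ w ρ f) : L2div σ w ρ (-f) := by simpa [L2div, neg_div] using hf

theorem zero : L2div σ w ρ (0 : Fam ι) :=
  ⟨fun c t _ => by simp, 0, le_rfl, 0, fun c t _ => by simp⟩

theorem sum (hw : ∀ c t, 0 ≤ w c t) {κ : Type*} {s : Finset κ} {f : κ → Fam ι}
    (h : ∀ j, L2div σ w ρ (f j)) : L2div σ w ρ (∑ j ∈ s, f j) := by
  classical
  induction s using Finset.induction_on with
  | empty => simpa using zero
  | insert a s ha ih => rw [Finset.sum_insert ha]; exact add hw (h a) ih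

theorem congr (hf : L2div σ w ρ f) (e : EqQ σ g f) : L2div σ w ρ g :=
  hf.mono (fun c t => by fun_prop) zero_le_one 0 fun c t ht x hx => by
    rw [e c t ht x (cell_subset_closedSlab hx), abs_of_nonneg (by positivity)]; simp

end L2div

/-! ### Leibniz formulas -/

theorem leibniz_two (j k : Fin 3) (f g : Fam ι) :
    D j (D k (f * g)) = f * D j (D k g) + D j (D k f) * g + (D j f * D k g + D k f * D j g) := by
  simp only [D_mul, map_add]; ring

theorem leibniz_three (j k l : Fin 3) (f g : Fam ι) :
    D j (D k (D l (f * g))) = f * D j (D k (D l g)) + D j (D k (D l f)) * g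
      + (D j f * D k (D l g) + D k f * D j (D l g) + D l f * D j (D k g)
        + (D j (D k f) * D l g + D j (D l f) * D k g + D k (D l f) * D j g)) := by
  simp only [D_mul, map_add]; ring

theorem leibniz_four (j k l m : Fin 3) (f g : Fam ι) :
    D j (D k (D l (D m (f * g)))) = f * D j (D k (D l (D m g))) + D j (D k (D l (D m f))) * g
      + ((D j f * D k (D l (D m g)) + D k f * D j (D l (D m g)) + D l f * D j (D k (D m g))
          + D m f * D j (D k (D l g)))
        + (D k (D l (D m f)) * D j g + D j (D l (D m f)) * D k g + D j (D k (D m f)) * D l g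
          + D j (D k (D l f)) * D m g)
        + (D j (D k f) * D l (D m g) + D j (D l f) * D k (D m g) + D j (D m f) * D k (D l g)
          + (D k (D l f) * D j (D m g) + D k (D m f) * D j (D l g) + D l (D m f) * D j (D k g)))) := by
  simp only [D_mul, map_add]; ring

/-! ### The algebra of regular families -/

/-- The bounds available for a family in `H³(Ω)`. -/
structure Reg (σ : Scale ι) (f : Fam ι) : Prop where
  d0 : Linf σ f
  d1 : ∀ j, Linf σ (D j f)
  d2 : ∀ j k, L6 σ (D j (D k f))
  d3 : ∀ j k l, L2 σ (fun _ _ => 1) (D j (D k (D l f)))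

/-- The bounds of `Reg`, and a weighted `L²` bound for four horizontal derivatives. -/
structure Reg4 (σ : Scale ι) (ρ f : Fam ι) : Prop extends Reg σ f where
  d4 : ∀ a b c d : Fin 2, L2 σ (fun _ _ => 1)
    (ρ * D a.castSucc (D b.castSucc (D c.castSucc (D d.castSucc f))))

theorem weight_one : ∀ (_ : ι) (_ : ℝ), (0 : ℝ) ≤ 1 := fun _ _ => zero_le_one

/-- The embeddings H¹ ⊂ L⁶ and W^{1,6} ⊂ L^∞ are applied at each order, each using one more
derivative. -/
theorem Reg.of_sobolev (h0 : L2 σ (fun _ _ => 1) f) (h1 : ∀ j, L2 σ (fun _ _ => 1) (D j f))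
    (h2 : ∀ j k, L2 σ (fun _ _ => 1) (D j (D k f)))
    (h3 : ∀ j k l, L2 σ (fun _ _ => 1) (D j (D k (D l f)))) : Reg σ f where
  d0 := h0.linf fun j => (h1 j).l6 fun k => h2 k j
  d1 := fun j => (h1 j).linf fun k => (h2 k j).l6 fun l => h3 l k j
  d2 := fun j k => (h2 j k).l6 fun l => h3 l j k
  d3 := h3

theorem Reg.mul (hf : Reg σ f) (hg : Reg σ g) : Reg σ (f * g) where
  d0 := hf.d0.mul hg.d0
  d1 := fun j => by
    rw [D_mul]; exact ((hf.d1 j).mul hg.d0).add (hf.d0.mul (hg.d1 j))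
  d2 := fun j k => by
    rw [leibniz_two]
    exact ((L6.linf_mul hf.d0 (hg.d2 j k)).add ((hf.d2 j k).mul_linf hg.d0)).add
      (((hf.d1 j).mul (hg.d1 k)).add ((hf.d1 k).mul (hg.d1 j))).l6
  d3 := fun j k l => by
    rw [leibniz_three]
    have t1 : ∀ j k l, L2 σ (fun _ _ => 1) (D j f * D k (D l g)) := fun j k l =>
      L2.linf_mul (hf.d1 j) (hg.d2 k l).l2
    have t2 : ∀ j k l, L2 σ (fun _ _ => 1) (D j (D k f) * D l g) := fun j k l =>
      L2.mul_linf (hf.d2 j k).l2 (hg.d1 l)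
    exact ((L2.linf_mul hf.d0 (hg.d3 j k l)).add weight_one ((hf.d3 j k l).mul_linf hg.d0)).add
      weight_one (.add weight_one (.add weight_one (.add weight_one (t1 _ _ _) (t1 _ _ _)) (t1 _ _ _))
        (.add weight_one (.add weight_one (t2 _ _ _) (t2 _ _ _)) (t2 _ _ _)))

/-- The distributions (1,3) and (3,1) of the four derivatives pair L^∞ with L², and (2,2) pairs L⁶
with L⁶. Only the terms where one factor takes all four derivatives are missing, and these need the
weight. -/
theorem Reg.leibniz_rem (hf : Reg σ f) (hg : Reg σ g) (j k l m : Fin 3) :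
    L2 σ (fun _ _ => 1) ((D j f * D k (D l (D m g)) + D k f * D j (D l (D m g))
        + D l f * D j (D k (D m g)) + D m f * D j (D k (D l g)))
      + (D k (D l (D m f)) * D j g + D j (D l (D m f)) * D k g + D j (D k (D m f)) * D l g
        + D j (D k (D l f)) * D m g)
      + (D j (D k f) * D l (D m g) + D j (D l f) * D k (D m g) + D j (D m f) * D k (D l g)
        + (D k (D l f) * D j (D m g) + D k (D m f) * D j (D l g) + D l (D m f) * D j (D k g)))) := by
  have t1 : ∀ j k l m, L2 σ (fun _ _ => 1) (D j f * D k (D l (D m g))) := fun j k l m =>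
    L2.linf_mul (hf.d1 j) (hg.d3 k l m)
  have t3 : ∀ j k l m, L2 σ (fun _ _ => 1) (D j (D k (D l f)) * D m g) := fun j k l m =>
    L2.mul_linf (hf.d3 j k l) (hg.d1 m)
  have t2 : ∀ j k l m, L2 σ (fun _ _ => 1) (D j (D k f) * D l (D m g)) := fun j k l m =>
    L2.mul_l6 (hf.d2 j k) (hg.d2 l m)
  have a4 : ∀ {p q r s : Fam ι}, L2 σ (fun _ _ => 1) p → L2 σ (fun _ _ => 1) q →
      L2 σ (fun _ _ => 1) r → L2 σ (fun _ _ => 1) s → L2 σ (fun _ _ => 1) (p + q + r + s) :=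
    fun hp hq hr hs => ((hp.add weight_one hq).add weight_one hr).add weight_one hs
  exact .add weight_one (.add weight_one (a4 (t1 _ _ _ _) (t1 _ _ _ _) (t1 _ _ _ _) (t1 _ _ _ _))
    (a4 (t3 _ _ _ _) (t3 _ _ _ _) (t3 _ _ _ _) (t3 _ _ _ _)))
    (a4 (t2 _ _ _ _) (t2 _ _ _ _) (t2 _ _ _ _)
      (.add weight_one (.add weight_one (t2 _ _ _ _) (t2 _ _ _ _)) (t2 _ _ _ _)))

theorem Reg4.mul (hρ : Linf σ ρ) (hf : Reg4 σ ρ f) (hg : Reg4 σ ρ g) : Reg4 σ ρ (f * g) where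
  toReg := hf.toReg.mul hg.toReg
  d4 := fun a b c d => by
    rw [leibniz_four, mul_add, mul_add]
    refine .add weight_one (.add weight_one ?_ ?_)
      (L2.linf_mul hρ (hf.toReg.leibniz_rem hg.toReg _ _ _ _))
    · rw [mul_left_comm]; exact L2.linf_mul hf.d0 (hg.d4 a b c d)
    · rw [← mul_assoc]; exact (hf.d4 a b c d).mul_linf hg.d0

theorem Reg4.add (hf : Reg4 σ ρ f) (hg : Reg4 σ ρ g) : Reg4 σ ρ (f + g) where
  d0 := hf.d0.add hg.d0
  d1 := fun j => by rw [map_add]; exact (hf.d1 j).add (hg.d1 j)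
  d2 := fun j k => by simp only [map_add]; exact (hf.d2 j k).add (hg.d2 j k)
  d3 := fun j k l => by simp only [map_add]; exact (hf.d3 j k l).add weight_one (hg.d3 j k l)
  d4 := fun a b c d => by
    simp only [map_add, mul_add]; exact (hf.d4 a b c d).add weight_one (hg.d4 a b c d)

theorem Reg4.neg (hf : Reg4 σ ρ f) : Reg4 σ ρ (-f) where
  d0 := hf.d0.neg
  d1 := fun j => by rw [map_neg]; exact (hf.d1 j).neg
  d2 := fun j k => by simp only [map_neg]; exact (hf.d2 j k).neg
  d3 := fun j k l => by simp only [map_neg]; exact (hf.d3 j k l).neg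
  d4 := fun a b c d => by
    simp only [map_neg]
    have := (hf.d4 a b c d).neg
    rwa [show ∀ p q : Fam ι, -(p * q) = p * -q from fun p q => by ring] at this

theorem Reg4.sub (hf : Reg4 σ ρ f) (hg : Reg4 σ ρ g) : Reg4 σ ρ (f - g) := by
  rw [sub_eq_add_neg]; exact hf.add hg.neg

/-- A bounded inverse of a regular family is regular. -/
theorem Reg4.inv (hρ : Linf σ ρ) (hf : Reg4 σ ρ f) (hh : Linf σ h) (e : EqQ σ (f * h) 1) :
    Reg4 σ ρ h := by
  have e1 : ∀ j, EqQ σ (D j (f * h)) 0 := fun j => by simpa using e.D j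
  have e2 : ∀ j k, EqQ σ (D j (D k (f * h))) 0 := fun j k => by simpa using (e1 k).D j
  have e3 : ∀ j k l, EqQ σ (D j (D k (D l (f * h)))) 0 := fun j k l => by simpa using (e2 k l).D j
  have e4 : ∀ j k l m, EqQ σ (D j (D k (D l (D m (f * h))))) 0 := fun j k l m => by
    simpa using (e3 k l m).D j
  -- At each order the top derivative of h is solved for from the differentiated identity f h = 1:
  -- multiply by h and replace h f by 1. The same device gives `d2`, `d3` and the weighted fourth
  -- order.
  have d1 : ∀ j, Linf σ (D j h) := fun j => by
    refine ((hh.mul hh).mul (hf.d1 j)).neg.congr fun c t ht x hx => ?_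
    have a := e c t ht x hx
    have b := e1 j c t ht x hx
    rw [D_mul] at b
    simp only [ev_mul, ev_add, ev_one, ev_zero, ev_neg] at a b ⊢
    linear_combination ev h c t x * b - ev (D j h) c t x * a
  have d2 : ∀ j k, L6 σ (D j (D k h)) := fun j k => by
    have hr : L6 σ (h * (D j (D k f) * h + (D j f * D k h + D k f * D j h))) :=
      L6.linf_mul hh (((hf.d2 j k).mul_linf hh).add
        (((hf.d1 j).mul (d1 k)).add ((hf.d1 k).mul (d1 j))).l6)
    refine hr.neg.congr fun c t ht x hx => ?_
    have a := e c t ht x hx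
    have b := e2 j k c t ht x hx
    rw [leibniz_two, add_assoc] at b
    rw [ev_neg, ev_mul h]
    rw [ev_add (f * _), ev_mul f, ev_zero] at b
    rw [ev_mul, ev_one] at a
    linear_combination ev h c t x * b - ev (D j (D k h)) c t x * a
  have d3 : ∀ j k l, L2 σ (fun _ _ => 1) (D j (D k (D l h))) := fun j k l => by
    have t1 : ∀ j k l, L2 σ (fun _ _ => 1) (D j f * D k (D l h)) := fun j k l =>
      L2.linf_mul (hf.d1 j) (d2 k l).l2
    have t2 : ∀ j k l, L2 σ (fun _ _ => 1) (D j (D k f) * D l h) := fun j k l =>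
      L2.mul_linf (hf.d2 j k).l2 (d1 l)
    have hr := L2.linf_mul hh (((hf.d3 j k l).mul_linf hh).add weight_one
      (.add weight_one (.add weight_one (.add weight_one (t1 j k l) (t1 k j l)) (t1 l j k))
        (.add weight_one (.add weight_one (t2 j k l) (t2 j l k)) (t2 k l j))))
    refine hr.neg.congr fun c t ht x hx => ?_
    have a := e c t ht x hx
    have b := e3 j k l c t ht x hx
    rw [leibniz_three, add_assoc] at b
    rw [ev_neg, ev_mul h]
    rw [ev_add (f * _), ev_mul f, ev_zero] at b
    rw [ev_mul, ev_one] at a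
    linear_combination ev h c t x * b - ev (D j (D k (D l h))) c t x * a
  have hr : Reg σ h := ⟨hh, d1, d2, d3⟩
  refine ⟨hr, fun a b c d => ?_⟩
  have hr := L2.linf_mul hh (((hf.d4 a b c d).mul_linf hh).add weight_one
    (L2.linf_mul hρ (hf.toReg.leibniz_rem hr a.castSucc b.castSucc c.castSucc d.castSucc)))
  refine hr.neg.congr fun i t ht x hx => ?_
  have p := e i t ht x hx
  have q := e4 a.castSucc b.castSucc c.castSucc d.castSucc i t ht x hx
  rw [leibniz_four, add_assoc] at q
  rw [ev_neg, ev_mul h, ev_add (_ * h), mul_assoc ρ, ev_mul ρ, ev_mul ρ, ev_mul ρ]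
  rw [ev_add (f * _), ev_mul f, ev_zero, ev_add (_ * h)] at q
  rw [ev_mul, ev_one] at p
  linear_combination ev ρ i t x * ev h i t x * q
    - ev ρ i t x * ev (D a.castSucc (D b.castSucc (D c.castSucc (D d.castSucc h)))) i t x * p

/-! ### Commutator estimates -/

/-- The weight `ρ` is positive and bounded, and its horizontal derivatives are dominated by it. -/
structure HWeight (σ : Scale ι) (ρ : Fam ι) : Prop where
  pos : ∀ c, ∀ t ∈ Icc 0 (σ.T c), ∀ x ∈ cell, 0 < ev ρ c t x
  linf : Linf σ ρ
  dom1 : ∀ a : Fin 2, Dom σ (D a.castSucc ρ) ρ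
  dom2 : ∀ a b : Fin 2, Dom σ (D a.castSucc (D b.castSucc ρ)) ρ
  dom3 : ∀ a b c : Fin 2, Dom σ (D a.castSucc (D b.castSucc (D c.castSucc ρ))) ρ
  dom4 : ∀ a b c d : Fin 2,
    Dom σ (D a.castSucc (D b.castSucc (D c.castSucc (D d.castSucc ρ)))) ρ

/-- The bounds available for a family in `H²(Ω)`, with a weighted bound for three horizontal
derivatives. -/
structure Mid (σ : Scale ι) (w : ι → ℝ → ℝ) (ρ f : Fam ι) : Prop where
  d0 : Linf σ f
  d1 : ∀ j, L6 σ (D j f)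
  d2 : ∀ j k, L2 σ (fun _ _ => 1) (D j (D k f))
  d3 : ∀ a b c : Fin 2, L2 σ w (ρ * D a.castSucc (D b.castSucc (D c.castSucc f)))

variable {H v : Fam ι}

/-- A vertical derivative of ρ∂̄²v is out of reach, but its horizontal derivatives are bounded by
ρ∂̄³v and by ∂̄²v, because ∂̄ρ is dominated by ρ. The anisotropic product estimate needs no more,
provided that H has a vertical derivative in L². -/
theorem Mid.l2_weighted_mul (hρ : HWeight σ ρ) (hw : ∀ c t, 1 ≤ w c t) (hv : Mid σ w ρ v)
    (hH : L6 σ H) (hH' : L2 σ (fun _ _ => 1) (D 2 H)) (a b : Fin 2) :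
    L2 σ w (ρ * D a.castSucc (D b.castSucc v) * H) := by
  have hw0 : ∀ c t, 0 ≤ w c t := fun c t => zero_le_one.trans (hw c t)
  have hD : ∀ c : Fin 2, L2 σ w (D c.castSucc (ρ * D a.castSucc (D b.castSucc v))) := fun c => by
    rw [D_mul]
    exact ((L2.linf_mul hρ.linf (hv.d2 _ _)).of_dom (hρ.dom1 c)).of_one hw |>.add hw0 (hv.d3 c a b)
  exact (L2.linf_mul hρ.linf (hv.d2 _ _)).mul_of_horizontal hw (hD 0) (hD 1) hH hH'

/-- The commutator of four horizontal derivatives with a regular coefficient. -/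
theorem Mid.commutator (hρ : HWeight σ ρ) (hw : ∀ c t, 1 ≤ w c t) (hH : Reg4 σ ρ H)
    (hv : Mid σ w ρ v) (a b c d : Fin 2) :
    L2 σ w (ρ * (D a.castSucc (D b.castSucc (D c.castSucc (D d.castSucc (H * v))))
      - H * D a.castSucc (D b.castSucc (D c.castSucc (D d.castSucc v))))) := by
  have hw0 : ∀ c t, 0 ≤ w c t := fun c t => zero_le_one.trans (hw c t)
  have t1 : ∀ a b c d : Fin 2, L2 σ w
      (ρ * (D a.castSucc H * D b.castSucc (D c.castSucc (D d.castSucc v)))) := fun a b c d => by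
    rw [mul_left_comm]; exact L2.linf_mul (hH.d1 _) (hv.d3 b c d)
  have t2 : ∀ a b c d : Fin 2, L2 σ w
      (ρ * (D a.castSucc (D b.castSucc H) * D c.castSucc (D d.castSucc v))) := fun a b c d => by
    have := hv.l2_weighted_mul hρ hw (hH.d2 a.castSucc b.castSucc) (hH.d3 2 _ _) c d
    rwa [mul_assoc, mul_comm (D c.castSucc _)] at this
  -- Here the factor with the weight and only horizontal derivatives is ρ∂̄³H, controlled by ρ∂̄⁴H,
  -- and ∂̄v carries the vertical derivative.
  have t3 : ∀ a b c d : Fin 2, L2 σ w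
      (ρ * (D a.castSucc (D b.castSucc (D c.castSucc H)) * D d.castSucc v)) := fun a b c d => by
    have hb := L2.linf_mul hρ.linf (hH.d3 a.castSucc b.castSucc c.castSucc)
    have hD : ∀ e : Fin 2, L2 σ w
        (D e.castSucc (ρ * D a.castSucc (D b.castSucc (D c.castSucc H)))) := fun e => by
      rw [D_mul]
      exact (.add weight_one (hb.of_dom (hρ.dom1 e)) (hH.d4 e a b c) : L2 σ (fun _ _ => 1) _).of_one hw
    have := hb.mul_of_horizontal hw (hD 0) (hD 1) (hv.d1 d.castSucc) (hv.d2 2 _)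
    rwa [mul_assoc] at this
  rw [leibniz_four]
  have e' : ∀ p q r : Fam ι, ρ * (p + q + r - p) = ρ * q + ρ * r := fun p q r => by ring
  rw [e']
  simp only [mul_add]
  have a4 : ∀ {p q r s : Fam ι}, L2 σ w p → L2 σ w q → L2 σ w r → L2 σ w s →
      L2 σ w (p + q + r + s) :=
    fun hp hq hr hs => ((hp.add hw0 hq).add hw0 hr).add hw0 hs
  refine .add hw0 ?_ (.add hw0 (.add hw0 (a4 (t1 _ _ _ _) (t1 _ _ _ _) (t1 _ _ _ _) (t1 _ _ _ _))
    (a4 (t3 _ _ _ _) (t3 _ _ _ _) (t3 _ _ _ _) (t3 _ _ _ _)))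
    (a4 (t2 _ _ _ _) (t2 _ _ _ _) (t2 _ _ _ _)
      (.add hw0 (.add hw0 (t2 _ _ _ _) (t2 _ _ _ _)) (t2 _ _ _ _))))
  rw [← mul_assoc]
  exact ((hH.d4 a b c d).mul_linf hv.d0).of_one hw

/-- Lower order derivatives of a product of a regular coefficient. -/
theorem Mid.low_order (hρ : HWeight σ ρ) (hw : ∀ c t, 1 ≤ w c t) (hH : Reg σ H)
    (hv : Mid σ w ρ v) :
    L2 σ w (ρ * (H * v)) ∧ (∀ a : Fin 2, L2 σ w (ρ * D a.castSucc (H * v))) ∧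
    (∀ a b : Fin 2, L2 σ w (ρ * D a.castSucc (D b.castSucc (H * v)))) ∧
    (∀ a b c : Fin 2, L2 σ w (ρ * D a.castSucc (D b.castSucc (D c.castSucc (H * v))))) := by
  have hw0 : ∀ c t, 0 ≤ w c t := fun c t => zero_le_one.trans (hw c t)
  refine ⟨?_, fun a => ?_, fun a b => ?_, fun a b c => ?_⟩
  · exact (hρ.linf.mul (hH.d0.mul hv.d0)).l2.of_one hw
  · rw [D_mul]
    exact (L2.linf_mul hρ.linf (.add weight_one ((hH.d1 _).mul hv.d0).l2
      (L6.linf_mul hH.d0 (hv.d1 _)).l2)).of_one hw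
  · rw [leibniz_two]
    exact (L2.linf_mul hρ.linf (.add weight_one (.add weight_one (L2.linf_mul hH.d0 (hv.d2 _ _))
      ((hH.d2 _ _).l2.mul_linf hv.d0)) (.add weight_one (L6.linf_mul (hH.d1 _) (hv.d1 _)).l2
      (L6.linf_mul (hH.d1 _) (hv.d1 _)).l2))).of_one hw
  · rw [leibniz_three, mul_add, mul_add]
    have t1 : ∀ j k l, L2 σ (fun _ _ => 1) (D j H * D k (D l v)) := fun j k l =>
      L2.linf_mul (hH.d1 _) (hv.d2 _ _)
    have t2 : ∀ j k l, L2 σ (fun _ _ => 1) (D j (D k H) * D l v) := fun j k l =>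
      L2.mul_l6 (hH.d2 _ _) (hv.d1 _)
    refine .add hw0 (.add hw0 ?_ ((L2.linf_mul hρ.linf ((hH.d3 _ _ _).mul_linf hv.d0)).of_one hw))
      ((L2.linf_mul hρ.linf (.add weight_one (.add weight_one (.add weight_one (t1 _ _ _)
        (t1 _ _ _)) (t1 _ _ _)) (.add weight_one (.add weight_one (t2 _ _ _) (t2 _ _ _))
          (t2 _ _ _)))).of_one hw)
    rw [mul_left_comm]
    exact L2.linf_mul hH.d0 (hv.d3 a b c)

theorem HWeight.dom_sq (hρ : HWeight σ ρ) :
    (∀ a : Fin 2, Dom σ (D a.castSucc (ρ * ρ)) (ρ * ρ)) ∧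
    (∀ a b : Fin 2, Dom σ (D a.castSucc (D b.castSucc (ρ * ρ))) (ρ * ρ)) ∧
    (∀ a b c : Fin 2, Dom σ (D a.castSucc (D b.castSucc (D c.castSucc (ρ * ρ)))) (ρ * ρ)) ∧
    (∀ a b c d : Fin 2,
      Dom σ (D a.castSucc (D b.castSucc (D c.castSucc (D d.castSucc (ρ * ρ))))) (ρ * ρ)) := by
  have h1 := hρ.dom1
  have h2 := hρ.dom2
  have h3 := hρ.dom3
  have h4 := hρ.dom4
  have h0 := Dom.refl (σ := σ) ρ
  have m11 := fun a b => (h1 a).mul (h1 b)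
  have m12 := fun a b c => (h1 a).mul (h2 b c)
  have m21 := fun a b c => (h2 a b).mul (h1 c)
  have m13 := fun a b c d => (h1 a).mul (h3 b c d)
  have m31 := fun a b c d => (h3 a b c).mul (h1 d)
  have m22 := fun a b c d => (h2 a b).mul (h2 c d)
  refine ⟨fun a => ?_, fun a b => ?_, fun a b c => ?_, fun a b c d => ?_⟩
  · rw [D_mul]; exact ((h1 a).mul h0).add (h0.mul (h1 a))
  · rw [leibniz_two]
    exact ((h0.mul (h2 a b)).add ((h2 a b).mul h0)).add ((m11 _ _).add (m11 _ _))
  · rw [leibniz_three]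
    exact ((h0.mul (h3 a b c)).add ((h3 a b c).mul h0)).add
      ((((m12 _ _ _).add (m12 _ _ _)).add (m12 _ _ _)).add
        (((m21 _ _ _).add (m21 _ _ _)).add (m21 _ _ _)))
  · rw [leibniz_four]
    exact ((h0.mul (h4 a b c d)).add ((h4 a b c d).mul h0)).add
      (((((m13 _ _ _ _).add (m13 _ _ _ _)).add (m13 _ _ _ _)).add (m13 _ _ _ _)).add
        ((((m31 _ _ _ _).add (m31 _ _ _ _)).add (m31 _ _ _ _)).add (m31 _ _ _ _)) |>.add
        ((((m22 _ _ _ _).add (m22 _ _ _ _)).add (m22 _ _ _ _)).add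
          (((m22 _ _ _ _).add (m22 _ _ _ _)).add (m22 _ _ _ _))))

/-- The commutator of four horizontal derivatives with a regular coefficient and the weight `ρ²`,
divided by `ρ`. -/
theorem Mid.commutator_weight (hρ : HWeight σ ρ) (hw : ∀ c t, 1 ≤ w c t) (hH : Reg4 σ ρ H)
    (hv : Mid σ w ρ v) (a b c d : Fin 2) :
    L2div σ w ρ (D a.castSucc (D b.castSucc (D c.castSucc (D d.castSucc (ρ * ρ * (H * v)))))
      - ρ * ρ * (H * D a.castSucc (D b.castSucc (D c.castSucc (D d.castSucc v))))) := by
  have hw0 : ∀ c t, 0 ≤ w c t := fun c t => zero_le_one.trans (hw c t)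
  obtain ⟨g0, g1, g2, g3⟩ := hv.low_order hρ hw hH.toReg
  obtain ⟨r1, r2, r3, r4⟩ := hρ.dom_sq
  have h4 := L2div.of_dom hρ.pos (hv.commutator hρ hw hH a b c d) (Dom.refl _)
  rw [leibniz_four]
  generalize H * v = u at *
  have e : ∀ p q x y z : Fam ι, ρ * ρ * p + x * y + z - ρ * ρ * q
      = ρ * ρ * (p - q) + (x * y + z) := fun p q x y z => by ring
  -- The term with all derivatives on H v is ρ² times the commutator without weight in the
  -- derivative. Every other term carries a horizontal derivative of ρ², which is dominated by ρ·ρ,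
  -- so one factor ρ can be divided out and the other one stays with the derivatives of H v.
  rw [e]
  have k13 := fun a b c d => L2div.of_dom hρ.pos (g3 b c d) (r1 a)
  have k31 := fun a b c d => L2div.of_dom hρ.pos (g1 d) (r3 a b c)
  have k22 := fun a b c d => L2div.of_dom hρ.pos (g2 c d) (r2 a b)
  have a4 : ∀ {p q r s : Fam ι}, L2div σ w ρ p → L2div σ w ρ q → L2div σ w ρ r → L2div σ w ρ s →
      L2div σ w ρ (p + q + r + s) :=
    fun hp hq hr hs => ((hp.add hw0 hq).add hw0 hr).add hw0 hs
  exact .add hw0 h4 (.add hw0 (L2div.of_dom hρ.pos g0 (r4 a b c d))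
    (.add hw0 (.add hw0 (a4 (k13 _ _ _ _) (k13 _ _ _ _) (k13 _ _ _ _) (k13 _ _ _ _))
      (a4 (k31 _ _ _ _) (k31 _ _ _ _) (k31 _ _ _ _) (k31 _ _ _ _)))
      (a4 (k22 _ _ _ _) (k22 _ _ _ _) (k22 _ _ _ _)
        (.add hw0 (.add hw0 (k22 _ _ _ _) (k22 _ _ _ _)) (k22 _ _ _ _)))))

end VacuumEuler

/-! ### Kinematics of the flow map; periodicity and vanishing on horizontal planes. -/

namespace VacuumEuler

open MeasureTheory Fam

noncomputable section

variable {ι : Type*} {σ : Scale ι}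

/-! ### A smooth substitute for the inverse -/

/-- A smooth function that agrees with the inverse on `[1/4, ∞)`. -/
def smoothInv (z : ℝ) : ℝ := Real.smoothTransition (8 * z - 1) * z⁻¹

theorem smoothInv_eq {z : ℝ} (hz : 1 / 4 ≤ z) : smoothInv z = z⁻¹ := by
  rw [smoothInv, Real.smoothTransition.one_of_one_le (by linarith), one_mul]

/-- The cutoff vanishes for z ≤ 1/8 and is one for z ≥ 1/4. It makes J⁻¹ smooth on all of
space-time, as membership in `Fam` requires, although J may degenerate off the domain. -/
theorem contDiff_smoothInv : ContDiff ℝ ∞ smoothInv := by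
  rw [contDiff_iff_contDiffAt]
  intro z
  rcases lt_or_ge z (1 / 8) with h | h
  · have : smoothInv =ᶠ[nhds z] fun _ => 0 := by
      filter_upwards [Iio_mem_nhds h] with y hy
      rw [smoothInv, Real.smoothTransition.zero_of_nonpos (by linarith [mem_Iio.1 hy]), zero_mul]
    exact contDiffAt_const.congr_of_eventuallyEq this
  · have hz : z ≠ 0 := by positivity
    exact ((Real.smoothTransition.contDiff (n := ⊤)).comp
      ((contDiff_const.mul contDiff_id).sub contDiff_const)).contDiffAt.mul (contDiffAt_inv ℝ hz)

/-! ### The kinematics of a flow map -/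

section Kinematics

variable (η : Fin 3 → Fam ι)

/-- The deformation gradient. -/
def grad : Matrix (Fin 3) (Fin 3) (Fam ι) := Matrix.of fun i k => D k (η i)

/-- The Jacobian determinant. -/
def detG : Fam ι := (grad η).det

/-- The transposed cofactor matrix. -/
def cofG : Matrix (Fin 3) (Fin 3) (Fam ι) := (grad η).adjugate

/-- The inverse of the Jacobian determinant. -/
def invJ : Fam ι := comp smoothInv contDiff_smoothInv (detG η)

/-- The inverse of the deformation gradient. -/
def invG : Matrix (Fin 3) (Fin 3) (Fam ι) := invJ η • cofG η

/-- The velocity. -/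
def velF (i : Fin 3) : Fam ι := Dt (η i)

/-- The stress `a J⁻²`. -/
def stress (k i : Fin 3) : Fam ι := invJ η * invG η k i

/-- The derivative of the stress with respect to the deformation gradient. -/
def stiff (k i s r : Fin 3) : Fam ι :=
  -(invJ η * (invG η k i * invG η s r + invG η s i * invG η k r))

/-- The stress is minus the gradient of J⁻¹ with respect to Dη, so this tensor is minus a Hessian.
The symmetry is what makes the principal part of the energy identity a time derivative. -/
theorem stiff_symm (k i s r : Fin 3) : stiff η k i s r = stiff η s r k i := by
  simp only [stiff]; ring

theorem invG_apply (k i : Fin 3) : invG η k i = invJ η * cofG η k i := rfl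

theorem Dt_grad (i k : Fin 3) : Dt (grad η i k) = D k (velF η i) := Dt_D k (η i)

/-- The entries are 2×2 minors of Dη, and in the divergence all mixed second derivatives cancel in
pairs. It brings the momentum equation into divergence form. -/
theorem piola (i : Fin 3) : ∑ k, D k (cofG η k i) = 0 := by
  have e : ∀ j k l, j < k → D k (D j (η l)) = D j (D k (η l)) := fun j k l _ => D_comm k j _
  fin_cases i <;>
  · simp only [cofG, Matrix.adjugate_fin_three, grad, Fin.sum_univ_three, Matrix.of_apply,
      Matrix.cons_val', Matrix.cons_val_zero, Matrix.cons_val_one, Matrix.cons_val, map_add,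
      map_sub, map_neg, D_mul, Fin.zero_eta, Fin.mk_one, Fin.reduceFinMk]
    -- Mixed derivatives are brought to one order, so that `ring` can cancel them. Two components of
    -- the flow map occur for each i, and a rewrite fixes one of them, hence the repetition.
    rw [e 0 1, e 0 2, e 1 2, e 0 1, e 0 2, e 1 2] <;> first | decide | skip
    ring

theorem Dt_detG : Dt (detG η) = ∑ s, ∑ r, cofG η s r * D s (velF η r) := by
  have e : ∀ i k, Dt (D k (η i)) = D k (velF η i) := fun i k => Dt_D k (η i)
  simp only [detG, Matrix.det_fin_three, cofG, Matrix.adjugate_fin_three, grad,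
    Fin.sum_univ_three, Matrix.of_apply, Matrix.cons_val', Matrix.cons_val_zero,
    Matrix.cons_val_one, Matrix.cons_val, map_add, map_sub, Dt_mul, e]
  ring

variable {η}

/-- The flow map is nondegenerate. -/
def NonDeg (σ : Scale ι) (η : Fin 3 → Fam ι) : Prop :=
  ∀ c, ∀ t ∈ Icc 0 (σ.T c), ∀ x ∈ closedSlab, 1 / 2 ≤ ev (detG η) c t x

theorem NonDeg.ev_invJ (h : NonDeg σ η) {c t x} (ht : t ∈ Icc 0 (σ.T c)) (hx : x ∈ closedSlab) :
    ev (invJ η) c t x = (ev (detG η) c t x)⁻¹ := by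
  rw [invJ, ev_comp, smoothInv_eq (by linarith [h c t ht x hx])]

theorem NonDeg.detG_mul_invJ (h : NonDeg σ η) : EqQ σ (detG η * invJ η) 1 := by
  intro c t ht x hx
  rw [ev_mul, h.ev_invJ ht hx, ev_one, mul_inv_cancel₀]
  linarith [h c t ht x hx]

theorem NonDeg.invJ_pos (h : NonDeg σ η) {c t x} (ht : t ∈ Icc 0 (σ.T c)) (hx : x ∈ closedSlab) :
    0 < ev (invJ η) c t x := by
  rw [h.ev_invJ ht hx]; exact inv_pos.2 (by linarith [h c t ht x hx])

theorem NonDeg.invJ_le (h : NonDeg σ η) {c t x} (ht : t ∈ Icc 0 (σ.T c)) (hx : x ∈ closedSlab) :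
    ev (invJ η) c t x ≤ 2 := by
  rw [h.ev_invJ ht hx]
  have := inv_anti₀ (by norm_num) (h c t ht x hx)
  norm_num at this; exact this

/-- The matrix of the values of a matrix of families. -/
def evM (X : Matrix (Fin 3) (Fin 3) (Fam ι)) (c : ι) (t : ℝ) (x : Point) :
    Matrix (Fin 3) (Fin 3) ℝ := (evHom c t x).mapMatrix X

theorem evM_apply (X : Matrix (Fin 3) (Fin 3) (Fam ι)) (c t x i j) :
    evM X c t x i j = ev (X i j) c t x := rfl

theorem evM_cofG (c t x) : evM (cofG η) c t x = (evM (grad η) c t x).adjugate :=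
  RingHom.map_adjugate _ _

theorem ev_detG (c t x) : ev (detG η) c t x = (evM (grad η) c t x).det :=
  RingHom.map_det (evHom c t x) (grad η)

theorem evM_invG (c t x) :
    evM (invG η) c t x = ev (invJ η) c t x • (evM (grad η) c t x).adjugate := by
  rw [← evM_cofG]; rfl

theorem NonDeg.evM_invG_eq (h : NonDeg σ η) {c t x} (ht : t ∈ Icc 0 (σ.T c))
    (hx : x ∈ closedSlab) : evM (invG η) c t x = (evM (grad η) c t x)⁻¹ := by
  rw [evM_invG, h.ev_invJ ht hx, ev_detG, Matrix.inv_def, Ring.inverse_eq_inv']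

theorem NonDeg.isUnit_det (h : NonDeg σ η) {c t x} (ht : t ∈ Icc 0 (σ.T c))
    (hx : x ∈ closedSlab) : IsUnit (evM (grad η) c t x).det := by
  rw [← ev_detG, isUnit_iff_ne_zero]; linarith [h c t ht x hx]

theorem NonDeg.invG_mul_grad (h : NonDeg σ η) {c t x} (ht : t ∈ Icc 0 (σ.T c))
    (hx : x ∈ closedSlab) : evM (invG η) c t x * evM (grad η) c t x = 1 := by
  rw [h.evM_invG_eq ht hx, Matrix.nonsing_inv_mul _ (h.isUnit_det ht hx)]

theorem NonDeg.grad_mul_invG (h : NonDeg σ η) {c t x} (ht : t ∈ Icc 0 (σ.T c))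
    (hx : x ∈ closedSlab) : evM (grad η) c t x * evM (invG η) c t x = 1 := by
  rw [h.evM_invG_eq ht hx, Matrix.mul_nonsing_inv _ (h.isUnit_det ht hx)]

/-- The time derivative of the inverse Jacobian. -/
theorem NonDeg.Dt_invJ (h : NonDeg σ η) : EqQ σ (Dt (invJ η))
    (-(invJ η * ∑ s, ∑ r, invG η s r * D s (velF η r))) := by
  intro c t ht x hx
  have a := h.detG_mul_invJ c t ht x hx
  have b := h.detG_mul_invJ.Dt c t ht x hx
  rw [Dt_mul, Dt_detG] at b
  simp only [ev_mul, ev_add, ev_neg, ev_sum, invG_apply, ev_one, Derivation.map_one_eq_zero, ev_zero] at a b ⊢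
  simp only [mul_assoc, ← Finset.mul_sum]
  linear_combination ev (invJ η) c t x * b - ev (Dt (invJ η)) c t x * a

/-- The time derivative of the inverse deformation gradient. -/
theorem NonDeg.Dt_invG (h : NonDeg σ η) (k i : Fin 3) : EqQ σ (Dt (invG η k i))
    (-∑ s, ∑ r, invG η k r * D s (velF η r) * invG η s i) := by
  have e : ∀ i j, EqQ σ (∑ l, grad η i l * invG η l j) (if i = j then 1 else 0) := by
    intro i j c t ht x hx
    have := congrFun (congrFun (h.grad_mul_invG ht hx) i) j
    rw [Matrix.mul_apply, Matrix.one_apply] at this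
    simp only [evM_apply] at this
    simp only [ev_sum, ev_mul, this]
    split_ifs <;> simp
  intro c t ht x hx
  have e' : ∀ i j, ∑ l, (ev (D l (velF η i)) c t x * ev (invG η l j) c t x
      + ev (grad η i l) c t x * ev (Dt (invG η l j)) c t x) = 0 := by
    intro i j
    have := (e i j).Dt c t ht x hx
    rw [map_sum] at this
    simp only [Dt_mul, Dt_grad, ev_sum, ev_add, ev_mul] at this
    rw [this]; split_ifs <;> simp
  set M : Matrix (Fin 3) (Fin 3) ℝ := Matrix.of fun l j => ev (Dt (invG η l j)) c t x with hM
  set V : Matrix (Fin 3) (Fin 3) ℝ := Matrix.of fun i l => ev (D l (velF η i)) c t x with hV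
  -- Differentiating (Dη)A = 1 in time, entry by entry; multiplication by A from the left then
  -- isolates A_t.
  have m1 : V * evM (invG η) c t x + evM (grad η) c t x * M = 0 := by
    ext i j
    have := e' i j
    rw [Finset.sum_add_distrib] at this
    simpa [Matrix.mul_apply, evM_apply, hM, hV] using this
  have m2 : M = -(evM (invG η) c t x * V * evM (invG η) c t x) := by
    calc M = evM (invG η) c t x * (V * evM (invG η) c t x + evM (grad η) c t x * M)
          - evM (invG η) c t x * V * evM (invG η) c t x := by
          rw [mul_add, ← mul_assoc _ (evM (grad η) c t x), h.invG_mul_grad ht hx, one_mul,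
            mul_assoc]; abel
      _ = _ := by rw [m1, mul_zero, zero_sub]
  have m3 := congrFun (congrFun m2 k) i
  simp only [hM, hV, Matrix.of_apply, Matrix.neg_apply, Matrix.mul_apply, evM_apply] at m3
  rw [m3]
  simp only [ev_neg, ev_sum, ev_mul, Finset.sum_mul]

/-- The time derivative of the stress. -/
theorem NonDeg.Dt_stress (h : NonDeg σ η) (k i : Fin 3) : EqQ σ (Dt (stress η k i))
    (∑ s, ∑ r, stiff η k i s r * D s (velF η r)) := by
  intro c t ht x hx
  have a := h.Dt_invJ c t ht x hx
  have b := h.Dt_invG k i c t ht x hx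
  rw [stress, Dt_mul]
  simp only [ev_add, ev_mul, a, b, stiff, ev_neg, Fin.sum_univ_three]
  ring

/-! ### Regularity of the kinematic quantities -/

variable {ρ : Fam ι}

theorem reg4_detG (hρ : Linf σ ρ) (hN : ∀ i k, Reg4 σ ρ (grad η i k)) : Reg4 σ ρ (detG η) := by
  rw [detG, Matrix.det_fin_three]
  have m := fun i j k l => (hN i j).mul hρ (hN k l)
  have m3 := fun i j k l p q => (m i j k l).mul hρ (hN p q)
  exact (((((m3 _ _ _ _ _ _).sub (m3 _ _ _ _ _ _)).sub (m3 _ _ _ _ _ _)).add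
    (m3 _ _ _ _ _ _)).add (m3 _ _ _ _ _ _)).sub (m3 _ _ _ _ _ _)

theorem reg4_cofG (hρ : Linf σ ρ) (hN : ∀ i k, Reg4 σ ρ (grad η i k)) (k i : Fin 3) :
    Reg4 σ ρ (cofG η k i) := by
  have m := fun i j k l => (hN i j).mul hρ (hN k l)
  have m1 := fun i j k l p q r s => (m i j k l).sub (m p q r s)
  have m2 : ∀ i j k l p q r s, Reg4 σ ρ
      (-(grad η i j * grad η k l) + grad η p q * grad η r s) :=
    fun i j k l p q r s => (m i j k l).neg.add (m p q r s)
  rw [cofG, Matrix.adjugate_fin_three]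
  fin_cases k <;> fin_cases i <;>
    first | exact m1 _ _ _ _ _ _ _ _ | exact m2 _ _ _ _ _ _ _ _

theorem NonDeg.linf_invJ (h : NonDeg σ η) : Linf σ (invJ η) :=
  ⟨2, zero_le_two, 0, fun c t ht x hx => by
    have hx' := cell_subset_closedSlab hx
    rw [abs_of_pos (h.invJ_pos ht hx')]; simpa using h.invJ_le ht hx'⟩

theorem NonDeg.reg4_invJ (h : NonDeg σ η) (hρ : Linf σ ρ) (hN : ∀ i k, Reg4 σ ρ (grad η i k)) :
    Reg4 σ ρ (invJ η) := (reg4_detG hρ hN).inv hρ h.linf_invJ h.detG_mul_invJ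

theorem NonDeg.reg4_invG (h : NonDeg σ η) (hρ : Linf σ ρ) (hN : ∀ i k, Reg4 σ ρ (grad η i k))
    (k i : Fin 3) : Reg4 σ ρ (invG η k i) :=
  (h.reg4_invJ hρ hN).mul hρ (reg4_cofG hρ hN k i)

theorem NonDeg.reg4_stiff (h : NonDeg σ η) (hρ : Linf σ ρ) (hN : ∀ i k, Reg4 σ ρ (grad η i k))
    (k i s r : Fin 3) : Reg4 σ ρ (stiff η k i s r) := by
  have g := h.reg4_invG hρ hN
  exact ((h.reg4_invJ hρ hN).mul hρ (((g k i).mul hρ (g s r)).add ((g s i).mul hρ (g k r)))).neg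

end Kinematics

/-! ### Periodicity -/

/-- Translation by a horizontal period. -/
def shift (α : Fin 2) : Fam ι →ₐ[ℝ] Fam ι where
  toFun f := ⟨fun c p => f.1 c (p + (0, hvec α)), fun c =>
    (f.2 c).comp (contDiff_id.add contDiff_const)⟩
  map_one' := rfl
  map_mul' _ _ := rfl
  map_zero' := rfl
  map_add' _ _ := rfl
  commutes' _ := rfl

theorem ev_shift (α : Fin 2) (f : Fam ι) (c t x) : ev (shift α f) c t x = ev f c t (x + hvec α) := by
  show f.1 c ((t, x) + (0, hvec α)) = f.1 c (t, x + hvec α)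
  rw [Prod.mk_add_mk, add_zero]

theorem shift_dir (α : Fin 2) (v : SpaceTime) (f : Fam ι) :
    shift α (dir v f) = dir v (shift α f) := by
  refine Subtype.ext (funext fun c => funext fun p => ?_)
  show fderiv ℝ (f.1 c) (p + (0, hvec α)) v = fderiv ℝ (fun q => f.1 c (q + (0, hvec α))) p v
  rw [fderiv_comp_add_right]

/-- Horizontal periodicity on `[0,T] × closedSlab`. -/
def PerQ (σ : Scale ι) (f : Fam ι) : Prop := ∀ α, EqQ σ (shift α f) f

namespace PerQ

variable {f g : Fam ι}

theorem dir (hf : PerQ σ f) (v : SpaceTime) : PerQ σ (Fam.dir v f) := fun α => by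
  rw [shift_dir]; exact (hf α).dir v

theorem D (hf : PerQ σ f) (k : Fin 3) : PerQ σ (Fam.D k f) := hf.dir _

theorem mul (hf : PerQ σ f) (hg : PerQ σ g) : PerQ σ (f * g) := fun α => by
  rw [map_mul]; exact (hf α).mul (hg α)

theorem add (hf : PerQ σ f) (hg : PerQ σ g) : PerQ σ (f + g) := fun α => by
  rw [map_add]; exact (hf α).add (hg α)

theorem neg (hf : PerQ σ f) : PerQ σ (-f) := fun α c t ht x hx => by
  rw [map_neg, ev_neg, ev_neg, hf α c t ht x hx]

theorem sub (hf : PerQ σ f) (hg : PerQ σ g) : PerQ σ (f - g) := by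
  rw [sub_eq_add_neg]; exact hf.add hg.neg

theorem sum {κ : Type*} {s : Finset κ} {f : κ → Fam ι} (h : ∀ j, PerQ σ (f j)) :
    PerQ σ (∑ j ∈ s, f j) := fun α c t ht x hx => by
  rw [map_sum, ev_sum, ev_sum]; exact Finset.sum_congr rfl fun j _ => h j α c t ht x hx

theorem comp (hf : PerQ σ f) (θ : ℝ → ℝ) (hθ : ContDiff ℝ ∞ θ) : PerQ σ (Fam.comp θ hθ f) :=
  fun α c t ht x hx => congrArg θ (hf α c t ht x hx)

theorem hPeriodic (hf : PerQ σ f) {c t} (ht : t ∈ Icc 0 (σ.T c)) : HPeriodic (ev f c t) :=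
  fun x hx α => by rw [← ev_shift]; exact hf α c t ht x hx

end PerQ

section

variable {η : Fin 3 → Fam ι}

theorem perQ_detG (h : ∀ i k, PerQ σ (grad η i k)) : PerQ σ (detG η) := by
  rw [detG, Matrix.det_fin_three]
  have m3 := fun i j k l p q => ((h i j).mul (h k l)).mul (h p q)
  exact (((((m3 _ _ _ _ _ _).sub (m3 _ _ _ _ _ _)).sub (m3 _ _ _ _ _ _)).add
    (m3 _ _ _ _ _ _)).add (m3 _ _ _ _ _ _)).sub (m3 _ _ _ _ _ _)

theorem perQ_cofG (h : ∀ i k, PerQ σ (grad η i k)) (k i : Fin 3) : PerQ σ (cofG η k i) := by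
  have m := fun i j k l => (h i j).mul (h k l)
  have m1 := fun i j k l p q r s => (m i j k l).sub (m p q r s)
  have m2 : ∀ i j k l p q r s, PerQ σ (-(grad η i j * grad η k l) + grad η p q * grad η r s) :=
    fun i j k l p q r s => (m i j k l).neg.add (m p q r s)
  rw [cofG, Matrix.adjugate_fin_three]
  fin_cases k <;> fin_cases i <;>
    first | exact m1 _ _ _ _ _ _ _ _ | exact m2 _ _ _ _ _ _ _ _

theorem perQ_stress (h : ∀ i k, PerQ σ (grad η i k)) (k i : Fin 3) : PerQ σ (stress η k i) :=
  ((perQ_detG h).comp _ _).mul (((perQ_detG h).comp _ _).mul (perQ_cofG h k i))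

end

/-! ### Vanishing on a horizontal plane -/

/-- The family vanishes on the plane `x₃ = z`. -/
def Van (σ : Scale ι) (z : ℝ) (f : Fam ι) : Prop :=
  ∀ c, ∀ t ∈ Icc 0 (σ.T c), ∀ x : Point, x 2 = z → ev f c t x = 0

namespace Van

variable {f g : Fam ι} {z : ℝ}

theorem mul_left (hf : Van σ z f) (g : Fam ι) : Van σ z (g * f) := fun c t ht x hx => by
  rw [ev_mul, hf c t ht x hx, mul_zero]

theorem mul_right (hf : Van σ z f) (g : Fam ι) : Van σ z (f * g) := fun c t ht x hx => by
  rw [ev_mul, hf c t ht x hx, zero_mul]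

theorem add (hf : Van σ z f) (hg : Van σ z g) : Van σ z (f + g) := fun c t ht x hx => by
  rw [ev_add, hf c t ht x hx, hg c t ht x hx, add_zero]

theorem sub (hf : Van σ z f) (hg : Van σ z g) : Van σ z (f - g) := fun c t ht x hx => by
  rw [ev_sub, hf c t ht x hx, hg c t ht x hx, sub_zero]

theorem D (hf : Van σ z f) (a : Fin 2) : Van σ z (Fam.D a.castSucc f) := fun c t ht x hx => by
  have h := hasDerivAt_update_comp (contDiff_ev f c t) x a.castSucc (x a.castSucc)
  have e : (fun r => ev f c t (Function.update x a.castSucc r)) = fun _ => 0 := by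
    funext r
    refine hf c t ht _ ?_
    rw [Function.update_of_ne, hx]
    fin_cases a <;> decide
  rw [e, Function.update_eq_self, pd_ev] at h
  exact h.unique (hasDerivAt_const _ _)

end Van

end

end VacuumEuler

/-! ### Integration by parts for families, and increments over short time intervals. -/

namespace VacuumEuler

open MeasureTheory Fam

noncomputable section

variable {ι : Type*} {σ : Scale ι} {w : ι → ℝ → ℝ}

/-! ### Integrals of products -/

theorem integ_add_ev (f g : Fam ι) (c t) :
    integ (ev (f + g) c t) = integ (ev f c t) + integ (ev g c t) :=
  integral_add (continuous_ev f c t).integrableOn_cell (continuous_ev g c t).integrableOn_cell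

theorem integ_neg_ev (f : Fam ι) (c t) : integ (ev (-f) c t) = -integ (ev f c t) :=
  integral_neg _

theorem integ_sub_ev (f g : Fam ι) (c t) :
    integ (ev (f - g) c t) = integ (ev f c t) - integ (ev g c t) :=
  integral_sub (continuous_ev f c t).integrableOn_cell (continuous_ev g c t).integrableOn_cell

theorem integ_smul_ev (r : ℝ) (f : Fam ι) (c t) :
    integ (ev (r • f) c t) = r * integ (ev f c t) := integral_const_mul _ _

theorem integ_sum_ev {κ : Type*} (s : Finset κ) (f : κ → Fam ι) (c t) :
    integ (ev (∑ j ∈ s, f j) c t) = ∑ j ∈ s, integ (ev (f j) c t) := by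
  have : ev (∑ j ∈ s, f j) c t = fun x => ∑ j ∈ s, ev (f j) c t x := funext fun x => ev_sum _ _ _ _ _
  rw [this]
  exact integral_finsetSum _ fun j _ => (continuous_ev (f j) c t).integrableOn_cell

theorem integ_congr {f g : Fam ι} (h : EqQ σ f g) {c t} (ht : t ∈ Icc 0 (σ.T c)) :
    integ (ev f c t) = integ (ev g c t) :=
  setIntegral_congr_fun measurableSet_cell fun x hx => h c t ht x (cell_subset_closedSlab hx)

theorem integ_mono_ev {f g : Fam ι} {c t} (h : ∀ x ∈ cell, ev f c t x ≤ ev g c t x) :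
    integ (ev f c t) ≤ integ (ev g c t) :=
  setIntegral_mono_on (continuous_ev f c t).integrableOn_cell (continuous_ev g c t).integrableOn_cell
    measurableSet_cell h

theorem integ_nonneg_ev {f : Fam ι} {c t} (h : ∀ x ∈ cell, 0 ≤ ev f c t x) :
    0 ≤ integ (ev f c t) := setIntegral_nonneg measurableSet_cell h

/-- Cauchy's inequality with a weight. -/
theorem abs_integral_mul_le {f g q : Point → ℝ} (hfg : IntegrableOn (fun x => f x * g x) cell)
    (hq : ∀ x ∈ cell, 0 < q x)
    (hf : IntegrableOn (fun x => (f x / q x) ^ 2) cell)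
    (hg : IntegrableOn (fun x => (q x * g x) ^ 2) cell) {ε : ℝ} (hε : 0 < ε) :
    |∫ x in cell, f x * g x|
      ≤ ε * (∫ x in cell, (f x / q x) ^ 2) + ε⁻¹ * ∫ x in cell, (q x * g x) ^ 2 := by
  rw [← integral_const_mul, ← integral_const_mul,
    ← integral_add (hf.const_mul ε) (hg.const_mul ε⁻¹)]
  refine abs_integral_le_integral_abs.trans (setIntegral_mono_on hfg.abs
    ((hf.const_mul ε).add (hg.const_mul ε⁻¹)) measurableSet_cell fun x hx => ?_)
  have h0 := hq x hx
  have e : f x * g x = (f x / q x) * (q x * g x) := by field_simp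
  rw [e, abs_mul, ← sq_abs (f x / q x), ← sq_abs (q x * g x)]
  generalize |f x / q x| = p
  generalize |q x * g x| = r
  have : 0 ≤ ε⁻¹ * (ε * p - r) ^ 2 := by positivity
  have e2 : ε⁻¹ * (ε * p - r) ^ 2 = ε * p ^ 2 - 2 * (p * r) + ε⁻¹ * r ^ 2 := by
    field_simp; ring
  have e3 : 0 ≤ ε * p ^ 2 + ε⁻¹ * r ^ 2 := by positivity
  linarith

theorem PolyBdd.abs_integ_mul {f g : Fam ι} (hf : L2 σ (fun _ _ => 1) f)
    (hg : L2 σ (fun _ _ => 1) g) : PolyBdd σ (fun _ _ => 1) (fun c t => |integ (ev (f * g) c t)|) := by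
  refine (IntBdd.add weight_one hf hg).2.mono fun c t ht => ?_
  have h := abs_integral_mul_le (f := ev f c t) (g := ev g c t) (q := fun _ => 1)
    (continuous_ev (f * g) c t).integrableOn_cell (fun _ _ => zero_lt_one)
    (by simpa using hf.1 c t ht) (by simpa using hg.1 c t ht) zero_lt_one
  simp only [div_one, one_mul, inv_one] at h
  rw [integral_add (hf.1 c t ht) (hg.1 c t ht)]
  exact h

/-! ### Integration by parts for families -/

theorem integ_div_eq_zero {W : Fin 3 → Fam ι} (hper : ∀ α : Fin 2, PerQ σ (W α.castSucc))
    (h0 : Van σ 0 (W 2)) (h1 : Van σ 1 (W 2)) {c t} (ht : t ∈ Icc 0 (σ.T c)) :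
    integ (ev (∑ k, D k (W k)) c t) = 0 := by
  have := integ_divergence_eq_zero (fun k => ev (W k) c t) (fun k => contDiff_ev _ c t)
    (fun α => (hper α).hPeriodic ht) (h0 c t ht) (h1 c t ht)
  simp only [pd_ev] at this
  rw [← this]
  exact congrArg integ (funext fun x => ev_sum _ _ _ _ _)

theorem integ_D_eq_zero {f : Fam ι} (hper : PerQ σ f) (a : Fin 2) {c t}
    (ht : t ∈ Icc 0 (σ.T c)) : integ (ev (D a.castSucc f) c t) = 0 := by
  have hne : (2 : Fin 3) ≠ a.castSucc := by fin_cases a <;> decide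
  have hz : ∀ z, Van σ z (0 : Fam ι) := fun z c t _ x _ => rfl
  have h := integ_div_eq_zero (σ := σ) (W := Pi.single a.castSucc f) (fun α => by
    by_cases e : α = a
    · subst e; rw [Pi.single_eq_same]; exact hper
    · rw [Pi.single_eq_of_ne ((Fin.castSucc_injective 2).ne e)]
      exact fun β c t _ x _ => by rw [map_zero]) (by rw [Pi.single_eq_of_ne hne]; exact hz 0)
    (by rw [Pi.single_eq_of_ne hne]; exact hz 1) ht
  rw [Finset.sum_eq_single a.castSucc (fun k _ hk => by rw [Pi.single_eq_of_ne hk, map_zero])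
    (fun h => absurd (Finset.mem_univ _) h), Pi.single_eq_same] at h
  exact h

/-! ### Growth in time -/

/-- Take ε = √T. The part with m contributes √T ∫m, which is small because m is merely integrable
but carries the factor ε, and the part with ε⁻¹ contributes T/√T = √T. -/
theorem growth_aux {T M M' : ℝ} {m Φ Φ' : ℝ → ℝ} (hT : 0 < T) (hT1 : T ≤ 1)
    (hΦ : ∀ s, HasDerivAt Φ (Φ' s) s) (hc : Continuous Φ') (hm : Continuous m)
    (hm0 : ∀ s, 0 ≤ m s) (hM : 0 ≤ M)
    (hb : ∀ s ∈ Icc 0 T, ∀ ε ∈ Ioc (0 : ℝ) 1, |Φ' s| ≤ M * (ε * (1 + m s) + ε⁻¹))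
    (hi : ∫ s in (0 : ℝ)..T, m s ≤ M') {t : ℝ} (ht : t ∈ Icc 0 T) :
    |Φ t - Φ 0| ≤ √T * (M * (2 + M')) := by
  rw [← intervalIntegral.integral_eq_sub_of_hasDerivAt (fun s _ => hΦ s) (hc.intervalIntegrable _ _)]
  have hs : 0 < √T := Real.sqrt_pos.2 hT
  have hs1 : √T ≤ 1 := Real.sqrt_le_one.2 hT1
  have hss : √T * √T = T := Real.mul_self_sqrt hT.le
  have hg : Continuous fun s => M * (√T * (1 + m s) + (√T)⁻¹) := by fun_prop
  have h1 : |∫ s in (0 : ℝ)..t, Φ' s| ≤ ∫ s in (0 : ℝ)..t, M * (√T * (1 + m s) + (√T)⁻¹) :=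
    (intervalIntegral.abs_integral_le_integral_abs ht.1).trans
      (intervalIntegral.integral_mono_on ht.1 (hc.abs.intervalIntegrable _ _)
        (hg.intervalIntegrable _ _) fun s h => hb s ⟨h.1, h.2.trans ht.2⟩ _ ⟨hs, hs1⟩)
  have h2 : ∫ s in (0 : ℝ)..t, M * (√T * (1 + m s) + (√T)⁻¹)
      ≤ ∫ s in (0 : ℝ)..T, M * (√T * (1 + m s) + (√T)⁻¹) := by
    refine intervalIntegral.integral_mono_interval le_rfl ht.1 ht.2
      (Filter.Eventually.of_forall fun s => ?_) (hg.intervalIntegrable _ _)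
    have := hm0 s
    exact mul_nonneg hM (by positivity)
  refine h1.trans (h2.trans ?_)
  rw [intervalIntegral.integral_const_mul, intervalIntegral.integral_add
    ((by fun_prop : Continuous fun s => √T * (1 + m s)).intervalIntegrable _ _) (by simp),
    intervalIntegral.integral_const_mul, intervalIntegral.integral_add (by simp)
    (hm.intervalIntegrable _ _)]
  simp only [intervalIntegral.integral_const, sub_zero, smul_eq_mul, mul_one]
  have e : T * (√T)⁻¹ = √T := by rw [← div_eq_mul_inv, Real.div_sqrt]
  rw [e]
  have : √T * (T + ∫ s in (0 : ℝ)..T, m s) ≤ √T * (1 + M') :=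
    mul_le_mul_of_nonneg_left (by linarith) hs.le
  have := mul_le_mul_of_nonneg_left this hM
  linarith

/-- The integrals are bounded by `ε (1 + m) + ε⁻¹` for all `ε`. -/
def SlowBd (σ : Scale ι) (m : ι → ℝ → ℝ) (G : Fam ι) : Prop :=
  ∃ C : ℝ, 0 ≤ C ∧ ∃ n : ℕ, ∀ c, ∀ s ∈ Icc 0 (σ.T c), ∀ ε ∈ Ioc (0 : ℝ) 1,
    |integ (ev G c s)| ≤ C * σ.B c ^ n * (ε * (1 + m c s) + ε⁻¹)

/-- The weight that vanishes with the length of the time interval. -/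
def rootT (σ : Scale ι) : ι → ℝ → ℝ := fun c _ => √(σ.T c)

theorem rootT_nonneg (σ : Scale ι) (c : ι) (t : ℝ) : 0 ≤ rootT σ c t := Real.sqrt_nonneg _

/-- The weight for the time derivatives is integrable in time. -/
structure TimeWeight (σ : Scale ι) (m : ι → ℝ → ℝ) : Prop where
  T_le : ∀ c, σ.T c ≤ 1
  cont : ∀ c, Continuous (m c)
  nonneg : ∀ c t, 0 ≤ m c t
  int : PolyBdd σ (fun _ _ => 1) (fun c _ => ∫ s in (0 : ℝ)..σ.T c, m c s)

variable {m : ι → ℝ → ℝ}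

theorem SlowBd.growth (hm : TimeWeight σ m) {F : Fam ι} (hF : SlowBd σ m (Dt F)) :
    PolyBdd σ (rootT σ) (fun c t => |integ (ev F c t) - integ (ev F c 0)|) := by
  obtain ⟨C, hC, n, hn⟩ := hF
  obtain ⟨C', hC', n', hn'⟩ := hm.int
  refine ⟨C * 2 + C * C', by positivity, n + (n + n'), fun c t ht => ?_⟩
  have h := growth_aux (σ.pos c) (hm.T_le c) (fun s => hasDerivAt_integ F c s)
    (continuous_integ (Dt F) c) (hm.cont c) (hm.nonneg c)
    (mul_nonneg hC (σ.pow_pos c n).le) (hn c) (hn' c t ht) ht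
  refine h.trans ?_
  rw [mul_one, mul_comm, rootT]
  refine mul_le_mul_of_nonneg_right ?_ (Real.sqrt_nonneg _)
  have := σ.add_le c (mul_nonneg hC zero_le_two) (mul_nonneg hC hC') n (n + n')
  refine le_trans (le_of_eq ?_) this
  rw [pow_add]; ring

namespace SlowBd

variable {F G : Fam ι}

theorem of_polyBdd (hm : TimeWeight σ m)
    (h : PolyBdd σ (fun _ _ => 1) (fun c t => |integ (ev G c t)|)) : SlowBd σ m G := by
  obtain ⟨C, hC, n, hn⟩ := h
  refine ⟨C, hC, n, fun c s hs ε hε => (hn c s hs).trans ?_⟩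
  refine mul_le_mul_of_nonneg_left ?_ (mul_nonneg hC (σ.pow_pos c n).le)
  have := one_le_inv₀ hε.1 |>.2 hε.2
  have := mul_nonneg hε.1.le (by linarith [hm.nonneg c s] : 0 ≤ 1 + m c s)
  linarith

theorem congr (hG : SlowBd σ m G)
    (h : ∀ c, ∀ t ∈ Icc 0 (σ.T c), integ (ev F c t) = integ (ev G c t)) : SlowBd σ m F := by
  obtain ⟨C, hC, n, hn⟩ := hG
  exact ⟨C, hC, n, fun c s hs ε hε => by rw [h c s hs]; exact hn c s hs ε hε⟩

theorem add (hm : TimeWeight σ m) (hF : SlowBd σ m F) (hG : SlowBd σ m G) :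
    SlowBd σ m (F + G) := by
  obtain ⟨C, hC, n, hn⟩ := hF
  obtain ⟨C', hC', n', hn'⟩ := hG
  refine ⟨C + C', add_nonneg hC hC', n + n', fun c t ht ε hε => ?_⟩
  rw [integ_add_ev]
  have h0 : 0 ≤ ε * (1 + m c t) + ε⁻¹ := by
    have := hm.nonneg c t
    have := hε.1
    positivity
  have := mul_le_mul_of_nonneg_right (σ.add_le c hC hC' n n') h0
  have := abs_add_le (integ (ev F c t)) (integ (ev G c t))
  have := hn c t ht ε hε
  have := hn' c t ht ε hε
  linarith

theorem neg (hG : SlowBd σ m G) : SlowBd σ m (-G) := by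
  simpa only [SlowBd, integ_neg_ev, abs_neg] using hG

theorem smul (r : ℝ) (hG : SlowBd σ m G) : SlowBd σ m (r • G) := by
  obtain ⟨C, hC, n, hn⟩ := hG
  refine ⟨|r| * C, by positivity, n, fun c t ht ε hε => ?_⟩
  rw [integ_smul_ev, abs_mul]
  have := mul_le_mul_of_nonneg_left (hn c t ht ε hε) (abs_nonneg r)
  linarith

theorem sum (hm : TimeWeight σ m) {κ : Type*} {s : Finset κ} {G : κ → Fam ι}
    (h : ∀ j, SlowBd σ m (G j)) : SlowBd σ m (∑ j ∈ s, G j) := by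
  classical
  induction s using Finset.induction_on with
  | empty => exact of_polyBdd hm ⟨0, le_rfl, 0, fun c t _ => by simp [integ]⟩
  | insert a s ha ih => rw [Finset.sum_insert ha]; exact (h a).add hm ih

end SlowBd

/-- The pairing of a family that is bounded with the time weight and a bounded one. -/
theorem slow_pairing {ρ f g : Fam ι} (hρ : ∀ c, ∀ t ∈ Icc 0 (σ.T c), ∀ x ∈ cell, 0 < ev ρ c t x)
    (hm : TimeWeight σ m) (hf : L2div σ (fun c t => 1 + m c t) ρ f)
    (hg : L2 σ (fun _ _ => 1) (ρ * g)) :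
    ∃ C : ℝ, 0 ≤ C ∧ ∃ n : ℕ, ∀ c, ∀ t ∈ Icc 0 (σ.T c), ∀ τ ∈ Icc 0 (σ.T c),
      (∀ x, ev ρ c τ x = ev ρ c t x) → ∀ ε ∈ Ioc (0 : ℝ) 1,
      |integ (fun x => ev f c t x * ev g c τ x)| ≤ C * σ.B c ^ n * (ε * (1 + m c t) + ε⁻¹) := by
  obtain ⟨C, hC, n, hn⟩ := hf.2
  obtain ⟨C', hC', n', hn'⟩ := hg.2
  refine ⟨C + C', add_nonneg hC hC', n + n', fun c t ht τ hτ hρτ ε hε => ?_⟩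
  have hε0 := hε.1
  -- The second factor may be evaluated at a time τ other than t, since ρ has the same values there.
  -- This allows pairing with a factor frozen in time.
  have hg' : (fun x => ev (ρ * g) c τ x ^ 2) = fun x => (ev ρ c t x * ev g c τ x) ^ 2 := by
    funext x; rw [ev_mul, hρτ]
  have h1 := hg.1 c τ hτ
  have h2 := hn' c τ hτ
  simp only [hg', mul_one] at h1 h2
  have h := abs_integral_mul_le (f := ev f c t) (g := ev g c τ) (q := ev ρ c t)
    (((continuous_ev f c t).mul (continuous_ev g c τ)).integrableOn_cell) (hρ c t ht)
    (hf.1 c t ht) h1 hε.1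
  have hm0 := hm.nonneg c t
  have a := mul_le_mul_of_nonneg_left (hn c t ht) hε0.le
  have b := mul_le_mul_of_nonneg_left h2 (inv_pos.2 hε0).le
  have k := mul_le_mul_of_nonneg_left (σ.pow_le_pow c (Nat.le_add_right n n'))
    (mul_nonneg hC (mul_nonneg hε0.le (by linarith : 0 ≤ 1 + m c t)))
  have k' := mul_le_mul_of_nonneg_left (σ.pow_le_pow c (Nat.le_add_left n' n))
    (mul_nonneg hC' (inv_pos.2 hε0).le)
  have p0 := (σ.pow_pos c (n + n')).le
  have z1 : 0 ≤ C' * σ.B c ^ (n + n') * (ε * (1 + m c t)) := by positivity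
  have z2 : 0 ≤ C * σ.B c ^ (n + n') * ε⁻¹ := by positivity
  refine h.trans ?_
  nlinarith

end

end VacuumEuler

/-! ### The properties of a flow used in the estimate, and the time-integrated bound for the
velocity. -/

namespace VacuumEuler

open MeasureTheory Fam

noncomputable section

variable {ι : Type*} {σ : Scale ι} {w : ι → ℝ → ℝ}

/-- Four horizontal derivatives. -/
def hd (a b e d : Fin 2) : Fam ι →ₗ[ℝ] Fam ι :=
  (D a.castSucc).toLinearMap ∘ₗ (D b.castSucc).toLinearMap ∘ₗ (D e.castSucc).toLinearMap ∘ₗ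
    (D d.castSucc).toLinearMap

theorem hd_apply (a b e d : Fin 2) (f : Fam ι) :
    hd a b e d f = D a.castSucc (D b.castSucc (D e.castSucc (D d.castSucc f))) := rfl

theorem hd_D (a b e d : Fin 2) (k : Fin 3) (f : Fam ι) : hd a b e d (D k f) = D k (hd a b e d f) := by
  simp only [hd_apply, D_comm _ k]

theorem Dt_hd (a b e d : Fin 2) (f : Fam ι) : Dt (hd a b e d f) = hd a b e d (Dt f) := by
  simp only [hd_apply, Dt_D]

theorem EqQ.hd {f g : Fam ι} (h : EqQ σ f g) (a b e d : Fin 2) :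
    EqQ σ (hd a b e d f) (VacuumEuler.hd a b e d g) := (((h.D _).D _).D _).D _

theorem PerQ.hd {f : Fam ι} (h : PerQ σ f) (a b e d : Fin 2) : PerQ σ (hd a b e d f) :=
  (((h.D _).D _).D _).D _

theorem Van.hd {f : Fam ι} {z : ℝ} (h : Van σ z f) (a b e d : Fin 2) : Van σ z (hd a b e d f) :=
  (((h.D _).D _).D _).D _

/-- The antisymmetric part of the Eulerian gradient of a vector field. -/
def curlG (A : Matrix (Fin 3) (Fin 3) (Fam ι)) (u : Fin 3 → Fam ι) (j k : Fin 3) : Fam ι :=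
  ∑ s, (A s j * D s (u k) - A s k * D s (u j))

/-- The properties of a family of solutions that enter the energy estimate. -/
structure Flow (σ : Scale ι) (ρ : Fam ι) (η : Fin 3 → Fam ι) : Prop where
  T_le : ∀ c, σ.T c ≤ 1
  weight : HWeight σ ρ
  rho_t : Dt ρ = 0
  rho_top : Van σ 1 ρ
  rho_per : PerQ σ ρ
  dom_const : ∀ a b e d, ∃ C : ℝ, 0 ≤ C ∧ ∀ c, ∀ x ∈ cell,
    |ev (hd a b e d (ρ * ρ)) c 0 x| ≤ C * ev ρ c 0 x
  nonDeg : NonDeg σ η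
  per_grad : ∀ i k, PerQ σ (grad η i k)
  per_vel : ∀ i, PerQ σ (velF η i)
  momentum : ∀ i, EqQ σ (ρ * Dt (velF η i)
    + ∑ k, cofG η k i * D k (ρ * ρ * (invJ η * invJ η))) 0
  init : ∀ c, ∀ x ∈ closedSlab, ∀ i k, ev (grad η i k) c 0 x = if i = k then 1 else 0
  bottom_pos : Van σ 0 (η 2)
  bottom_vel : Van σ 0 (velF η 2)
  reg : ∀ i k, Reg4 σ ρ (grad η i k)
  vel1 : ∀ i j, L2 σ (fun _ _ => 1) (D j (velF η i))
  vel2 : ∀ i j k, L2 σ (fun _ _ => 1) (D j (D k (velF η i)))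
  vel3 : ∀ i j k l, L2 σ (fun _ _ => 1) (D j (D k (D l (velF η i))))
  acc0 : ∀ i, L2 σ (fun _ _ => 1) (Dt (velF η i))
  acc1 : ∀ i j, L2 σ (fun _ _ => 1) (D j (Dt (velF η i)))
  acc2 : ∀ i j k, L2 σ (fun _ _ => 1) (D j (D k (Dt (velF η i))))
  acc3 : ∀ i j k l, L2 σ (fun _ _ => 1) (D j (D k (D l (Dt (velF η i)))))
  acc4 : ∀ i k, ∀ a b e : Fin 2, L2 σ (fun _ _ => 1)
    (ρ * D a.castSucc (D b.castSucc (D e.castSucc (D k (Dt (velF η i))))))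
  vel4 : ∀ a b e d i, IntBdd σ (fun _ _ => 1)
    (ev (ρ * (hd a b e d (velF η i) * hd a b e d (velF η i))))
  curl4 : ∀ a b e d j k, L2 σ (fun _ _ => 1)
    (ρ * hd a b e d (curlG (invG η) (velF η) j k))

namespace Flow

variable {ρ : Fam ι} {η : Fin 3 → Fam ι}

/-! ### The time weight -/

/-- Three horizontal derivatives of the velocity gradient, with the weight. -/
def velGrad3 (ρ : Fam ι) (η : Fin 3 → Fam ι) (j : Fin 3 × Fin 3 × Fin 2 × Fin 2 × Fin 2) : Fam ι :=
  ρ * D j.2.2.1.castSucc (D j.2.2.2.1.castSucc (D j.2.2.2.2.castSucc (D j.2.1 (velF η j.1))))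

/-- The square of the weighted norm of three horizontal derivatives of the velocity gradient. -/
def tw (ρ : Fam ι) (η : Fin 3 → Fam ι) (c : ι) (t : ℝ) : ℝ :=
  ∑ j, integ (ev (velGrad3 ρ η j * velGrad3 ρ η j) c t)

theorem integ_sq_nonneg (f : Fam ι) (c t) : 0 ≤ integ (ev (f * f) c t) :=
  integ_nonneg_ev fun _ _ => mul_self_nonneg _

theorem l2_reg4 (hF : Flow σ ρ η) (i k : Fin 3) (a b e d : Fin 2) : L2 σ (fun _ _ => 1)
    (ρ * D a.castSucc (D b.castSucc (D e.castSucc (D d.castSucc (D k (η i)))))) :=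
  (hF.reg i k).d4 a b e d

/-- Interpolation in time. With Y = ∂̄³Dη, V = Y_t and Z = V_t one has d/dt ∫ρ²YV = ∫ρ²V² + ∫ρ²YZ.
The term with Z is bounded at each time by the weighted norm of ∂_t²η, so after integration over
[0,T] only ∫ρ²YV at the two end times remains. -/
theorem int_velGrad3 (hF : Flow σ ρ η) (j : Fin 3 × Fin 3 × Fin 2 × Fin 2 × Fin 2) :
    PolyBdd σ (fun _ _ => 1) (fun c _ => ∫ s in (0 : ℝ)..σ.T c,
      integ (ev (velGrad3 ρ η j * velGrad3 ρ η j) c s)) := by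
  obtain ⟨i, k, a, b, e⟩ := j
  set U : Fam ι := D b.castSucc (D e.castSucc (D k (velF η i))) with hU
  set V : Fam ι := D a.castSucc U with hV
  set Y : Fam ι := D a.castSucc (D b.castSucc (D e.castSucc (D k (η i)))) with hY
  set Z : Fam ι := D a.castSucc (D b.castSucc (D e.castSucc (D k (Dt (velF η i))))) with hZ
  have hYt : Dt Y = V := by simp only [hY, hV, hU, Dt_D]; rfl
  have hVt : Dt V = Z := by simp only [hV, hU, hZ, Dt_D]
  have hFt : Dt (ρ * Y * (ρ * V)) = ρ * V * (ρ * V) + ρ * Y * (ρ * Z) := by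
    simp only [Dt_mul, hF.rho_t, hYt, hVt]; ring
  have hYL : L2 σ (fun _ _ => 1) Y := (hF.reg i k).d3 _ _ _
  have hUL : L2 σ (fun _ _ => 1) U := hF.vel3 i _ _ _
  have hρ2 : Linf σ (ρ * ρ) := hF.weight.linf.mul hF.weight.linf
  have b1 : PolyBdd σ (fun _ _ => 1) (fun c t => |integ (ev (ρ * Y * (ρ * Z)) c t)|) :=
    .abs_integ_mul (L2.linf_mul hF.weight.linf hYL) (hF.acc4 i k a b e)
  -- One horizontal derivative is moved from V to ρ²Y. This costs ρ∂̄⁴Dη, which is in the energy,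
  -- and leaves ∂̄²Dv, which is bounded in L² because v is bounded in H³.
  have b2 : PolyBdd σ (fun _ _ => 1) (fun c t => |integ (ev (ρ * Y * (ρ * V)) c t)|) := by
    have hD : L2 σ (fun _ _ => 1) (D a.castSucc (ρ * ρ * Y)) := by
      rw [D_mul]
      refine .add weight_one ((L2.linf_mul hρ2 hYL).of_dom (hF.weight.dom_sq.1 a)) ?_
      rw [mul_assoc]
      exact L2.linf_mul hF.weight.linf (hF.l2_reg4 i k a a b e)
    refine (PolyBdd.abs_integ_mul hD hUL).mono fun c t ht => le_of_eq ?_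
    have hper : PerQ σ (ρ * ρ * Y * U) :=
      ((hF.rho_per.mul hF.rho_per).mul ((((hF.per_grad i k).D _).D _).D _)).mul
        ((((hF.per_vel i).D _).D _).D _)
    have h := integ_D_eq_zero hper a ht
    rw [D_mul, integ_add_ev] at h
    have e1 : ρ * Y * (ρ * V) = ρ * ρ * Y * V := by ring
    rw [e1, eq_neg_of_add_eq_zero_left h, abs_neg]
  obtain ⟨C, hC, n, hn⟩ := b1
  obtain ⟨C', hC', n', hn'⟩ := b2
  refine ⟨C + 2 * C', by positivity, n + n', fun c t ht => ?_⟩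
  have hT := (σ.pos c).le
  have h1 : ∫ s in (0 : ℝ)..σ.T c, integ (ev (Dt (ρ * Y * (ρ * V))) c s)
      = integ (ev (ρ * Y * (ρ * V)) c (σ.T c)) - integ (ev (ρ * Y * (ρ * V)) c 0) :=
    intervalIntegral.integral_eq_sub_of_hasDerivAt (fun s _ => hasDerivAt_integ _ c s)
      ((continuous_integ _ c).intervalIntegrable _ _)
  simp only [hFt, integ_add_ev] at h1
  rw [intervalIntegral.integral_add ((continuous_integ _ c).intervalIntegrable _ _)
    ((continuous_integ _ c).intervalIntegrable _ _)] at h1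
  have h2 : |∫ s in (0 : ℝ)..σ.T c, integ (ev (ρ * Y * (ρ * Z)) c s)| ≤ C * σ.B c ^ n := by
    have := intervalIntegral.norm_integral_le_of_norm_le_const (a := 0) (b := σ.T c)
      (C := C * σ.B c ^ n) (f := fun s => integ (ev (ρ * Y * (ρ * Z)) c s)) fun s hs => by
        rw [uIoc_of_le hT] at hs
        simpa using hn c s (Ioc_subset_Icc_self hs)
    rw [sub_zero, abs_of_nonneg hT, Real.norm_eq_abs] at this
    exact this.trans (mul_le_of_le_one_right (mul_nonneg hC (σ.pow_pos c n).le) (hF.T_le c))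
  have h3 := hn' c _ (right_mem_Icc.2 hT)
  have h4 := hn' c _ (left_mem_Icc.2 hT)
  have h5 := σ.add_le c hC (mul_nonneg zero_le_two hC') n n'
  rw [mul_one] at h3 h4 ⊢
  rw [abs_le] at h2 h3 h4
  show ∫ s in (0 : ℝ)..σ.T c, integ (ev (ρ * V * (ρ * V)) c s) ≤ _
  linarith [h2.1, h2.2, h3.1, h3.2, h4.1, h4.2]

theorem timeWeight (hF : Flow σ ρ η) : TimeWeight σ (tw ρ η) where
  T_le := hF.T_le
  cont := fun c => continuous_finsetSum _ fun j _ => continuous_integ _ c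
  nonneg := fun c t => Finset.sum_nonneg fun j _ => integ_sq_nonneg _ c t
  int := by
    have key : ∀ s : Finset (Fin 3 × Fin 3 × Fin 2 × Fin 2 × Fin 2),
        PolyBdd σ (fun _ _ => 1) (fun c _ => ∑ j ∈ s, ∫ r in (0 : ℝ)..σ.T c,
          integ (ev (velGrad3 ρ η j * velGrad3 ρ η j) c r)) := by
      classical
      intro s
      induction s using Finset.induction_on with
      | empty => simpa using PolyBdd.const (σ := σ) le_rfl
      | insert a s ha ih =>
        simp only [Finset.sum_insert ha]
        exact (hF.int_velGrad3 a).add weight_one ih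
    refine (key Finset.univ).mono fun c t _ => le_of_eq ?_
    exact intervalIntegral.integral_finsetSum fun j _ => (continuous_integ _ c).intervalIntegrable _ _

/-- The weight with the time derivatives. -/
def wt (ρ : Fam ι) (η : Fin 3 → Fam ι) (c : ι) (t : ℝ) : ℝ := 1 + tw ρ η c t

theorem one_le_wt (hF : Flow σ ρ η) (c t) : 1 ≤ wt ρ η c t := by
  have := hF.timeWeight.nonneg c t
  rw [wt]; linarith

theorem wt_nonneg (hF : Flow σ ρ η) (c t) : 0 ≤ wt ρ η c t := zero_le_one.trans (hF.one_le_wt c t)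

/-- The weighted third horizontal derivatives are bounded at each time only by `wt`, which contains
their squared norms by definition; that this weight is integrable in time is `timeWeight`. The
remaining bounds come from v in H³. -/
theorem mid_vel (hF : Flow σ ρ η) (i k : Fin 3) : Mid σ (wt ρ η) ρ (D k (velF η i)) where
  d0 := (hF.vel1 i k).linf fun j => (hF.vel2 i j k).l6 fun l => hF.vel3 i l j k
  d1 := fun j => (hF.vel2 i j k).l6 fun l => hF.vel3 i l j k
  d2 := fun j l => hF.vel3 i j l k
  d3 := fun a b e => by
    refine ⟨fun c t _ => Continuous.integrableOn_cell ((continuous_ev _ c t).pow 2),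
      1, zero_le_one, 0, fun c t _ => ?_⟩
    have h := Finset.single_le_sum
      (f := fun j => integ (ev (velGrad3 ρ η j * velGrad3 ρ η j) c t))
      (fun j _ => integ_sq_nonneg _ c t) (Finset.mem_univ (i, k, a, b, e))
    have h' : ∫ x in cell, ev (velGrad3 ρ η (i, k, a, b, e)) c t x ^ 2 ≤ tw ρ η c t := by
      simp only [sq]; exact h
    rw [pow_zero, one_mul, one_mul, wt]
    exact h'.trans (by linarith)

end Flow

end

end VacuumEuler

/-! ### The energy identity and the bounds for its error terms. -/

namespace VacuumEuler

open MeasureTheory Fam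

noncomputable section

variable {ι : Type*} {σ : Scale ι} {w : ι → ℝ → ℝ}

namespace Flow

/-! ### The energy identity -/

section Defs

variable (ρ : Fam ι) (η : Fin 3 → Fam ι) (a b e d : Fin 2)

/-- The differentiated flow map. -/
def yF (i : Fin 3) : Fam ι := hd a b e d (η i)

/-- The differentiated velocity. -/
def wF (i : Fin 3) : Fam ι := hd a b e d (velF η i)

/-- The differentiated weighted stress. -/
def sF (k i : Fin 3) : Fam ι := hd a b e d (ρ * ρ * stress η k i)

/-- The principal part of the differentiated stress. -/
def pF (k i : Fin 3) : Fam ι := ∑ s, ∑ r, stiff η k i s r * D s (yF η a b e d r)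

/-- The remainder of the differentiated weighted stress. -/
def rF (k i : Fin 3) : Fam ι := sF ρ η a b e d k i - ρ * ρ * pF η a b e d k i

/-- The contribution of the time derivative of the stiffness. -/
def qF (k i : Fin 3) : Fam ι := ∑ s, ∑ r, Dt (stiff η k i s r) * D s (yF η a b e d r)

/-- The commutator in the acceleration term. -/
def cF (i : Fin 3) : Fam ι :=
  hd a b e d (ρ * Dt (velF η i)) - ρ * hd a b e d (Dt (velF η i))

/-- The energy density. -/
def psiF : Fam ι :=
  (1 / 2 : ℝ) • (∑ i, ρ * (wF η a b e d i * wF η a b e d i))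
    - (1 / 2 : ℝ) • (∑ k, ∑ i, ρ * ρ * (pF η a b e d k i * D k (yF η a b e d i)))
    - ∑ k, ∑ i, rF ρ η a b e d k i * D k (yF η a b e d i)

end Defs

variable {ρ : Fam ι} {η : Fin 3 → Fam ι} {a b e d : Fin 2}

theorem Dt_yF (i : Fin 3) : Dt (yF η a b e d i) = wF η a b e d i := Dt_hd _ _ _ _ _

theorem Dt_pF (k i : Fin 3) : Dt (pF η a b e d k i) = qF η a b e d k i
    + ∑ s, ∑ r, stiff η k i s r * D s (wF η a b e d r) := by
  simp only [pF, qF, map_sum, Dt_mul, Dt_D, Dt_yF, Finset.sum_add_distrib]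

/-- The index pairs (k,i) and (s,r) are exchanged, using `stiff_symm`; the rest reorders the sums.
-/
theorem pairing_symm : ∑ k, ∑ i, (∑ s, ∑ r, stiff η k i s r * D s (wF η a b e d r))
      * D k (yF η a b e d i)
    = ∑ k, ∑ i, pF η a b e d k i * D k (wF η a b e d i) := by
  simp only [pF, Finset.sum_mul]
  calc _ = ∑ k, ∑ i, ∑ s, ∑ r, stiff η s r k i * D s (wF η a b e d r) * D k (yF η a b e d i) := by
        refine Finset.sum_congr rfl fun k _ => Finset.sum_congr rfl fun i _ =>
          Finset.sum_congr rfl fun s _ => Finset.sum_congr rfl fun r _ => ?_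
        rw [stiff_symm]
    _ = ∑ k, ∑ s, ∑ i, ∑ r, stiff η s r k i * D s (wF η a b e d r) * D k (yF η a b e d i) :=
        Finset.sum_congr rfl fun k _ => Finset.sum_comm
    _ = ∑ s, ∑ k, ∑ i, ∑ r, stiff η s r k i * D s (wF η a b e d r) * D k (yF η a b e d i) :=
        Finset.sum_comm
    _ = ∑ s, ∑ k, ∑ r, ∑ i, stiff η s r k i * D s (wF η a b e d r) * D k (yF η a b e d i) :=
        Finset.sum_congr rfl fun s _ => Finset.sum_congr rfl fun k _ => Finset.sum_comm
    _ = ∑ s, ∑ r, ∑ k, ∑ i, stiff η s r k i * D s (wF η a b e d r) * D k (yF η a b e d i) :=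
        Finset.sum_congr rfl fun s _ => Finset.sum_comm
    _ = _ := by
        refine Finset.sum_congr rfl fun k _ => Finset.sum_congr rfl fun i _ =>
          Finset.sum_congr rfl fun s _ => Finset.sum_congr rfl fun r _ => ?_
        ring

/-- The momentum equation in divergence form. -/
theorem momentum_div (hF : Flow σ ρ η) (i : Fin 3) :
    EqQ σ (ρ * Dt (velF η i)) (-∑ k, D k (ρ * ρ * stress η k i)) := by
  have h1 : ∑ k, D k (ρ * ρ * stress η k i)
      = ∑ k, cofG η k i * D k (ρ * ρ * (invJ η * invJ η)) := by
    have h2 : ∀ k, D k (ρ * ρ * stress η k i) = cofG η k i * D k (ρ * ρ * (invJ η * invJ η))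
        + ρ * ρ * (invJ η * invJ η) * D k (cofG η k i) := fun k => by
      have h3 : ρ * ρ * stress η k i = ρ * ρ * (invJ η * invJ η) * cofG η k i := by
        rw [stress, invG_apply]; ring
      rw [h3, D_mul]; ring
    rw [Finset.sum_congr rfl fun k _ => h2 k, Finset.sum_add_distrib, ← Finset.mul_sum, piola,
      mul_zero, add_zero]
  intro c t ht x hx
  have := hF.momentum i c t ht x hx
  rw [h1, ev_neg]
  rw [ev_add, ev_zero] at this
  linarith

theorem momentum_hd (hF : Flow σ ρ η) (i : Fin 3) :
    EqQ σ (ρ * Dt (wF η a b e d i))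
      (-(∑ k, D k (sF ρ η a b e d k i)) - cF ρ η a b e d i) := by
  intro c t ht x hx
  have h := (hF.momentum_div i).hd a b e d c t ht x hx
  rw [map_neg, map_sum] at h
  simp only [hd_D] at h
  rw [ev_sub, cF, ev_sub, h, wF, Dt_hd]
  simp only [sF]
  ring

/-- By the symmetry of the stiffness, ½ρ²(c:Dy):Dy yields ρ²(c:Dy):Dw and a term with c_t. The term
r:Dy yields r:Dw and r_t:Dy. The two contributions with Dw add up to the full stress ∂̄⁴(ρ²τ):Dw. -/
theorem Dt_psiF (hF : Flow σ ρ η) : Dt (psiF ρ η a b e d)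
    = (∑ i, ρ * Dt (wF η a b e d i) * wF η a b e d i)
      - (∑ k, ∑ i, sF ρ η a b e d k i * D k (wF η a b e d i))
      - (1 / 2 : ℝ) • (∑ k, ∑ i, ρ * ρ * (qF η a b e d k i * D k (yF η a b e d i)))
      - ∑ k, ∑ i, Dt (rF ρ η a b e d k i) * D k (yF η a b e d i) := by
  have hsymm := pairing_symm (η := η) (a := a) (b := b) (e := e) (d := d)
  refine ext_ev fun c t x => ?_
  have hs := congrArg (fun f => ev f c t x) hsymm
  simp only [psiF, map_sub, Derivation.map_smul, map_sum, Dt_mul, hF.rho_t, Dt_D, Dt_yF, Dt_pF]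
  have hr : ∀ k i, ev (rF ρ η a b e d k i) c t x = ev (sF ρ η a b e d k i) c t x
      - ev ρ c t x * ev ρ c t x * ev (pF η a b e d k i) c t x := fun k i => rfl
  set HW : Fin 3 → Fin 3 → Fam ι := fun k i => ∑ s, ∑ r, stiff η k i s r * D s (wF η a b e d r)
    with hHW
  have hHW' : ∀ k i, ∑ s, ∑ r, stiff η k i s r * D s (wF η a b e d r) = HW k i := fun _ _ => rfl
  simp only [hHW'] at hs ⊢
  clear_value HW
  simp only [ev_add, ev_sub, ev_mul, ev_smul, hr, zero_mul, mul_zero, zero_add,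
    Fin.sum_univ_three] at hs ⊢
  linear_combination (1 / 2 : ℝ) * (-(ev ρ c t x * ev ρ c t x)) * hs

/-- After insertion of the momentum equation, w·(∂ₖ of the stress) and stress:Dw combine to a
divergence, so Dw disappears from the volume terms. -/
theorem Dt_psiF_eq (hF : Flow σ ρ η) : EqQ σ (Dt (psiF ρ η a b e d))
    (-(∑ k, D k (∑ i, wF η a b e d i * sF ρ η a b e d k i))
      - (∑ i, cF ρ η a b e d i * wF η a b e d i)
      - (1 / 2 : ℝ) • (∑ k, ∑ i, ρ * ρ * (qF η a b e d k i * D k (yF η a b e d i)))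
      - ∑ k, ∑ i, Dt (rF ρ η a b e d k i) * D k (yF η a b e d i)) := by
  intro c t ht x hx
  rw [hF.Dt_psiF]
  simp only [map_sum, D_mul]
  have hm := fun i => hF.momentum_hd (a := a) (b := b) (e := e) (d := d) i c t ht x hx
  simp only [ev_sub, ev_neg, ev_sum, ev_mul, ev_add] at hm ⊢
  simp only [hm, Fin.sum_univ_three]
  ring

/-- The flux vanishes on the top because ρ does. On the bottom its third component is w³ times the
normal stress plus terms with tangential stress, and both vanish there. -/
theorem integ_Dt_psiF (hF : Flow σ ρ η) {c t} (ht : t ∈ Icc 0 (σ.T c)) :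
    integ (ev (Dt (psiF ρ η a b e d)) c t)
      = integ (ev (-(∑ i, cF ρ η a b e d i * wF η a b e d i)
      + -((1 / 2 : ℝ) • (∑ k, ∑ i, ρ * ρ * (qF η a b e d k i * D k (yF η a b e d i))))
      + -(∑ k, ∑ i, Dt (rF ρ η a b e d k i) * D k (yF η a b e d i))) c t) := by
  have hdiv : integ (ev (∑ k, D k (∑ i, wF η a b e d i * sF ρ η a b e d k i)) c t) = 0 := by
    refine integ_div_eq_zero (σ := σ) (fun α => .sum fun i => ?_) ?_ ?_ ht
    · exact ((hF.per_vel i).hd a b e d).mul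
        (((hF.rho_per.mul hF.rho_per).mul (perQ_stress hF.per_grad _ i)).hd a b e d)
    · rw [Fin.sum_univ_three]
      -- The cofactors a³₁ and a³₂ contain only products with a horizontal derivative of η³, which
      -- is zero on the bottom.
      have hc : ∀ i : Fin 3, i ≠ 2 → Van σ 0 (sF ρ η a b e d 2 i) := fun i hi => by
        refine Van.hd (Van.mul_left ?_ _) a b e d
        refine Van.mul_left (Van.mul_left ?_ _) _
        have h0 : Van σ 0 (grad η 2 0) := hF.bottom_pos.D 0
        have h1 : Van σ 0 (grad η 2 1) := hF.bottom_pos.D 1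
        rw [cofG, Matrix.adjugate_fin_three]
        fin_cases i
        · exact (h1.mul_left (grad η 1 0)).sub (h0.mul_left (grad η 1 1))
        · intro c t ht x hx
          have := (h1.mul_left (grad η 0 0)) c t ht x hx
          have := (h0.mul_left (grad η 0 1)) c t ht x hx
          show ev (-(grad η 0 0 * grad η 2 1) + grad η 0 1 * grad η 2 0) c t x = 0
          rw [ev_add, ev_neg]; linarith
        · exact absurd rfl hi
      exact (((hc 0 (by decide)).mul_left _).add ((hc 1 (by decide)).mul_left _)).add
        ((hF.bottom_vel.hd a b e d).mul_right _)
    · have : ∀ i, Van σ 1 (wF η a b e d i * sF ρ η a b e d 2 i) := fun i =>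
        (((hF.rho_top.mul_right ρ).mul_right _).hd a b e d).mul_left _
      rw [Fin.sum_univ_three]
      exact ((this 0).add (this 1)).add (this 2)
  rw [integ_congr hF.Dt_psiF_eq ht]
  simp only [integ_add_ev, integ_sub_ev, integ_neg_ev, hdiv]
  ring

/-! ### Bounds for the error terms -/

theorem reg4_stiff (hF : Flow σ ρ η) (k i s r : Fin 3) : Reg4 σ ρ (stiff η k i s r) :=
  hF.nonDeg.reg4_stiff hF.weight.linf hF.reg k i s r

theorem linf_Dt_invJ (hF : Flow σ ρ η) : Linf σ (Dt (invJ η)) :=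
  (((hF.nonDeg.reg4_invJ hF.weight.linf hF.reg).d0.mul (.sum fun s => .sum fun r =>
    (hF.nonDeg.reg4_invG hF.weight.linf hF.reg s r).d0.mul (hF.mid_vel r s).d0)).neg).congr
    hF.nonDeg.Dt_invJ

theorem linf_Dt_invG (hF : Flow σ ρ η) (k i : Fin 3) : Linf σ (Dt (invG η k i)) :=
  (Linf.neg (.sum fun s => .sum fun r =>
    ((hF.nonDeg.reg4_invG hF.weight.linf hF.reg k r).d0.mul (hF.mid_vel r s).d0).mul
      (hF.nonDeg.reg4_invG hF.weight.linf hF.reg s i).d0)).congr (hF.nonDeg.Dt_invG k i)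

theorem linf_Dt_stiff (hF : Flow σ ρ η) (k i s r : Fin 3) : Linf σ (Dt (stiff η k i s r)) := by
  have g := fun k i => (hF.nonDeg.reg4_invG hF.weight.linf hF.reg k i).d0
  have g' := hF.linf_Dt_invG
  have h := (hF.nonDeg.reg4_invJ hF.weight.linf hF.reg).d0
  rw [stiff, map_neg, Dt_mul, map_add, Dt_mul, Dt_mul]
  exact ((hF.linf_Dt_invJ.mul (((g _ _).mul (g _ _)).add ((g _ _).mul (g _ _)))).add
    (h.mul ((((g' _ _).mul (g _ _)).add ((g _ _).mul (g' _ _))).add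
      (((g' _ _).mul (g _ _)).add ((g _ _).mul (g' _ _)))))).neg

theorem l2_grad_yF (hF : Flow σ ρ η) (k i : Fin 3) :
    L2 σ (fun _ _ => 1) (ρ * D k (yF η a b e d i)) := by
  rw [yF, ← hd_D]; exact hF.l2_reg4 i k a b e d

theorem slow_qF (hF : Flow σ ρ η) (k i : Fin 3) :
    SlowBd σ (tw ρ η) (ρ * ρ * (qF η a b e d k i * D k (yF η a b e d i))) := by
  refine .of_polyBdd hF.timeWeight ?_
  have h1 : L2 σ (fun _ _ => 1) (ρ * qF η a b e d k i) := by
    rw [qF, Finset.mul_sum]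
    refine .sum weight_one fun s => ?_
    rw [Finset.mul_sum]
    refine .sum weight_one fun r => ?_
    rw [mul_left_comm]
    exact L2.linf_mul (hF.linf_Dt_stiff k i s r) (hF.l2_grad_yF s r)
  have := PolyBdd.abs_integ_mul h1 (hF.l2_grad_yF (a := a) (b := b) (e := e) (d := d) k i)
  rwa [show ρ * ρ * (qF η a b e d k i * D k (yF η a b e d i))
    = ρ * qF η a b e d k i * (ρ * D k (yF η a b e d i)) by ring]

/-- As τ_t = c:Dv, differentiation of r gives ∂̄⁴(ρ² c:Dv) - ρ² c:∂̄⁴Dv, a commutator in which ∂̄⁴Dv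
cancels, minus ρ² c_t:Dy. Hence `commutator_weight` applies with v replaced by Dv. -/
theorem l2div_Dt_rF (hF : Flow σ ρ η) (k i : Fin 3) :
    L2div σ (wt ρ η) ρ (Dt (rF ρ η a b e d k i)) := by
  have hw0 := hF.wt_nonneg
  have h1 : L2div σ (wt ρ η) ρ (∑ s, ∑ r,
      (hd a b e d (ρ * ρ * (stiff η k i s r * D s (velF η r)))
        - ρ * ρ * (stiff η k i s r * hd a b e d (D s (velF η r))))) :=
    .sum hw0 fun s => .sum hw0 fun r =>
      (hF.mid_vel r s).commutator_weight hF.weight hF.one_le_wt (hF.reg4_stiff k i s r) a b e d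
  have h2 : L2div σ (wt ρ η) ρ (ρ * ρ * qF η a b e d k i) := by
    refine .of_dom (s := ρ) hF.weight.pos ?_ (Dom.refl _)
    rw [qF, Finset.mul_sum]
    refine .sum hw0 fun s => ?_
    rw [Finset.mul_sum]
    refine .sum hw0 fun r => ?_
    rw [mul_left_comm]
    exact (L2.linf_mul (hF.linf_Dt_stiff k i s r) (hF.l2_grad_yF s r)).of_one hF.one_le_wt
  refine (h1.add hw0 h2.neg).congr fun c t ht x hx => ?_
  have h3 : EqQ σ (ρ * ρ * Dt (stress η k i))
      (∑ s, ∑ r, ρ * ρ * (stiff η k i s r * D s (velF η r))) := by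
    intro c t ht x hx
    rw [ev_mul, hF.nonDeg.Dt_stress k i c t ht x hx]
    simp only [ev_sum, ev_mul, Finset.mul_sum]
  have h4 := h3.hd a b e d c t ht x hx
  simp only [map_sum] at h4
  simp only [rF, sF, map_sub, Dt_hd, Dt_mul, hF.rho_t, Dt_pF, zero_mul, mul_zero, add_zero,
    zero_add]
  rw [ev_sub, h4]
  simp only [ev_add, ev_sub, ev_neg, ev_mul, ev_sum, hd_D, wF, Finset.mul_sum,
    Finset.sum_sub_distrib, mul_add]
  ring

/-- At least one derivative falls on ρ, and ∂̄ʲρ is dominated by ρ, so at most three derivatives of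
v_t are needed, without weight. These are in the H³ norm of ∂_t²η. -/
theorem l2div_cF (hF : Flow σ ρ η) (i : Fin 3) :
    L2div σ (fun _ _ => 1) ρ (cF ρ η a b e d i) := by
  have e1 : ∀ {r f : Fam ι}, L2 σ (fun _ _ => 1) f → Dom σ r ρ → L2div σ (fun _ _ => 1) ρ (r * f) :=
    fun {r f} hf hr => .of_dom (s := 1) hF.weight.pos (by rwa [one_mul]) (by rwa [mul_one])
  have k1 : ∀ a b e d : Fin 2, L2div σ (fun _ _ => 1) ρ
      (D a.castSucc ρ * D b.castSucc (D e.castSucc (D d.castSucc (Dt (velF η i))))) :=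
    fun a b e d => e1 (hF.acc3 _ _ _ _) (hF.weight.dom1 a)
  have k2 : ∀ a b e d : Fin 2, L2div σ (fun _ _ => 1) ρ
      (D a.castSucc (D b.castSucc ρ) * D e.castSucc (D d.castSucc (Dt (velF η i)))) :=
    fun a b e d => e1 (hF.acc2 _ _ _) (hF.weight.dom2 a b)
  have k3 : ∀ a b e d : Fin 2, L2div σ (fun _ _ => 1) ρ
      (D a.castSucc (D b.castSucc (D e.castSucc ρ)) * D d.castSucc (Dt (velF η i))) :=
    fun a b e d => e1 (hF.acc1 _ _) (hF.weight.dom3 a b e)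
  have k4 : L2div σ (fun _ _ => 1) ρ
      (D a.castSucc (D b.castSucc (D e.castSucc (D d.castSucc ρ))) * Dt (velF η i)) :=
    e1 (hF.acc0 _) (hF.weight.dom4 a b e d)
  have a4 : ∀ {p q r s : Fam ι}, L2div σ (fun _ _ => 1) ρ p → L2div σ (fun _ _ => 1) ρ q →
      L2div σ (fun _ _ => 1) ρ r → L2div σ (fun _ _ => 1) ρ s →
      L2div σ (fun _ _ => 1) ρ (p + q + r + s) :=
    fun hp hq hr hs => ((hp.add weight_one hq).add weight_one hr).add weight_one hs
  rw [cF, hd_apply, hd_apply, leibniz_four, show ∀ p q r : Fam ι, p + q + r - p = q + r from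
    fun p q r => by ring]
  exact .add weight_one k4 (.add weight_one (.add weight_one
    (a4 (k1 _ _ _ _) (k1 _ _ _ _) (k1 _ _ _ _) (k1 _ _ _ _))
    (a4 (k3 _ _ _ _) (k3 _ _ _ _) (k3 _ _ _ _) (k3 _ _ _ _)))
    (a4 (k2 _ _ _ _) (k2 _ _ _ _) (k2 _ _ _ _)
      (.add weight_one (.add weight_one (k2 _ _ _ _) (k2 _ _ _ _)) (k2 _ _ _ _))))

/-- With q = c/ρ in L², |c w| = ρ|q w| ≤ ρq² + ρw², and √ρ w is in the energy. No time weight is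
needed here. -/
theorem slow_cF (hF : Flow σ ρ η) (i : Fin 3) :
    SlowBd σ (tw ρ η) (cF ρ η a b e d i * wF η a b e d i) := by
  refine .of_polyBdd hF.timeWeight ?_
  have h1 := hF.l2div_cF (a := a) (b := b) (e := e) (d := d) i
  have h2 := hF.vel4 a b e d i
  obtain ⟨C, hC, n, hn⟩ := hF.weight.linf
  have h3 : IntBdd σ (fun _ _ => 1)
      (fun c t x => |ev (cF ρ η a b e d i * wF η a b e d i) c t x|) := by
    refine (IntBdd.add weight_one h1 h2).mono
      (fun c t => (continuous_abs.comp (continuous_ev _ c t)).measurable)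
      (show 0 ≤ C + 1 by linarith) n fun c t ht x hx => ?_
    rw [abs_abs]
    have h0 := hF.weight.pos c t ht x hx
    have hb := hn c t ht x hx
    rw [abs_of_pos h0] at hb
    have hB : 1 ≤ σ.B c ^ n := one_le_pow₀ (σ.one_le c)
    simp only [ev_mul]
    change |_ * ev (wF η a b e d i) c t x| ≤ (C + 1) * σ.B c ^ n * ((_ / _) ^ 2
      + _ * (ev (wF η a b e d i) c t x * ev (wF η a b e d i) c t x))
    generalize ev (wF η a b e d i) c t x = W
    have e1 : ev (cF ρ η a b e d i) c t x
        = ev (cF ρ η a b e d i) c t x / ev ρ c t x * ev ρ c t x := by field_simp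
    rw [e1]
    generalize ev (cF ρ η a b e d i) c t x / ev ρ c t x = q at *
    generalize ev ρ c t x = r at *
    have e2 : q * r / r = q := by field_simp
    rw [e2, abs_le]
    have hq : r * q ^ 2 ≤ C * σ.B c ^ n * q ^ 2 := mul_le_mul_of_nonneg_right hb (sq_nonneg _)
    have hW : 0 ≤ r * (W * W) := mul_nonneg h0.le (mul_self_nonneg _)
    have hW1 : r * (W * W) ≤ (C + 1) * σ.B c ^ n * (r * (W * W)) :=
      le_mul_of_one_le_left hW (by nlinarith)
    have hq2 : 0 ≤ σ.B c ^ n * q ^ 2 := by positivity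
    have p1 : 0 ≤ r * (q + W) ^ 2 := mul_nonneg h0.le (sq_nonneg _)
    have p2 : 0 ≤ r * (q - W) ^ 2 := mul_nonneg h0.le (sq_nonneg _)
    constructor <;> nlinarith
  exact h3.2.mono fun c t ht => abs_integral_le_integral_abs

theorem slow_rF (hF : Flow σ ρ η) (k i : Fin 3) :
    SlowBd σ (tw ρ η) (Dt (rF ρ η a b e d k i) * D k (yF η a b e d i)) := by
  obtain ⟨C, hC, n, hn⟩ := slow_pairing hF.weight.pos hF.timeWeight
    (hF.l2div_Dt_rF (a := a) (b := b) (e := e) (d := d) k i)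
    (hF.l2_grad_yF (a := a) (b := b) (e := e) (d := d) k i)
  exact ⟨C, hC, n, fun c t ht ε hε => hn c t ht t ht (fun _ => rfl) ε hε⟩

theorem growth_psiF (hF : Flow σ ρ η) : PolyBdd σ (rootT σ)
    (fun c t => |integ (ev (psiF ρ η a b e d) c t) - integ (ev (psiF ρ η a b e d) c 0)|) := by
  have hm := hF.timeWeight
  refine SlowBd.growth hm (SlowBd.congr ?_ fun c t ht => hF.integ_Dt_psiF ht)
  exact ((SlowBd.neg (.sum hm fun i => hF.slow_cF i)).add hm
    (SlowBd.neg (.smul _ (.sum hm fun k => .sum hm fun i => hF.slow_qF k i)))).add hm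
    (SlowBd.neg (.sum hm fun k => .sum hm fun i => hF.slow_rF k i))

end Flow

end

end VacuumEuler

/-! ### Curl, metric and initial remainder; the energy estimate for one choice of directions. -/

namespace VacuumEuler

open MeasureTheory Fam

noncomputable section

variable {ι : Type*} {σ : Scale ι} {w : ι → ℝ → ℝ}

/-! ### Values at a fixed time -/

/-- The values on the slab at a fixed time determine those of the spatial derivatives. -/
theorem ev_D_congr {f g : Fam ι} {c t} (h : ∀ x ∈ slab, ev f c t x = ev g c t x) (k : Fin 3) :
    ∀ x ∈ slab, ev (D k f) c t x = ev (D k g) c t x := fun x hx => by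
  rw [← pd_ev, ← pd_ev, pd, pd]
  congr 1
  refine Filter.EventuallyEq.fderiv_eq ?_
  filter_upwards [isOpen_slab.mem_nhds hx] with y hy using h y hy

theorem ev_hd_congr {f g : Fam ι} {c t} (h : ∀ x ∈ slab, ev f c t x = ev g c t x)
    (a b e d : Fin 2) : ∀ x ∈ slab, ev (hd a b e d f) c t x = ev (hd a b e d g) c t x :=
  ev_D_congr (ev_D_congr (ev_D_congr (ev_D_congr h _) _) _) _

theorem hd_algebraMap (r : ℝ) (a b e d : Fin 2) : hd a b e d (algebraMap ℝ (Fam ι) r) = 0 := by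
  rw [hd_apply, Derivation.map_algebraMap, map_zero, map_zero, map_zero]

theorem ev_algebraMap (r : ℝ) (c : ι) (t x) : ev (algebraMap ℝ (Fam ι) r) c t x = r := rfl

/-- The family that is frozen at the time `τ`. -/
def freeze (τ : ℝ) : Fam ι →ₐ[ℝ] Fam ι where
  toFun f := ⟨fun c p => f.1 c (τ, p.2), fun c => (f.2 c).comp (contDiff_const.prodMk contDiff_snd)⟩
  map_one' := rfl
  map_mul' _ _ := rfl
  map_zero' := rfl
  map_add' _ _ := rfl
  commutes' _ := rfl

theorem Dt_freeze (τ : ℝ) (f : Fam ι) : Dt (freeze τ f) = 0 :=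
  ext_ev fun c t x => by
    have h := hasDerivAt_ev (freeze τ f) c t x
    exact h.unique (hasDerivAt_const t (ev f c τ x))

theorem ev_of_Dt_eq_zero {f : Fam ι} (h : Dt f = 0) (c : ι) (s t : ℝ) (x : Point) :
    ev f c s x = ev f c t x :=
  is_const_of_deriv_eq_zero (fun r => (hasDerivAt_ev f c r x).differentiableAt)
    (fun r => by rw [(hasDerivAt_ev f c r x).deriv, h, ev_zero]) s t

/-- A bounded time derivative gives a small increment. -/
theorem Linf.increment {f : Fam ι} (hT : ∀ c, σ.T c ≤ 1) (h : Linf σ (Dt f)) :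
    ∃ C : ℝ, 0 ≤ C ∧ ∃ n : ℕ, ∀ c, ∀ t ∈ Icc 0 (σ.T c), ∀ x ∈ cell,
      |ev f c t x - ev f c 0 x| ≤ C * σ.B c ^ n * √(σ.T c) := by
  obtain ⟨C, hC, n, hn⟩ := h
  refine ⟨C, hC, n, fun c t ht x hx => ?_⟩
  have h := norm_image_sub_le_of_norm_deriv_le_segment' (f := fun s => ev f c s x) (a := 0) (b := t)
    (fun s _ => (hasDerivAt_ev f c s x).hasDerivWithinAt)
    (fun s hs => hn c s ⟨hs.1, hs.2.le.trans ht.2⟩ x hx) t (right_mem_Icc.2 ht.1)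
  rw [Real.norm_eq_abs, sub_zero] at h
  have h0 := mul_nonneg hC (σ.pow_pos c n).le
  -- The increment is of order t, which is weakened to √T by T ≤ 1 to match the other errors.
  have hs : t ≤ √(σ.T c) := ht.2.trans (Real.le_sqrt_of_sq_le (by
    have := σ.pos c
    have := hT c
    nlinarith))
  exact h.trans (mul_le_mul_of_nonneg_left hs h0)

theorem PolyBdd.abs_integ_increment {q f g : Fam ι} (hT : ∀ c, σ.T c ≤ 1) (hq : Linf σ (Dt q))
    (hq0 : ∀ c, ∀ x ∈ cell, ev q c 0 x = 0) (hf : L2 σ (fun _ _ => 1) f)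
    (hg : L2 σ (fun _ _ => 1) g) :
    PolyBdd σ (rootT σ) (fun c t => |integ (ev (q * (f * g)) c t)|) := by
  obtain ⟨C, hC, n, hn⟩ := hq.increment hT
  obtain ⟨C', hC', n', hn'⟩ := (IntBdd.add weight_one hf hg).2
  refine ⟨C * C', mul_nonneg hC hC', n + n', fun c t ht => ?_⟩
  have hfi := hf.1 c t ht
  have hgi := hg.1 c t ht
  have h0 : 0 ≤ C * σ.B c ^ n * √(σ.T c) :=
    mul_nonneg (mul_nonneg hC (σ.pow_pos c n).le) (Real.sqrt_nonneg _)
  calc |integ (ev (q * (f * g)) c t)|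
      ≤ ∫ x in cell, |ev (q * (f * g)) c t x| := abs_integral_le_integral_abs
    _ ≤ ∫ x in cell, C * σ.B c ^ n * √(σ.T c) * (ev f c t x ^ 2 + ev g c t x ^ 2) := by
        refine setIntegral_mono_on (continuous_ev _ c t).abs.integrableOn_cell
          ((hfi.add hgi).const_mul _) measurableSet_cell fun x hx => ?_
        have := hn c t ht x hx
        rw [hq0 c x hx, sub_zero] at this
        rw [ev_mul, abs_mul]
        refine mul_le_mul this ?_ (abs_nonneg _) h0
        rw [ev_mul, abs_le]
        constructor <;> nlinarith [sq_nonneg (ev f c t x + ev g c t x),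
          sq_nonneg (ev f c t x - ev g c t x), sq_nonneg (ev f c t x), sq_nonneg (ev g c t x)]
    _ = C * σ.B c ^ n * √(σ.T c) * ∫ x in cell, (ev f c t x ^ 2 + ev g c t x ^ 2) :=
        integral_const_mul _ _
    _ ≤ C * σ.B c ^ n * √(σ.T c) * (C' * σ.B c ^ n' * 1) :=
        mul_le_mul_of_nonneg_left (hn' c t ht) h0
    _ = _ := by rw [rootT, pow_add]; ring

namespace Flow

variable {ρ : Fam ι} {η : Fin 3 → Fam ι} {a b e d : Fin 2}

/-! ### The curl -/

/-- The curl of the differentiated flow map. -/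
def kF (η : Fin 3 → Fam ι) (a b e d : Fin 2) (j k : Fin 3) : Fam ι :=
  curlG (invG η) (yF η a b e d) j k

/-- Initially Dη is the identity, which four derivatives annihilate. -/
theorem grad_yF_zero (hF : Flow σ ρ η) (c : ι) (k i : Fin 3) :
    ∀ x ∈ slab, ev (D k (yF η a b e d i)) c 0 x = 0 := fun x hx => by
  rw [yF, ← hd_D]
  have := ev_hd_congr (f := D k (η i)) (g := algebraMap ℝ (Fam ι) (if i = k then 1 else 0))
    (c := c) (t := 0) (fun x hx => hF.init c x (slab_subset_closedSlab hx) i k) a b e d x hx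
  rw [this, hd_algebraMap, ev_zero]

/-- The time derivative is A_t:Dy plus the antisymmetric part of A:Dw. The latter equals ∂̄⁴curl_η v
up to the commutator of ∂̄⁴ with A, and ρ∂̄⁴curl_η v is part of the energy. -/
theorem l2_Dt_kF (hF : Flow σ ρ η) (j k : Fin 3) :
    L2 σ (wt ρ η) (ρ * Dt (kF η a b e d j k)) := by
  have hw0 := hF.wt_nonneg
  have h1 : ∀ j s k, L2 σ (wt ρ η) (ρ * (hd a b e d (invG η s j * D s (velF η k))
      - invG η s j * hd a b e d (D s (velF η k)))) := fun j s k =>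
    (hF.mid_vel k s).commutator hF.weight hF.one_le_wt
      (hF.nonDeg.reg4_invG hF.weight.linf hF.reg s j) a b e d
  have h2 : ∀ j s k, L2 σ (wt ρ η) (ρ * (Dt (invG η s j) * D s (yF η a b e d k))) :=
    fun j s k => by
      rw [mul_left_comm]
      exact (L2.linf_mul (hF.linf_Dt_invG s j) (hF.l2_grad_yF s k)).of_one hF.one_le_wt
  have h3 : ρ * Dt (kF η a b e d j k) = ρ * hd a b e d (curlG (invG η) (velF η) j k)
      + ∑ s, (ρ * (Dt (invG η s j) * D s (yF η a b e d k))
        - ρ * (Dt (invG η s k) * D s (yF η a b e d j))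
        - (ρ * (hd a b e d (invG η s j * D s (velF η k))
            - invG η s j * hd a b e d (D s (velF η k)))
          - ρ * (hd a b e d (invG η s k * D s (velF η j))
            - invG η s k * hd a b e d (D s (velF η j))))) := by
    simp only [kF, curlG, map_sum, map_sub, Dt_mul, Dt_D, Dt_yF, wF, hd_D]
    simp only [Fin.sum_univ_three]
    ring
  rw [h3]
  exact ((hF.curl4 a b e d j k).of_one hF.one_le_wt).add hw0 (.sum hw0 fun s =>
    ((h2 j s k).sub hw0 (h2 k s j)).sub hw0 ((h1 j s k).sub hw0 (h1 k s j)))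

theorem l2_kF (hF : Flow σ ρ η) (j k : Fin 3) :
    L2 σ (fun _ _ => 1) (ρ * kF η a b e d j k) := by
  have h2 : ∀ j s k, L2 σ (fun _ _ => 1) (ρ * (invG η s j * D s (yF η a b e d k))) :=
    fun j s k => by
      rw [mul_left_comm]
      exact L2.linf_mul (hF.nonDeg.reg4_invG hF.weight.linf hF.reg s j).d0 (hF.l2_grad_yF s k)
  rw [kF, curlG, Finset.mul_sum]
  refine .sum weight_one fun s => ?_
  rw [mul_sub]
  exact (h2 j s k).sub weight_one (h2 k s j)

/-- The curl of y is zero at t = 0, and the time derivative of ∫ρ²κ² is twice the pairing of ρκ_t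
with ρκ, the first of which is square integrable in time. -/
theorem small_kF (hF : Flow σ ρ η) (j k : Fin 3) : PolyBdd σ (rootT σ)
    (fun c t => |integ (ev (ρ * ρ * (kF η a b e d j k * kF η a b e d j k)) c t)|) := by
  have h6 := hF.l2_Dt_kF (a := a) (b := b) (e := e) (d := d) j k
  have h7 := hF.l2_kF (a := a) (b := b) (e := e) (d := d) j k
  have h8 : ∀ c, ∀ x ∈ cell, ev (kF η a b e d j k) c 0 x = 0 := fun c x hx => by
    simp only [kF, curlG, ev_sum, ev_sub, ev_mul,
      hF.grad_yF_zero c _ _ x (cell_subset_slab hx), mul_zero, sub_zero, Finset.sum_const_zero]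
  generalize kF η a b e d j k = κ at *
  have h1 : L2div σ (wt ρ η) ρ (ρ * ρ * Dt κ) :=
    .of_dom (s := ρ) hF.weight.pos h6 (Dom.refl _)
  obtain ⟨C, hC, n, hn⟩ := slow_pairing hF.weight.pos hF.timeWeight h1 h7
  have h2 : SlowBd σ (tw ρ η) (ρ * ρ * Dt κ * κ) :=
    ⟨C, hC, n, fun c t ht ε hε => hn c t ht t ht (fun _ => rfl) ε hε⟩
  have h3 : Dt (ρ * ρ * (κ * κ)) = (2 : ℝ) • (ρ * ρ * Dt κ * κ) := by
    rw [two_smul]; simp only [Dt_mul, hF.rho_t]; ring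
  have h4 := SlowBd.growth hF.timeWeight (F := ρ * ρ * (κ * κ)) (by rw [h3]; exact h2.smul 2)
  refine h4.mono fun c t ht => le_of_eq ?_
  have h5 : integ (ev (ρ * ρ * (κ * κ)) c 0) = 0 := by
    refine setIntegral_eq_zero_of_forall_eq_zero fun x hx => ?_
    simp only [ev_mul, h8 c x hx, mul_zero]
  rw [h5, sub_zero]

/-! ### The metric -/

/-- The deviation of the metric from its initial value. -/
def metricF (η : Fin 3 → Fam ι) (s r : Fin 3) : Fam ι :=
  invJ η * (∑ j, invG η s j * invG η r j) - algebraMap ℝ (Fam ι) (if s = r then 1 else 0)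

theorem evM_grad_zero (hF : Flow σ ρ η) (c : ι) {x : Point} (hx : x ∈ closedSlab) :
    evM (grad η) c 0 x = 1 := by
  ext i k
  rw [evM_apply, hF.init c x hx, Matrix.one_apply]

theorem invJ_zero (hF : Flow σ ρ η) (c : ι) {x : Point} (hx : x ∈ closedSlab) :
    ev (invJ η) c 0 x = 1 := by
  rw [hF.nonDeg.ev_invJ (left_mem_Icc.2 (σ.pos c).le) hx, ev_detG, hF.evM_grad_zero c hx,
    Matrix.det_one, inv_one]

theorem invG_zero (hF : Flow σ ρ η) (c : ι) {x : Point} (hx : x ∈ closedSlab) (k i : Fin 3) :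
    ev (invG η k i) c 0 x = if k = i then 1 else 0 := by
  rw [← evM_apply, hF.nonDeg.evM_invG_eq (left_mem_Icc.2 (σ.pos c).le) hx, hF.evM_grad_zero c hx,
    inv_one, Matrix.one_apply]

theorem metricF_zero (hF : Flow σ ρ η) (s r : Fin 3) (c : ι) {x : Point} (hx : x ∈ cell) :
    ev (metricF η s r) c 0 x = 0 := by
  have hx' := cell_subset_closedSlab hx
  simp only [metricF, ev_sub, ev_mul, ev_sum, ev_algebraMap, hF.invJ_zero c hx',
    hF.invG_zero c hx', one_mul, ite_mul, zero_mul, Finset.sum_ite_eq, Finset.mem_univ, if_true]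
  simp [eq_comm]

theorem linf_Dt_metricF (hF : Flow σ ρ η) (s r : Fin 3) : Linf σ (Dt (metricF η s r)) := by
  have g := fun k i => (hF.nonDeg.reg4_invG hF.weight.linf hF.reg k i).d0
  have h := (hF.nonDeg.reg4_invJ hF.weight.linf hF.reg).d0
  rw [metricF, map_sub, Derivation.map_algebraMap, sub_zero, Dt_mul, map_sum]
  refine (hF.linf_Dt_invJ.mul (.sum fun j => (g _ _).mul (g _ _))).add (h.mul (.sum fun j => ?_))
  rw [Dt_mul]
  exact ((hF.linf_Dt_invG _ _).mul (g _ _)).add ((g _ _).mul (hF.linf_Dt_invG _ _))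

/-- The metric deviation starts from zero and has a bounded time derivative, and ρDy is in L² at
each time. -/
theorem small_metricF (hF : Flow σ ρ η) (i s r : Fin 3) : PolyBdd σ (rootT σ) (fun c t =>
    |integ (ev (metricF η s r * (ρ * D s (yF η a b e d i) * (ρ * D r (yF η a b e d i)))) c t)|) :=
  .abs_integ_increment hF.T_le (hF.linf_Dt_metricF s r) (fun c _ hx => hF.metricF_zero s r c hx)
    (hF.l2_grad_yF s i) (hF.l2_grad_yF r i)

/-- Coercivity of the quadratic form of the stiffness up to the curl. -/
theorem coercive (hF : Flow σ ρ η) {c t} (ht : t ∈ Icc 0 (σ.T c)) {x} (hx : x ∈ closedSlab) :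
    ev (∑ i, ∑ k, ρ * D k (yF η a b e d i) * (ρ * D k (yF η a b e d i))
      + ∑ i, ∑ s, ∑ r, metricF η s r * (ρ * D s (yF η a b e d i) * (ρ * D r (yF η a b e d i)))
      - ∑ j, ∑ k, ρ * ρ * (kF η a b e d j k * kF η a b e d j k)) c t x
    ≤ ev (-(∑ k, ∑ i, ρ * ρ * (pF η a b e d k i * D k (yF η a b e d i)))) c t x := by
  have h0 := hF.nonDeg.invJ_pos ht hx
  have h2 := hF.nonDeg.invJ_le ht hx
  simp only [pF, stiff, kF, curlG, metricF, ev_add, ev_sub, ev_neg, ev_mul, ev_sum, ev_algebraMap]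
  generalize ev (invJ η) c t x = h at *
  generalize ev ρ c t x = q
  obtain ⟨A, hA⟩ : ∃ A : Fin 3 → Fin 3 → ℝ, A = fun s j => ev (invG η s j) c t x := ⟨_, rfl⟩
  obtain ⟨Y, hY⟩ : ∃ Y : Fin 3 → Fin 3 → ℝ, Y = fun s i => ev (D s (yF η a b e d i)) c t x :=
    ⟨_, rfl⟩
  have hA' : ∀ s j, ev (invG η s j) c t x = A s j := fun s j => by rw [hA]
  have hY' : ∀ s i, ev (D s (yF η a b e d i)) c t x = Y s i := fun s i => by rw [hY]
  simp only [hA', hY']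
  clear hA hY hA' hY' hx ht
  -- With G = A:Dy and κ = G - Gᵀ one has tr(G²) = |G|² - ½|κ|². The difference of the two sides is
  -- therefore ρ² times J⁻¹(tr G)² + (1 - J⁻¹/2)|κ|², and J⁻¹ ≤ 2 because J ≥ 1/2.
  have key : ∀ κ : Fin 3 → Fin 3 → ℝ, (∀ j k, κ j k = ∑ s, (A s j * Y s k - A s k * Y s j)) →
      0 ≤ q ^ 2 * (h * (∑ s, ∑ i, A s i * Y s i) ^ 2 + (1 - h / 2) * ∑ j, ∑ k, κ j k ^ 2) :=
    fun κ _ => mul_nonneg (sq_nonneg q) (add_nonneg (mul_nonneg h0.le (sq_nonneg _))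
      (mul_nonneg (by linarith) (Finset.sum_nonneg fun j _ => Finset.sum_nonneg fun k _ =>
        sq_nonneg _)))
  have key := key _ fun _ _ => rfl
  rw [← sub_nonneg]
  refine key.trans (le_of_eq ?_)
  simp only [Fin.sum_univ_three, Fin.isValue, Fin.reduceEq, if_true, if_false]
  ring

/-! ### The remainder -/

/-- At t = 0 the stress is the identity and Dy = 0, so only ∂̄⁴ of ρ² is left, on the diagonal. -/
theorem rF_zero (hF : Flow σ ρ η) (k i : Fin 3) (c : ι) {x : Point} (hx : x ∈ slab) :
    ev (rF ρ η a b e d k i) c 0 x = if k = i then ev (hd a b e d (ρ * ρ)) c 0 x else 0 := by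
  have h1 : ev (pF η a b e d k i) c 0 x = 0 := by
    simp only [pF, ev_sum, ev_mul, hF.grad_yF_zero c _ _ x hx, mul_zero, Finset.sum_const_zero]
  have h2 := ev_hd_congr (f := ρ * ρ * stress η k i)
    (g := (if k = i then (1 : ℝ) else 0) • (ρ * ρ)) (c := c) (t := 0) (fun x hx => by
      have hx' := slab_subset_closedSlab hx
      simp only [stress, ev_mul, ev_smul, hF.invJ_zero c hx', hF.invG_zero c hx', one_mul,
        mul_comm]) a b e d x hx
  rw [rF, ev_sub, ev_mul, h1, mul_zero, sub_zero, sF, h2, map_smul, ev_smul]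
  split_ifs <;> simp

/-- Dy is frozen at the final time t and only r evolves from 0 to t. The time derivative of the
integral then involves r_t alone, so no bound for Dw is needed. -/
theorem growth_rF (hF : Flow σ ρ η) (k i : Fin 3) : PolyBdd σ (rootT σ) (fun c t =>
    |integ (ev (rF ρ η a b e d k i * D k (yF η a b e d i)) c t)
      - integ (fun x => ev (rF ρ η a b e d k i) c 0 x * ev (D k (yF η a b e d i)) c t x)|) := by
  have hm := hF.timeWeight
  obtain ⟨C, hC, n, hn⟩ := slow_pairing hF.weight.pos hm
    (hF.l2div_Dt_rF (a := a) (b := b) (e := e) (d := d) k i)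
    (hF.l2_grad_yF (a := a) (b := b) (e := e) (d := d) k i)
  obtain ⟨C', hC', n', hn'⟩ := hm.int
  refine ⟨C * 2 + C * C', by positivity, n + (n + n'), fun c t ht => ?_⟩
  set Y : Fam ι := D k (yF η a b e d i) with hY
  set R : Fam ι := rF ρ η a b e d k i with hR
  have hD : Dt (R * freeze t Y) = Dt R * freeze t Y := by
    rw [Dt_mul, Dt_freeze, mul_zero, add_zero]
  have h := growth_aux (σ.pos c) (hm.T_le c) (fun s => hasDerivAt_integ (R * freeze t Y) c s)
    (continuous_integ (Dt (R * freeze t Y)) c) (hm.cont c) (hm.nonneg c)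
    (mul_nonneg hC (σ.pow_pos c n).le) (fun s hs ε hε => by
      rw [hD]; exact hn c s hs t ht (fun x => ev_of_Dt_eq_zero hF.rho_t c t s x) ε hε)
    (hn' c t ht) ht
  refine h.trans ?_
  rw [mul_one, mul_comm, rootT]
  refine mul_le_mul_of_nonneg_right ?_ (Real.sqrt_nonneg _)
  have := σ.add_le c (mul_nonneg hC zero_le_two) (mul_nonneg hC hC') n (n + n')
  refine le_trans (le_of_eq ?_) this
  rw [pow_add]; ring

/-- The remainder at the initial time is absorbed by the energy. -/
theorem rF_zero_le (hF : Flow σ ρ η) (a b e d : Fin 2) : ∃ C : ℝ, 0 ≤ C ∧ ∀ c, ∀ t ∈ Icc 0 (σ.T c),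
    ∀ ε : ℝ, 0 < ε → ∀ k i,
      |integ (fun x => ev (rF ρ η a b e d k i) c 0 x * ev (D k (yF η a b e d i)) c t x)|
        ≤ ε * integ (ev (ρ * D k (yF η a b e d i) * (ρ * D k (yF η a b e d i))) c t) + C / ε := by
  -- This constant depends on the density alone and carries no power of B; otherwise the resulting
  -- term could not go into M_δ.
  obtain ⟨C, hC, h⟩ := hF.dom_const a b e d
  refine ⟨C ^ 2, sq_nonneg C, fun c t ht ε hε k i => ?_⟩
  have h0t := left_mem_Icc.2 (σ.pos c).le
  have hb : ∀ x ∈ cell, |ev (rF ρ η a b e d k i) c 0 x * ev (D k (yF η a b e d i)) c t x|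
      ≤ ε * ev (ρ * D k (yF η a b e d i) * (ρ * D k (yF η a b e d i))) c t x + C ^ 2 / ε := by
    intro x hx
    have hr : |ev (rF ρ η a b e d k i) c 0 x| ≤ C * ev ρ c t x := by
      rw [hF.rF_zero k i c (cell_subset_slab hx), ev_of_Dt_eq_zero hF.rho_t c t 0 x]
      split_ifs
      · exact h c x hx
      · rw [abs_zero]; exact mul_nonneg hC (hF.weight.pos c 0 h0t x hx).le
    rw [abs_mul]
    simp only [ev_mul]
    have h1 := mul_le_mul_of_nonneg_right hr (abs_nonneg (ev (D k (yF η a b e d i)) c t x))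
    refine h1.trans ?_
    have h2 : (ev ρ c t x * ev (D k (yF η a b e d i)) c t x) ^ 2
        = (ev ρ c t x * |ev (D k (yF η a b e d i)) c t x|) ^ 2 := by
      rw [mul_pow, mul_pow, sq_abs]
    rw [← sq, h2, mul_assoc]
    generalize ev ρ c t x * |ev (D k (yF η a b e d i)) c t x| = z
    have h3 : 0 ≤ ε⁻¹ * (ε * z - C) ^ 2 := by positivity
    have h4 : ε⁻¹ * (ε * z - C) ^ 2 = ε * z ^ 2 - 2 * (C * z) + C ^ 2 / ε := by field_simp; ring
    have h5 : 0 ≤ ε * z ^ 2 + C ^ 2 / ε := by positivity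
    linarith
  have hi := (continuous_ev (ρ * D k (yF η a b e d i) * (ρ * D k (yF η a b e d i))) c
    t).integrableOn_cell
  calc _ ≤ ∫ x in cell, |ev (rF ρ η a b e d k i) c 0 x * ev (D k (yF η a b e d i)) c t x| :=
        abs_integral_le_integral_abs
    _ ≤ ∫ x in cell, (ε * ev (ρ * D k (yF η a b e d i) * (ρ * D k (yF η a b e d i))) c t x
          + C ^ 2 / ε) :=
        setIntegral_mono_on ((continuous_ev _ c 0).mul (continuous_ev _ c t)).abs.integrableOn_cell
          (((continuous_ev _ c t).const_mul ε).add continuous_const).integrableOn_cell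
          measurableSet_cell hb
    _ = _ := by
        rw [integral_add (hi.const_mul ε) (integrable_const _), integral_const_mul,
          integral_const_cell]
        rfl

/-! ### The energy estimate -/

/-- The kinetic part of the energy. -/
def kinE (ρ : Fam ι) (η : Fin 3 → Fam ι) (a b e d : Fin 2) (c : ι) (t : ℝ) : ℝ :=
  integ (ev (∑ i, ρ * (wF η a b e d i * wF η a b e d i)) c t)

/-- The elastic part of the energy. -/
def potE (ρ : Fam ι) (η : Fin 3 → Fam ι) (a b e d : Fin 2) (c : ι) (t : ℝ) : ℝ :=
  integ (ev (∑ i, ∑ k, ρ * D k (yF η a b e d i) * (ρ * D k (yF η a b e d i))) c t)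

theorem integ_psiF_zero (hF : Flow σ ρ η) (c : ι) :
    integ (ev (psiF ρ η a b e d) c 0) = 1 / 2 * kinE ρ η a b e d c 0 := by
  rw [kinE, ← integ_smul_ev]
  refine setIntegral_congr_fun measurableSet_cell fun x hx => ?_
  simp only [psiF, ev_sub, ev_smul, ev_sum, ev_mul, hF.grad_yF_zero c _ _ x (cell_subset_slab hx),
    mul_zero, Finset.sum_const_zero, sub_zero]

theorem integ_psiF_ge (hF : Flow σ ρ η) {c t} (ht : t ∈ Icc 0 (σ.T c)) :
    1 / 2 * kinE ρ η a b e d c t + 1 / 2 * (potE ρ η a b e d c t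
      + ∑ i, ∑ s, ∑ r, integ (ev (metricF η s r *
          (ρ * D s (yF η a b e d i) * (ρ * D r (yF η a b e d i)))) c t)
      - ∑ j, ∑ k, integ (ev (ρ * ρ * (kF η a b e d j k * kF η a b e d j k)) c t))
      - ∑ k, ∑ i, integ (ev (rF ρ η a b e d k i * D k (yF η a b e d i)) c t)
    ≤ integ (ev (psiF ρ η a b e d) c t) := by
  have h := integ_mono_ev fun x hx =>
    hF.coercive (a := a) (b := b) (e := e) (d := d) ht (cell_subset_closedSlab hx)
  rw [psiF, integ_sub_ev, integ_sub_ev, integ_smul_ev, integ_smul_ev, kinE, potE]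
  rw [integ_neg_ev] at h
  simp only [integ_add_ev, integ_sub_ev, integ_sum_ev] at h ⊢
  linarith

/-- Compare ∫ψ at t and at 0: initially it is half the kinetic part, and at t coercivity bounds it
from below. All errors are O(√T) except the one from r(0), which gives ε·`potE` + C₀/ε. Keeping C₀
free of B is essential. -/
theorem energy_estimate (hF : Flow σ ρ η) (a b e d : Fin 2) :
    ∃ C₀ : ℝ, 0 ≤ C₀ ∧ ∃ C : ℝ, 0 ≤ C ∧ ∃ n : ℕ, ∀ c, ∀ t ∈ Icc 0 (σ.T c), ∀ ε : ℝ, 0 < ε →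
      kinE ρ η a b e d c t + potE ρ η a b e d c t
        ≤ kinE ρ η a b e d c 0 + ε * potE ρ η a b e d c t + C₀ / ε
          + C * σ.B c ^ n * √(σ.T c) := by
  obtain ⟨C₀, hC₀, h₀⟩ := hF.rF_zero_le a b e d
  have hw := rootT_nonneg σ
  have sum3 : ∀ {X : Fin 3 → ι → ℝ → ℝ}, (∀ i, PolyBdd σ (rootT σ) (X i)) →
      PolyBdd σ (rootT σ) (fun c t => ∑ i, X i c t) := fun {X} h => by
    simp only [Fin.sum_univ_three]
    exact ((h 0).add hw (h 1)).add hw (h 2)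
  have g1 := hF.growth_psiF (a := a) (b := b) (e := e) (d := d)
  have g2 := sum3 fun i => sum3 fun s => sum3 fun r =>
    hF.small_metricF (a := a) (b := b) (e := e) (d := d) i s r
  have g3 := sum3 fun j => sum3 fun k => hF.small_kF (a := a) (b := b) (e := e) (d := d) j k
  have g4 := sum3 fun k => sum3 fun i => hF.growth_rF (a := a) (b := b) (e := e) (d := d) k i
  obtain ⟨C, hC, n, hn⟩ := ((g1.const_mul zero_le_two).add hw g2).add hw
    (g3.add hw (g4.const_mul zero_le_two))
  -- Young's inequality is used with ε/2 for each of the nine entries of r(0), giving 18 C₀/ε, and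
  -- the whole inequality is doubled.
  refine ⟨36 * C₀, by positivity, C, hC, n, fun c t ht ε hε => ?_⟩
  have h1 := hn c t ht
  have h2 := hF.integ_psiF_ge (a := a) (b := b) (e := e) (d := d) ht
  beta_reduce at h1
  rw [hF.integ_psiF_zero] at h1
  have h3 : ∀ k i, integ (ev (rF ρ η a b e d k i * D k (yF η a b e d i)) c t)
      ≤ |integ (ev (rF ρ η a b e d k i * D k (yF η a b e d i)) c t)
        - integ (fun x => ev (rF ρ η a b e d k i) c 0 x * ev (D k (yF η a b e d i)) c t x)|
        + (ε / 2 * integ (ev (ρ * D k (yF η a b e d i) * (ρ * D k (yF η a b e d i))) c t)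
          + C₀ / (ε / 2)) := fun k i => by
    have := h₀ c t ht (ε / 2) (by positivity) k i
    have := le_abs_self (integ (fun x => ev (rF ρ η a b e d k i) c 0 x
      * ev (D k (yF η a b e d i)) c t x))
    have := le_abs_self (integ (ev (rF ρ η a b e d k i * D k (yF η a b e d i)) c t)
        - integ (fun x => ev (rF ρ η a b e d k i) c 0 x * ev (D k (yF η a b e d i)) c t x))
    linarith
  have h4 := Finset.sum_le_sum fun k (_ : k ∈ Finset.univ) =>
    Finset.sum_le_sum fun i (_ : i ∈ Finset.univ) => h3 k i
  have h5 : ∑ k, ∑ i, (ε / 2 * integ (ev (ρ * D k (yF η a b e d i) * (ρ * D k (yF η a b e d i))) c t)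
          + C₀ / (ε / 2)) = ε / 2 * potE ρ η a b e d c t + 18 * (C₀ / ε) := by
    rw [potE, Finset.sum_comm]
    simp only [integ_sum_ev, Finset.sum_add_distrib, ← Finset.mul_sum, Finset.sum_const,
      Finset.card_univ, Fintype.card_fin, nsmul_eq_mul]
    field_simp
    ring
  simp only [Finset.sum_add_distrib] at h4 h5
  have h6 : ∑ i, ∑ s, ∑ r, -|integ (ev (metricF η s r *
          (ρ * D s (yF η a b e d i) * (ρ * D r (yF η a b e d i)))) c t)|
      ≤ ∑ i, ∑ s, ∑ r, integ (ev (metricF η s r *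
          (ρ * D s (yF η a b e d i) * (ρ * D r (yF η a b e d i)))) c t) :=
    Finset.sum_le_sum fun i _ => Finset.sum_le_sum fun s _ => Finset.sum_le_sum fun r _ =>
      neg_abs_le _
  have h7 : ∑ j, ∑ k, integ (ev (ρ * ρ * (kF η a b e d j k * kF η a b e d j k)) c t)
      ≤ ∑ j, ∑ k, |integ (ev (ρ * ρ * (kF η a b e d j k * kF η a b e d j k)) c t)| :=
    Finset.sum_le_sum fun i _ => Finset.sum_le_sum fun s _ => le_abs_self _
  simp only [Finset.sum_neg_distrib] at h6
  have h8 := le_abs_self (integ (ev (psiF ρ η a b e d) c t) - 1 / 2 * kinE ρ η a b e d c 0)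
  rw [rootT] at h1
  have h9 : 36 * C₀ / ε = 36 * (C₀ / ε) := by ring
  rw [h9]
  linarith

end Flow

end

end VacuumEuler

/-! ### The norms as integrals of families, and the density near the vacuum boundary. -/

namespace VacuumEuler

open MeasureTheory Fam

noncomputable section

/-! ### Locality of the norms -/

section Locality

variable {f g : Point → ℝ}

theorem eqOn_pd (h : EqOn f g slab) (k : Fin 3) : EqOn (pd k f) (pd k g) slab := fun x hx => by
  rw [pd, pd]
  congr 1
  refine Filter.EventuallyEq.fderiv_eq ?_
  filter_upwards [isOpen_slab.mem_nhds hx] with y hy using h hy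

theorem eqOn_pd_iterate (h : EqOn f g slab) (k : Fin 3) (n : ℕ) :
    EqOn ((pd k)^[n] f) ((pd k)^[n] g) slab := by
  induction n with
  | zero => exact h
  | succ n ih =>
    rw [Function.iterate_succ_apply', Function.iterate_succ_apply']
    exact eqOn_pd ih k

theorem sobSq_congr (h : EqOn f g slab) (k : ℕ) : sobSq k f = sobSq k g :=
  Finset.sum_congr rfl fun _ _ => Finset.sum_congr rfl fun _ _ =>
    setIntegral_congr_fun measurableSet_cell fun _ hx => congrArg (· ^ 2)
      (eqOn_pd_iterate (eqOn_pd_iterate (eqOn_pd_iterate h 2 _) 1 _) 0 _ (cell_subset_slab hx))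

theorem eqOn_hderivSq (h : EqOn f g slab) (m : ℕ) : EqOn (hderivSq m f) (hderivSq m g) slab := by
  induction m generalizing f g with
  | zero => exact fun x hx => congrArg (· ^ 2) (h hx)
  | succ m ih => exact fun x hx => Finset.sum_congr rfl fun α _ => ih (eqOn_pd h _) hx

end Locality

/-! ### Families of densities of the norms -/

section Densities

variable {ι : Type*}

/-- The density of the square of a Sobolev norm. -/
def sobF (k : ℕ) (f : Fam ι) : Fam ι :=
  ∑ n ∈ Finset.range (k + 1), ∑ a ∈ Finset.piAntidiag (Finset.univ : Finset (Fin 3)) n,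
    ((D 0)^[a 0] ((D 1)^[a 1] ((D 2)^[a 2] f))) ^ 2

theorem sobSq_ev (k : ℕ) (f : Fam ι) (c t) : sobSq k (ev f c t) = integ (ev (sobF k f) c t) := by
  simp only [sobF, integ_sum_ev, sobSq, l2Sq, pdMulti_ev]
  rfl

theorem ev_sobF_nonneg (k : ℕ) (f : Fam ι) (c t x) : 0 ≤ ev (sobF k f) c t x := by
  simp only [sobF, ev_sum, ev_pow]
  exact Finset.sum_nonneg fun n _ => Finset.sum_nonneg fun a _ => sq_nonneg _

theorem sq_le_sobF {k : ℕ} (L : List (Fin 3)) (hL : L.length ≤ k) (f : Fam ι) (c t x) :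
    ev (L.foldr (fun k g => D k g) f) c t x ^ 2 ≤ ev (sobF k f) c t x := by
  obtain ⟨a, ha, h⟩ := exists_multiIndex (ι := ι) L
  simp only [h f, sobF, ev_sum, ev_pow]
  refine le_trans ?_ (Finset.single_le_sum (f := fun n => ∑ a ∈ Finset.piAntidiag (Finset.univ : Finset (Fin 3)) n,
    ev ((D 0)^[a 0] ((D 1)^[a 1] ((D 2)^[a 2] f))) c t x ^ 2)
    (fun n _ => Finset.sum_nonneg fun a _ => sq_nonneg _)
    (Finset.mem_range.2 (Nat.lt_succ_of_le hL)))
  exact Finset.single_le_sum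
    (f := fun a : Fin 3 → ℕ => ev ((D 0)^[a 0] ((D 1)^[a 1] ((D 2)^[a 2] f))) c t x ^ 2)
    (fun a _ => sq_nonneg _) ha

/-- The square of the length of the tensor of the horizontal derivatives of order `m`. -/
def hsqF : ℕ → Fam ι → Fam ι
  | 0, f => f ^ 2
  | m + 1, f => ∑ α : Fin 2, hsqF m (D α.castSucc f)

theorem hderivSq_ev (m : ℕ) (f : Fam ι) (c t) : hderivSq m (ev f c t) = ev (hsqF m f) c t := by
  induction m generalizing f with
  | zero => rfl
  | succ m ih =>
    funext x
    simp only [hderivSq, hsqF, ev_sum, pd_ev, ih]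

theorem ev_hsqF_nonneg (m : ℕ) (f : Fam ι) (c t x) : 0 ≤ ev (hsqF m f) c t x := by
  induction m generalizing f with
  | zero => exact sq_nonneg _
  | succ m ih => rw [hsqF, ev_sum]; exact Finset.sum_nonneg fun α _ => ih _

theorem hsqF_le_succ (m : ℕ) (f : Fam ι) (α : Fin 2) (c t x) :
    ev (hsqF m (D α.castSucc f)) c t x ≤ ev (hsqF (m + 1) f) c t x := by
  rw [hsqF, ev_sum]
  exact Finset.single_le_sum (f := fun α : Fin 2 => ev (hsqF m (D α.castSucc f)) c t x)
    (fun α _ => ev_hsqF_nonneg _ _ _ _ _) (Finset.mem_univ α)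

theorem hsqF_four (f : Fam ι) :
    hsqF 4 f = ∑ d, ∑ e, ∑ b, ∑ a, (hd a b e d f) ^ 2 := rfl

theorem sq_hd_le_hsqF (f : Fam ι) (a b e d : Fin 2) (c t x) :
    ev (hd a b e d f) c t x ^ 2 ≤ ev (hsqF 4 f) c t x :=
  (((hsqF_le_succ 0 _ a c t x).trans (hsqF_le_succ 1 _ b c t x)).trans
    (hsqF_le_succ 2 _ e c t x)).trans (hsqF_le_succ 3 _ d c t x)

theorem sq_le_hsqF_three (f : Fam ι) (a b e : Fin 2) (c t x) :
    ev (D a.castSucc (D b.castSucc (D e.castSucc f))) c t x ^ 2 ≤ ev (hsqF 3 f) c t x :=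
  ((hsqF_le_succ 0 _ a c t x).trans (hsqF_le_succ 1 _ b c t x)).trans (hsqF_le_succ 2 _ e c t x)

/-- A family that does not depend on time. -/
def spaceF (f : Point → ℝ) (hf : ContDiff ℝ ∞ f) : Fam ι :=
  ⟨fun _ p => f p.2, fun _ => hf.comp contDiff_snd⟩

theorem ev_spaceF (f : Point → ℝ) (hf : ContDiff ℝ ∞ f) (c : ι) (t x) :
    ev (spaceF f hf) c t x = f x := rfl

theorem D_spaceF (f : Point → ℝ) (hf : ContDiff ℝ ∞ f) (k : Fin 3) :
    D k (spaceF f hf : Fam ι) = spaceF (pd k f) (contDiff_pd hf k) :=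
  ext_ev fun c t x => by rw [← pd_ev]; rfl

theorem Dt_spaceF (f : Point → ℝ) (hf : ContDiff ℝ ∞ f) : Dt (spaceF f hf : Fam ι) = 0 :=
  ext_ev fun c t x => (hasDerivAt_ev (spaceF f hf) c t x).unique (hasDerivAt_const t (f x))

end Densities

/-! ### The density -/

/-- A smooth function that vanishes on the vacuum boundary is bounded by the distance to it. -/
theorem exists_abs_le_one_sub {f : Point → ℝ} (hf : ContDiff ℝ ∞ f)
    (h : ∀ x : Point, x 2 = 1 → f x = 0) : ∃ C : ℝ, 0 ≤ C ∧ ∀ x ∈ cell, |f x| ≤ C * (1 - x 2) := by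
  obtain ⟨C, hC⟩ := (isCompact_Icc (a := (0 : Point)) (b := 1)).exists_bound_of_continuousOn
    (continuous_pd hf 2).continuousOn
  have hC0 : 0 ≤ C := (norm_nonneg _).trans (hC 0 ⟨le_rfl, fun _ => zero_le_one⟩)
  refine ⟨C, hC0, fun x hx => ?_⟩
  have hx2 := mem_cell.1 hx 2
  have := norm_image_sub_le_of_norm_deriv_le_segment' (f := fun r => f (Function.update x 2 r))
    (a := x 2) (b := 1) (C := C)
    (fun r _ => (hasDerivAt_update_comp hf x 2 r).hasDerivWithinAt)
    (fun r hr => hC _ (by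
      have hI := cell_subset_Icc hx
      constructor
      · intro i
        rcases eq_or_ne i 2 with rfl | hi
        · rw [Function.update_self]; exact hx2.1.le.trans hr.1
        · rw [Function.update_of_ne hi]; exact hI.1 i
      · intro i
        rcases eq_or_ne i 2 with rfl | hi
        · rw [Function.update_self]; exact hr.2.le
        · rw [Function.update_of_ne hi]; exact hI.2 i)) 1 (right_mem_Icc.2 hx2.2.le)
  rwa [h _ (Function.update_self _ _ _), Function.update_eq_self, zero_sub, norm_neg] at this

theorem pd_eq_zero_of_top {f : Point → ℝ} (hf : ContDiff ℝ ∞ f) (h : ∀ x : Point, x 2 = 1 → f x = 0)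
    (a : Fin 2) : ∀ x : Point, x 2 = 1 → pd a.castSucc f x = 0 := fun x hx => by
  have hd := hasDerivAt_update_comp hf x a.castSucc (x a.castSucc)
  have e : (fun r => f (Function.update x a.castSucc r)) = fun _ => 0 := by
    funext r
    refine h _ ?_
    rw [Function.update_of_ne, hx]
    fin_cases a <;> decide
  rw [e, Function.update_eq_self] at hd
  exact hd.unique (hasDerivAt_const _ _)

theorem IsVacuumDensity.pos {ρ₀ : Point → ℝ} (hρ₀ : IsVacuumDensity ρ₀) {x : Point}
    (hx : x ∈ cell) : 0 < ρ₀ x := by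
  obtain ⟨k, hk, h⟩ := hρ₀.physical
  have := (mem_cell.1 hx 2).2
  exact (mul_pos hk (by linarith)).trans_le (h x (cell_subset_closedSlab hx))

/-- Vanishing on Γ gives O(1 - x₃) by the mean value inequality, and the physical vacuum condition
bounds 1 - x₃ by a multiple of ρ₀. -/
theorem IsVacuumDensity.exists_abs_le {ρ₀ : Point → ℝ} (hρ₀ : IsVacuumDensity ρ₀)
    {f : Point → ℝ} (hf : ContDiff ℝ ∞ f) (h : ∀ x : Point, x 2 = 1 → f x = 0) :
    ∃ C : ℝ, 0 ≤ C ∧ ∀ x ∈ cell, |f x| ≤ C * ρ₀ x := by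
  obtain ⟨k, hk, hk'⟩ := hρ₀.physical
  obtain ⟨C, hC, hC'⟩ := exists_abs_le_one_sub hf h
  refine ⟨C / k, by positivity, fun x hx => (hC' x hx).trans ?_⟩
  rw [div_mul_eq_mul_div, le_div_iff₀ hk]
  have := mul_le_mul_of_nonneg_left (hk' x (cell_subset_closedSlab hx)) hC
  linarith

end

end VacuumEuler

/-! ### Solutions as families, and the energies in terms of families. -/

namespace VacuumEuler

open MeasureTheory Fam

noncomputable section

/-! ### Families of solutions -/

/-- A solution that satisfies the assumptions, with the bound for its initial velocity. -/
structure Config (ρ₀ : Point → ℝ) where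
  K : ℝ
  T : ℝ
  u₀ : Point → Vec
  η : ℝ → Point → Vec
  pos : 0 < T
  sol : IsSmoothSolution ρ₀ u₀ T η
  small : SmallTime T η
  init : ∀ m : ℕ, m ≤ 6 → velNormSq η m 0 ≤ K

variable {ρ₀ : Point → ℝ} {ι : Type*}

/-- The scales of a family of solutions. -/
def scale (cfg : ι → Config ρ₀) : Scale ι where
  T := fun c => (cfg c).T
  B := fun c => (1 + |(cfg c).K|) * (1 + |supOn (cfg c).T (energy ρ₀ (cfg c).η)|)
  pos := fun c => (cfg c).pos
  one_le := fun c => one_le_mul_of_one_le_of_one_le (by linarith [abs_nonneg (cfg c).K])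
    (by linarith [abs_nonneg (supOn (cfg c).T (energy ρ₀ (cfg c).η))])

/-- The flow maps of a family of solutions. -/
def flowF (cfg : ι → Config ρ₀) (i : Fin 3) : Fam ι :=
  ⟨fun c p => (cfg c).η p.1 p.2 i, fun c => contDiff_pi.1 (cfg c).sol.smooth i⟩

/-- The density as a family. -/
def densF (hρ₀ : IsVacuumDensity ρ₀) : Fam ι := spaceF ρ₀ hρ₀.smooth

variable (hρ₀ : IsVacuumDensity ρ₀) (cfg : ι → Config ρ₀)

theorem ev_flowF (i : Fin 3) (c : ι) :
    ev (flowF cfg i) c = fun t x => (cfg c).η t x i := rfl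

theorem vel_eq (i : Fin 3) (c : ι) : vel (cfg c).η i = ev (velF (flowF cfg) i) c :=
  funext fun t => funext fun x => (hasDerivAt_ev (flowF cfg i) c t x).deriv

theorem defGrad_eq (c : ι) (t x) : defGrad (cfg c).η t x = evM (grad (flowF cfg)) c t x := by
  ext i k
  exact congrFun (pd_ev k (flowF cfg i) c t) x

theorem jac_eq (c : ι) (t x) : jac (cfg c).η t x = ev (detG (flowF cfg)) c t x := by
  rw [jac, defGrad_eq, ev_detG]

theorem nonDeg_flowF : NonDeg (scale cfg) (flowF cfg) := fun c t ht x hx => by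
  rw [← jac_eq]; exact ((cfg c).small.jac_bounds t ht x hx).1

theorem invGrad_eq {c : ι} {t x} (ht : t ∈ Icc 0 (cfg c).T) (hx : x ∈ closedSlab) :
    invGrad (cfg c).η t x = evM (invG (flowF cfg)) c t x := by
  rw [invGrad, defGrad_eq, (nonDeg_flowF cfg).evM_invG_eq ht hx]

theorem cof_eq (c : ι) (t x) : cof (cfg c).η t x = evM (cofG (flowF cfg)) c t x := by
  rw [cof, defGrad_eq, evM_cofG]

/-- The square of the inverse Jacobian. -/
def invSqF : Fam ι := invJ (flowF cfg) * invJ (flowF cfg)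

theorem jacInvSq_eq_of_le {c : ι} {t x} (h : 1 / 4 ≤ ev (detG (flowF cfg)) c t x) :
    jacInvSq (cfg c).η t x = ev (invSqF cfg) c t x := by
  rw [jacInvSq, jac_eq, invSqF, ev_mul, invJ, ev_comp, smoothInv_eq h, sq, mul_inv]

theorem jacInvSq_eq {c : ι} {t x} (ht : t ∈ Icc 0 (cfg c).T) (hx : x ∈ closedSlab) :
    jacInvSq (cfg c).η t x = ev (invSqF cfg) c t x :=
  jacInvSq_eq_of_le cfg (by linarith [nonDeg_flowF cfg c t ht x hx])

/-- Iterated time derivatives at an end point of [0,T] use values outside the interval. There J ≥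
1/2 may fail, but J > 1/4 persists near t by continuity, and the smooth inverse is exact for such
values. -/
theorem dt_jacInvSq_eq (n : ℕ) {c : ι} {t x} (ht : t ∈ Icc 0 (cfg c).T) (hx : x ∈ closedSlab) :
    dt n (jacInvSq (cfg c).η) t x = ev (Dt^[n] (invSqF cfg)) c t x := by
  rw [← dt_ev, dt, dt]
  refine Filter.EventuallyEq.iteratedDeriv_eq n ?_
  have h : (1 : ℝ) / 4 < ev (detG (flowF cfg)) c t x := by
    linarith [nonDeg_flowF cfg c t ht x hx]
  filter_upwards [(contDiff_ev_time (detG (flowF cfg)) c x).continuous.continuousAt.eventually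
    (lt_mem_nhds h)] with s hs using jacInvSq_eq_of_le cfg hs.le

/-- The components of the Lagrangian curl. -/
def curlF (i : Fin 3) : Fam ι :=
  ![curlG (invG (flowF cfg)) (velF (flowF cfg)) 1 2,
    curlG (invG (flowF cfg)) (velF (flowF cfg)) 2 0,
    curlG (invG (flowF cfg)) (velF (flowF cfg)) 0 1] i

theorem lagGrad_sub_eq {c : ι} {t x} (ht : t ∈ Icc 0 (cfg c).T) (hx : x ∈ closedSlab)
    (j k : Fin 3) : lagGrad (cfg c).η t x j k - lagGrad (cfg c).η t x k j
      = ev (curlG (invG (flowF cfg)) (velF (flowF cfg)) j k) c t x := by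
  simp only [lagGrad, invGrad_eq cfg ht hx, vel_eq cfg, pd_ev, evM_apply, curlG, ev_sum, ev_sub,
    ev_mul, Finset.sum_sub_distrib]

theorem curlEta_eq {c : ι} {t x} (ht : t ∈ Icc 0 (cfg c).T) (hx : x ∈ closedSlab) (i : Fin 3) :
    curlEta (cfg c).η i t x = ev (curlF cfg i) c t x := by
  fin_cases i
  · exact lagGrad_sub_eq cfg ht hx 1 2
  · exact lagGrad_sub_eq cfg ht hx 2 0
  · exact lagGrad_sub_eq cfg ht hx 0 1

/-! ### The energies as integrals of families -/

/-- The density of the horizontal energy. -/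
def horizF : Fam ι :=
  densF hρ₀ * ∑ i, hsqF 4 (velF (flowF cfg) i)
    + densF hρ₀ ^ 2 * ∑ i, ∑ k, hsqF 4 (D k (flowF cfg i))

theorem horizontalEnergy_eq (c : ι) (t : ℝ) :
    horizontalEnergy ρ₀ (cfg c).η t = integ (ev (horizF hρ₀ cfg) c t) := by
  rw [horizontalEnergy, horizF, integ_add_ev]
  congr 2
  · funext x
    simp only [vel_eq cfg, hderivSq_ev, ev_mul, ev_sum]
    rfl
  · funext x
    simp only [← congrFun (ev_flowF cfg _ c) t, pd_ev, hderivSq_ev, ev_mul, ev_sum, ev_pow]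
    rfl

/-- The Sobolev norms of the flow map. -/
def energyF₁ : Fam ι := ∑ m ∈ Finset.range 5, ∑ i, sobF (4 - m) (Dt^[2 * m] (flowF cfg i))

/-- The weighted norms of the flow map. -/
def energyF₂ : Fam ι := ∑ m ∈ Finset.range 5,
  (densF hρ₀ ^ 2 * (∑ i, ∑ k, hsqF (4 - m) (D k (Dt^[2 * m] (flowF cfg i))))
    + densF hρ₀ * ∑ i, hsqF (4 - m) (Dt^[2 * m] (velF (flowF cfg) i)))

/-- The weighted norms of the inverse Jacobian. -/
def energyF₃ : Fam ι :=
  ∑ m ∈ Finset.range 4, sobF (4 - m) (densF hρ₀ * Dt^[2 * m] (invSqF cfg))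

/-- The Sobolev norms of the curl. -/
def energyF₄ : Fam ι := ∑ i, sobF 3 (curlF cfg i)

/-- The weighted norms of the curl. -/
def energyF₅ : Fam ι := densF hρ₀ ^ 2 * ∑ i, hsqF 4 (curlF cfg i)

/-- The density of the energy. -/
def energyF : Fam ι :=
  energyF₁ cfg + energyF₂ hρ₀ cfg + energyF₃ hρ₀ cfg + energyF₄ cfg + energyF₅ hρ₀ cfg

theorem energy_eq {c : ι} {t} (ht : t ∈ Icc 0 (cfg c).T) :
    energy ρ₀ (cfg c).η t = integ (ev (energyF hρ₀ cfg) c t) := by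
  simp only [energyF, integ_add_ev]
  rw [energy]
  congr 1
  congr 1
  congr 1
  congr 1
  · simp only [energyF₁, integ_sum_ev, ← sobSq_ev, ← dt_ev, ev_flowF]
  · simp only [energyF₂, integ_sum_ev, integ_add_ev]
    refine Finset.sum_congr rfl fun m _ => ?_
    congr 2
    · funext x
      simp only [← ev_flowF cfg, dt_ev, pd_ev, hderivSq_ev, ev_mul, ev_sum, ev_pow]
      rfl
    · funext x
      simp only [vel_eq cfg, dt_ev, hderivSq_ev, ev_mul, ev_sum]
      rfl
  · simp only [energyF₃, integ_sum_ev, ← sobSq_ev]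
    refine Finset.sum_congr rfl fun m _ => sobSq_congr (fun x hx => ?_) _
    rw [dt_jacInvSq_eq cfg _ ht (slab_subset_closedSlab hx), ev_mul]
    rfl
  · simp only [energyF₄, integ_sum_ev, ← sobSq_ev]
    exact Finset.sum_congr rfl fun i _ => sobSq_congr
      (fun x hx => curlEta_eq cfg ht (slab_subset_closedSlab hx) i) _
  · refine setIntegral_congr_fun measurableSet_cell fun x hx => ?_
    rw [energyF₅, ev_mul, ev_pow, ev_sum]
    refine congrArg _ (Finset.sum_congr rfl fun i _ => ?_)
    rw [← hderivSq_ev]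
    exact eqOn_hderivSq (fun x hx => curlEta_eq cfg ht (slab_subset_closedSlab hx) i) 4
      (cell_subset_slab hx)

section Pointwise

variable (c : ι) (t : ℝ) {x : Point}

theorem ev_densF (x : Point) : ev (densF hρ₀ : Fam ι) c t x = ρ₀ x := rfl

theorem energyF₁_nonneg : 0 ≤ ev (energyF₁ cfg) c t x := by
  simp only [energyF₁, ev_sum]
  exact Finset.sum_nonneg fun m _ => Finset.sum_nonneg fun i _ => ev_sobF_nonneg _ _ _ _ _

theorem sum_hsqF_nonneg (m : ℕ) (f : Fin 3 → Fin 3 → Fam ι) :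
    0 ≤ ev (densF hρ₀ ^ 2 * ∑ i, ∑ k, hsqF m (f i k)) c t x := by
  simp only [ev_mul, ev_pow, ev_sum]
  exact mul_nonneg (sq_nonneg _) (Finset.sum_nonneg fun i _ => Finset.sum_nonneg fun k _ =>
    ev_hsqF_nonneg _ _ _ _ _)

theorem sum_hsqF_nonneg' (hx : x ∈ cell) (m : ℕ) (f : Fin 3 → Fam ι) :
    0 ≤ ev (densF hρ₀ * ∑ i, hsqF m (f i)) c t x := by
  simp only [ev_mul, ev_sum, ev_densF]
  exact mul_nonneg (hρ₀.pos hx).le (Finset.sum_nonneg fun i _ => ev_hsqF_nonneg _ _ _ _ _)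

theorem energyF₂_nonneg (hx : x ∈ cell) : 0 ≤ ev (energyF₂ hρ₀ cfg) c t x := by
  rw [energyF₂, ev_sum]
  exact Finset.sum_nonneg fun m _ => add_nonneg (sum_hsqF_nonneg hρ₀ c t _ _)
    (sum_hsqF_nonneg' hρ₀ c t hx _ _)

theorem energyF₃_nonneg : 0 ≤ ev (energyF₃ hρ₀ cfg) c t x := by
  simp only [energyF₃, ev_sum]
  exact Finset.sum_nonneg fun m _ => ev_sobF_nonneg _ _ _ _ _

theorem energyF₄_nonneg : 0 ≤ ev (energyF₄ cfg) c t x := by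
  simp only [energyF₄, ev_sum]
  exact Finset.sum_nonneg fun m _ => ev_sobF_nonneg _ _ _ _ _

theorem energyF₅_nonneg : 0 ≤ ev (energyF₅ hρ₀ cfg) c t x := by
  simp only [energyF₅, ev_mul, ev_pow, ev_sum]
  exact mul_nonneg (sq_nonneg _) (Finset.sum_nonneg fun i _ => ev_hsqF_nonneg _ _ _ _ _)

theorem energyF_ge (hx : x ∈ cell) : ev (energyF₁ cfg) c t x ≤ ev (energyF hρ₀ cfg) c t x
    ∧ ev (energyF₂ hρ₀ cfg) c t x ≤ ev (energyF hρ₀ cfg) c t x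
    ∧ ev (energyF₅ hρ₀ cfg) c t x ≤ ev (energyF hρ₀ cfg) c t x := by
  have h1 := energyF₁_nonneg cfg c t (x := x)
  have h2 := energyF₂_nonneg hρ₀ cfg c t hx
  have h3 := energyF₃_nonneg hρ₀ cfg c t (x := x)
  have h4 := energyF₄_nonneg cfg c t (x := x)
  have h5 := energyF₅_nonneg hρ₀ cfg c t (x := x)
  simp only [energyF, ev_add]
  refine ⟨?_, ?_, ?_⟩ <;> linarith

theorem sobF_le_energyF (hx : x ∈ cell) {m : ℕ} (hm : m < 5) (i : Fin 3) :
    ev (sobF (4 - m) (Dt^[2 * m] (flowF cfg i))) c t x ≤ ev (energyF hρ₀ cfg) c t x := by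
  refine le_trans ?_ (energyF_ge hρ₀ cfg c t hx).1
  simp only [energyF₁, ev_sum]
  refine le_trans ?_ (Finset.single_le_sum
    (f := fun m => ∑ i, ev (sobF (4 - m) (Dt^[2 * m] (flowF cfg i))) c t x)
    (fun m _ => Finset.sum_nonneg fun i _ => ev_sobF_nonneg _ _ _ _ _) (Finset.mem_range.2 hm))
  exact Finset.single_le_sum (f := fun i => ev (sobF (4 - m) (Dt^[2 * m] (flowF cfg i))) c t x)
    (fun i _ => ev_sobF_nonneg _ _ _ _ _) (Finset.mem_univ i)

theorem energyF₂_term_le (hx : x ∈ cell) {m : ℕ} (hm : m < 5) :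
    ev (densF hρ₀ ^ 2 * (∑ i, ∑ k, hsqF (4 - m) (D k (Dt^[2 * m] (flowF cfg i))))
      + densF hρ₀ * ∑ i, hsqF (4 - m) (Dt^[2 * m] (velF (flowF cfg) i))) c t x
      ≤ ev (energyF hρ₀ cfg) c t x := by
  refine le_trans ?_ (energyF_ge hρ₀ cfg c t hx).2.1
  rw [energyF₂, ev_sum]
  exact Finset.single_le_sum (f := fun m =>
    ev (densF hρ₀ ^ 2 * (∑ i, ∑ k, hsqF (4 - m) (D k (Dt^[2 * m] (flowF cfg i))))
      + densF hρ₀ * ∑ i, hsqF (4 - m) (Dt^[2 * m] (velF (flowF cfg) i))) c t x)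
    (fun m _ => by
      rw [ev_add]
      exact add_nonneg (sum_hsqF_nonneg hρ₀ c t _ _) (sum_hsqF_nonneg' hρ₀ c t hx _ _))
    (Finset.mem_range.2 hm)

theorem horizF_le_energyF (hx : x ∈ cell) :
    ev (horizF hρ₀ cfg) c t x ≤ ev (energyF hρ₀ cfg) c t x := by
  refine le_trans (le_of_eq ?_) (energyF₂_term_le hρ₀ cfg c t hx (m := 0) (by norm_num))
  rw [horizF, add_comm]
  rfl

theorem hsqF_grad_le_energyF (hx : x ∈ cell) {m : ℕ} (hm : m < 5) (i k : Fin 3) :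
    ρ₀ x ^ 2 * ev (hsqF (4 - m) (D k (Dt^[2 * m] (flowF cfg i)))) c t x
      ≤ ev (energyF hρ₀ cfg) c t x := by
  refine le_trans ?_ (energyF₂_term_le hρ₀ cfg c t hx hm)
  rw [ev_add]
  refine le_add_of_le_of_nonneg ?_ (sum_hsqF_nonneg' hρ₀ c t hx _ _)
  simp only [ev_mul, ev_pow, ev_sum, ev_densF]
  refine mul_le_mul_of_nonneg_left ?_ (sq_nonneg _)
  refine le_trans ?_ (Finset.single_le_sum
    (f := fun i => ∑ k, ev (hsqF (4 - m) (D k (Dt^[2 * m] (flowF cfg i)))) c t x)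
    (fun i _ => Finset.sum_nonneg fun k _ => ev_hsqF_nonneg _ _ _ _ _) (Finset.mem_univ i))
  exact Finset.single_le_sum
    (f := fun k => ev (hsqF (4 - m) (D k (Dt^[2 * m] (flowF cfg i)))) c t x)
    (fun k _ => ev_hsqF_nonneg _ _ _ _ _) (Finset.mem_univ k)

theorem hsqF_vel_le_energyF (hx : x ∈ cell) (i : Fin 3) :
    ρ₀ x * ev (hsqF 4 (velF (flowF cfg) i)) c t x ≤ ev (energyF hρ₀ cfg) c t x := by
  refine le_trans ?_ (energyF₂_term_le hρ₀ cfg c t hx (m := 0) (by norm_num))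
  rw [ev_add]
  refine le_add_of_nonneg_of_le (sum_hsqF_nonneg hρ₀ c t _ _) ?_
  simp only [ev_mul, ev_sum, ev_densF]
  exact mul_le_mul_of_nonneg_left (Finset.single_le_sum
    (f := fun i => ev (hsqF 4 (velF (flowF cfg) i)) c t x)
    (fun i _ => ev_hsqF_nonneg _ _ _ _ _) (Finset.mem_univ i)) (hρ₀.pos hx).le

theorem hsqF_curl_le_energyF (hx : x ∈ cell) (i : Fin 3) :
    ρ₀ x ^ 2 * ev (hsqF 4 (curlF cfg i)) c t x ≤ ev (energyF hρ₀ cfg) c t x := by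
  refine le_trans ?_ (energyF_ge hρ₀ cfg c t hx).2.2
  simp only [energyF₅, ev_mul, ev_pow, ev_sum, ev_densF]
  exact mul_le_mul_of_nonneg_left (Finset.single_le_sum
    (f := fun i => ev (hsqF 4 (curlF cfg i)) c t x)
    (fun i _ => ev_hsqF_nonneg _ _ _ _ _) (Finset.mem_univ i)) (sq_nonneg _)

end Pointwise

/-! ### The suprema -/

theorem bddAbove_energy (hρ₀ : IsVacuumDensity ρ₀) (cfg : ι → Config ρ₀) (c : ι) : BddAbove (energy ρ₀ (cfg c).η '' Icc 0 (cfg c).T) := by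
  have : EqOn (energy ρ₀ (cfg c).η) (fun t => integ (ev (energyF hρ₀ cfg) c t))
      (Icc 0 (cfg c).T) := fun t ht => energy_eq hρ₀ cfg ht
  rw [this.image_eq]
  exact (isCompact_Icc.image (continuous_integ _ c)).bddAbove

theorem energy_le_sup (hρ₀ : IsVacuumDensity ρ₀) (cfg : ι → Config ρ₀) {c : ι} {t} (ht : t ∈ Icc 0 (cfg c).T) :
    energy ρ₀ (cfg c).η t ≤ supOn (cfg c).T (energy ρ₀ (cfg c).η) :=
  le_csSup (bddAbove_energy hρ₀ cfg c) (mem_image_of_mem _ ht)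

theorem horizontalEnergy_le_energy (hρ₀ : IsVacuumDensity ρ₀) (cfg : ι → Config ρ₀) {c : ι} {t} (ht : t ∈ Icc 0 (cfg c).T) :
    horizontalEnergy ρ₀ (cfg c).η t ≤ energy ρ₀ (cfg c).η t := by
  rw [horizontalEnergy_eq hρ₀ cfg, energy_eq hρ₀ cfg ht]
  exact integ_mono_ev fun x hx => horizF_le_energyF hρ₀ cfg c t hx

theorem energy_nonneg (hρ₀ : IsVacuumDensity ρ₀) (cfg : ι → Config ρ₀) {c : ι} {t} (ht : t ∈ Icc 0 (cfg c).T) : 0 ≤ energy ρ₀ (cfg c).η t := by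
  rw [energy_eq hρ₀ cfg ht]
  exact integ_nonneg_ev fun x hx =>
    (energyF₁_nonneg cfg c t).trans (energyF_ge hρ₀ cfg c t hx).1

theorem sup_energy_nonneg (hρ₀ : IsVacuumDensity ρ₀) (cfg : ι → Config ρ₀) (c : ι) : 0 ≤ supOn (cfg c).T (energy ρ₀ (cfg c).η) :=
  (energy_nonneg hρ₀ cfg (left_mem_Icc.2 (cfg c).pos.le)).trans
    (energy_le_sup hρ₀ cfg (left_mem_Icc.2 (cfg c).pos.le))

theorem integ_energyF_le : PolyBdd (scale cfg) (fun _ _ => 1)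
    (fun c t => integ (ev (energyF hρ₀ cfg) c t)) := by
  refine ⟨1, zero_le_one, 1, fun c t ht => ?_⟩
  beta_reduce
  rw [← energy_eq hρ₀ cfg ht, one_mul, pow_one, mul_one]
  refine (energy_le_sup hρ₀ cfg ht).trans ?_
  have h1 := le_abs_self (supOn (cfg c).T (energy ρ₀ (cfg c).η))
  have h2 := abs_nonneg (supOn (cfg c).T (energy ρ₀ (cfg c).η))
  show _ ≤ (1 + |(cfg c).K|) * (1 + |supOn (cfg c).T (energy ρ₀ (cfg c).η)|)
  nlinarith [abs_nonneg (cfg c).K]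

end

end VacuumEuler

/-! ### Solutions satisfy the properties of a flow. -/

namespace VacuumEuler

open MeasureTheory Fam

noncomputable section

variable {ρ₀ : Point → ℝ} {ι : Type*} (hρ₀ : IsVacuumDensity ρ₀) (cfg : ι → Config ρ₀)

/-! ### Solutions form a flow -/

theorem l2_of_le {g G : Fam ι} {σ : Scale ι}
    (hG : PolyBdd σ (fun _ _ => 1) (fun c t => integ (ev G c t)))
    (h : ∀ c, ∀ t ∈ Icc 0 (σ.T c), ∀ x ∈ cell, ev g c t x ^ 2 ≤ ev G c t x) :
    L2 σ (fun _ _ => 1) g :=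
  ⟨fun c t _ => ((continuous_ev g c t).pow 2).integrableOn_cell, hG.mono fun c t ht =>
    setIntegral_mono_on ((continuous_ev g c t).pow 2).integrableOn_cell
      (continuous_ev G c t).integrableOn_cell measurableSet_cell (h c t ht)⟩

theorem l2_flow (hρ₀ : IsVacuumDensity ρ₀) (cfg : ι → Config ρ₀) (i : Fin 3) (L : List (Fin 3)) (hL : L.length ≤ 4) :
    L2 (scale cfg) (fun _ _ => 1) (L.foldr (fun k g => D k g) (flowF cfg i)) :=
  l2_of_le (integ_energyF_le hρ₀ cfg) fun c t _ x hx => (sq_le_sobF L hL _ c t x).trans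
    (sobF_le_energyF hρ₀ cfg c t hx (m := 0) (by norm_num) i)

theorem l2_acc (hρ₀ : IsVacuumDensity ρ₀) (cfg : ι → Config ρ₀) (i : Fin 3) (L : List (Fin 3)) (hL : L.length ≤ 3) :
    L2 (scale cfg) (fun _ _ => 1) (L.foldr (fun k g => D k g) (Dt (velF (flowF cfg) i))) :=
  l2_of_le (integ_energyF_le hρ₀ cfg) fun c t _ x hx => (sq_le_sobF L hL _ c t x).trans
    (sobF_le_energyF hρ₀ cfg c t hx (m := 1) (by norm_num) i)

/-- The H³ norm of v is taken from the standing assumption: it is at most 2K + 1 ≤ 3(1 + |K|) ≤ 3B.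
This is why the scale contains K. -/
theorem integ_vel_le : PolyBdd (scale cfg) (fun _ _ => 1)
    (fun c t => integ (ev (∑ i, sobF 3 (velF (flowF cfg) i)) c t)) := by
  refine ⟨3, by norm_num, 1, fun c t ht => ?_⟩
  have h1 := (cfg c).small.vel_bound 0 (by norm_num) t ht
  have h2 := (cfg c).init 0 (by norm_num)
  have h3 : velNormSq (cfg c).η 0 t = integ (ev (∑ i, sobF 3 (velF (flowF cfg) i)) c t) := by
    rw [integ_sum_ev, velNormSq]
    refine Finset.sum_congr rfl fun i _ => ?_
    rw [sobHalvesSq, if_pos (by decide), ← sobSq_ev, vel_eq cfg, dt_ev]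
    rfl
  have h4 := le_abs_self (cfg c).K
  have h5 := abs_nonneg (supOn (cfg c).T (energy ρ₀ (cfg c).η))
  have h6 := abs_nonneg (cfg c).K
  have h7 : 1 + |(cfg c).K| ≤ (scale cfg).B c :=
    le_mul_of_one_le_right (by linarith) (by linarith)
  beta_reduce
  rw [← h3, pow_one, mul_one]
  linarith

theorem l2_vel (i : Fin 3) (L : List (Fin 3)) (hL : L.length ≤ 3) :
    L2 (scale cfg) (fun _ _ => 1) (L.foldr (fun k g => D k g) (velF (flowF cfg) i)) :=
  l2_of_le (integ_vel_le cfg) fun c t _ x _ => (sq_le_sobF L hL _ c t x).trans (by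
    rw [ev_sum]
    exact Finset.single_le_sum (f := fun i => ev (sobF 3 (velF (flowF cfg) i)) c t x)
      (fun i _ => ev_sobF_nonneg _ _ _ _ _) (Finset.mem_univ i))

theorem reg4_grad (i k : Fin 3) : Reg4 (scale cfg) (densF hρ₀) (grad (flowF cfg) i k) where
  toReg := .of_sobolev (l2_flow hρ₀ cfg i [k] (by simp))
    (fun j => l2_flow hρ₀ cfg i [j, k] (by simp))
    (fun j l => l2_flow hρ₀ cfg i [j, l, k] (by simp))
    (fun j l m => l2_flow hρ₀ cfg i [j, l, m, k] (by simp))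
  d4 a b e d := l2_of_le (integ_energyF_le hρ₀ cfg) fun c t _ x hx => by
    rw [ev_mul, mul_pow]
    exact (mul_le_mul_of_nonneg_left (sq_hd_le_hsqF _ a b e d c t x) (sq_nonneg _)).trans
      (hsqF_grad_le_energyF hρ₀ cfg c t hx (m := 0) (by norm_num) i k)

theorem l2_acc4 (i k : Fin 3) (a b e : Fin 2) : L2 (scale cfg) (fun _ _ => 1) (densF hρ₀ *
    D a.castSucc (D b.castSucc (D e.castSucc (D k (Dt (velF (flowF cfg) i)))))) :=
  l2_of_le (integ_energyF_le hρ₀ cfg) fun c t _ x hx => by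
    rw [ev_mul, mul_pow]
    exact (mul_le_mul_of_nonneg_left (sq_le_hsqF_three _ a b e c t x) (sq_nonneg _)).trans
      (hsqF_grad_le_energyF hρ₀ cfg c t hx (m := 1) (by norm_num) i k)

theorem intBdd_vel4 (a b e d : Fin 2) (i : Fin 3) : IntBdd (scale cfg) (fun _ _ => 1)
    (ev (densF hρ₀ * (hd a b e d (velF (flowF cfg) i) * hd a b e d (velF (flowF cfg) i)))) :=
  ⟨fun c t _ => (continuous_ev _ c t).integrableOn_cell,
    (integ_energyF_le hρ₀ cfg).mono fun c t _ => integ_mono_ev fun x hx => by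
      rw [ev_mul, ev_mul, ← sq]
      exact (mul_le_mul_of_nonneg_left (sq_hd_le_hsqF _ a b e d c t x) (hρ₀.pos hx).le).trans
        (hsqF_vel_le_energyF hρ₀ cfg c t hx i)⟩

theorem l2_curlF (a b e d : Fin 2) (i : Fin 3) : L2 (scale cfg) (fun _ _ => 1)
    (densF hρ₀ * hd a b e d (curlF cfg i)) :=
  l2_of_le (integ_energyF_le hρ₀ cfg) fun c t _ x hx => by
    rw [ev_mul, mul_pow]
    exact (mul_le_mul_of_nonneg_left (sq_hd_le_hsqF _ a b e d c t x) (sq_nonneg _)).trans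
      (hsqF_curl_le_energyF hρ₀ cfg c t hx i)

theorem curlG_swap (A : Matrix (Fin 3) (Fin 3) (Fam ι)) (u : Fin 3 → Fam ι) (j k : Fin 3) :
    curlG A u k j = -curlG A u j k := by
  rw [curlG, curlG, ← Finset.sum_neg_distrib]
  exact Finset.sum_congr rfl fun s _ => (neg_sub _ _).symm

theorem l2_curlG (a b e d : Fin 2) (j k : Fin 3) : L2 (scale cfg) (fun _ _ => 1)
    (densF hρ₀ * hd a b e d (curlG (invG (flowF cfg)) (velF (flowF cfg)) j k)) := by
  have h := l2_curlF hρ₀ cfg a b e d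
  have hs : ∀ j k, L2 (scale cfg) (fun _ _ => 1)
      (densF hρ₀ * hd a b e d (curlG (invG (flowF cfg)) (velF (flowF cfg)) j k)) →
      L2 (scale cfg) (fun _ _ => 1)
      (densF hρ₀ * hd a b e d (curlG (invG (flowF cfg)) (velF (flowF cfg)) k j)) :=
    fun j k h => by
      rw [curlG_swap, map_neg, show ∀ p q : Fam ι, p * -q = -(p * q) from fun p q => by ring]
      exact h.neg
  have hd0 : ∀ j, L2 (scale cfg) (fun _ _ => 1)
      (densF hρ₀ * hd a b e d (curlG (invG (flowF cfg)) (velF (flowF cfg)) j j)) := fun j => by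
    simp only [curlG, sub_self, Finset.sum_const_zero, map_zero, mul_zero]; exact .zero
  fin_cases j <;> fin_cases k
  · exact hd0 0
  · exact h 2
  · exact hs _ _ (h 1)
  · exact hs _ _ (h 2)
  · exact hd0 1
  · exact h 0
  · exact h 1
  · exact hs _ _ (h 0)
  · exact hd0 2

theorem dom_densF {f : Point → ℝ} (hf : ContDiff ℝ ∞ f) (h : ∀ x : Point, x 2 = 1 → f x = 0)
    (σ : Scale ι) : Dom σ (spaceF f hf) (densF hρ₀) := by
  obtain ⟨C, hC, hC'⟩ := hρ₀.exists_abs_le hf h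
  refine ⟨C, hC, 0, fun c t _ x hx => ?_⟩
  rw [ev_densF, abs_of_pos (hρ₀.pos hx), pow_zero, mul_one]
  exact hC' x hx

/-- Vanishing on Γ is inherited by horizontal derivatives, since these are tangential to Γ. -/
theorem hWeight_densF (σ : Scale ι) : HWeight σ (densF hρ₀ : Fam ι) where
  pos c t _ x hx := hρ₀.pos hx
  linf := by
    obtain ⟨C, hC⟩ := (isCompact_Icc (a := (0 : Point)) (b := 1)).exists_bound_of_continuousOn
      hρ₀.smooth.continuous.continuousOn
    exact ⟨C, (norm_nonneg _).trans (hC 0 ⟨le_rfl, fun _ => zero_le_one⟩), 0, fun c t _ x hx => by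
      rw [pow_zero, mul_one]; exact hC x (cell_subset_Icc hx)⟩
  dom1 a := by
    have h0 := hρ₀.vanishes
    simp only [densF, D_spaceF]
    exact dom_densF hρ₀ _ (pd_eq_zero_of_top hρ₀.smooth h0 a) σ
  dom2 a b := by
    have h0 := pd_eq_zero_of_top hρ₀.smooth hρ₀.vanishes b
    simp only [densF, D_spaceF]
    exact dom_densF hρ₀ _ (pd_eq_zero_of_top (contDiff_pd hρ₀.smooth _) h0 a) σ
  dom3 a b c := by
    have h0 := pd_eq_zero_of_top hρ₀.smooth hρ₀.vanishes c
    have h1 := pd_eq_zero_of_top (contDiff_pd hρ₀.smooth _) h0 b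
    simp only [densF, D_spaceF]
    exact dom_densF hρ₀ _ (pd_eq_zero_of_top (contDiff_pd (contDiff_pd hρ₀.smooth _) _) h1 a) σ
  dom4 a b c d := by
    have h0 := pd_eq_zero_of_top hρ₀.smooth hρ₀.vanishes d
    have h1 := pd_eq_zero_of_top (contDiff_pd hρ₀.smooth _) h0 c
    have h2 := pd_eq_zero_of_top (contDiff_pd (contDiff_pd hρ₀.smooth _) _) h1 b
    simp only [densF, D_spaceF]
    exact dom_densF hρ₀ _ (pd_eq_zero_of_top
      (contDiff_pd (contDiff_pd (contDiff_pd hρ₀.smooth _) _) _) h2 a) σ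

theorem exists_hd_densF_sq_le (a b e d : Fin 2) : ∃ C : ℝ, 0 ≤ C ∧ ∀ (c : ι), ∀ x ∈ cell,
    |ev (hd a b e d (densF hρ₀ * densF hρ₀ : Fam ι)) c 0 x| ≤ C * ev (densF hρ₀ : Fam ι) c 0 x := by
  have hs : ContDiff ℝ ∞ fun x => ρ₀ x * ρ₀ x := hρ₀.smooth.mul hρ₀.smooth
  have hsp : (densF hρ₀ * densF hρ₀ : Fam ι) = spaceF _ hs := rfl
  have h0 := pd_eq_zero_of_top hs (fun x hx => by rw [hρ₀.vanishes x hx, mul_zero]) d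
  have h1 := pd_eq_zero_of_top (contDiff_pd hs _) h0 e
  have h2 := pd_eq_zero_of_top (contDiff_pd (contDiff_pd hs _) _) h1 b
  have hs4 := contDiff_pd (contDiff_pd (contDiff_pd (contDiff_pd hs d.castSucc) e.castSucc)
    b.castSucc) a.castSucc
  obtain ⟨C, hC, h⟩ := hρ₀.exists_abs_le hs4
    (pd_eq_zero_of_top (contDiff_pd (contDiff_pd (contDiff_pd hs _) _) _) h2 a)
  refine ⟨C, hC, fun c x hx => ?_⟩
  rw [hsp, hd_apply, D_spaceF, D_spaceF, D_spaceF, D_spaceF]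
  exact h x hx

theorem per_flowF (i : Fin 3) (α : Fin 2) : EqQ (scale cfg) (shift α (flowF cfg i))
    (flowF cfg i + algebraMap ℝ (Fam ι) (hvec α i)) := fun c t ht x hx => by
  rw [ev_shift, ev_add, ev_algebraMap]
  exact congrFun ((cfg c).sol.periodic t ht x hx α) i

/-- The flow map is periodic up to a constant translation, which any derivative removes. -/
theorem per_dir_flowF (i : Fin 3) (v : SpaceTime) : PerQ (scale cfg) (dir v (flowF cfg i)) :=
  fun α c t ht x hx => by
    have := (per_flowF cfg i α).dir v c t ht x hx
    rwa [map_add, Derivation.map_algebraMap, add_zero, ← shift_dir] at this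

theorem momentum_flowF (i : Fin 3) : EqQ (scale cfg) (densF hρ₀ * Dt (velF (flowF cfg) i)
    + ∑ k, cofG (flowF cfg) k i * D k (densF hρ₀ * densF hρ₀ *
      (invJ (flowF cfg) * invJ (flowF cfg)))) 0 := by
  refine eqQ_of_open fun c t ht x hx => ?_
  have ht' := Ioo_subset_Icc_self ht
  have h := (cfg c).sol.momentum t (Ioo_subset_Ioc_self ht) x hx i
  rw [vel_eq cfg, (hasDerivAt_ev (velF (flowF cfg) i) c t x).deriv, cof_eq] at h
  simp only [ev_add, ev_mul, ev_sum, ev_zero, ev_densF]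
  rw [← h]
  congr 1
  refine Finset.sum_congr rfl fun k _ => ?_
  rw [evM_apply, ← pd_ev]
  congr 1
  refine eqOn_pd (fun y hy => ?_) k hx
  rw [jacInvSq_eq cfg ht' (slab_subset_closedSlab hy), ev_mul, ev_mul, ev_densF, sq]
  rfl

theorem grad_zero (c : ι) {x : Point} (hx : x ∈ closedSlab) (i k : Fin 3) :
    ev (grad (flowF cfg) i k) c 0 x = if i = k then 1 else 0 := by
  have hs : ContDiff ℝ ∞ (fun x : Point => x i) := contDiff_apply ℝ ℝ i
  have h1 : EqOn (ev (grad (flowF cfg) i k) c 0) (fun _ => if i = k then 1 else 0) slab := by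
    intro x hx
    have := ev_D_congr (f := flowF cfg i) (g := spaceF (fun x => x i) hs) (c := c) (t := 0)
      (fun x hx => congrFun ((cfg c).sol.init_position x (slab_subset_closedSlab hx)) i) k x hx
    refine this.trans ?_
    rw [D_spaceF, ev_spaceF, pd, (hasFDerivAt_apply i x).fderiv, ContinuousLinearMap.proj_apply,
      Pi.single_apply]
  exact h1.closure (continuous_ev _ c 0) continuous_const (closedSlab_subset_closure hx)

theorem van_vel : Van (scale cfg) 0 (velF (flowF cfg) 2) := fun c t ht x hx => by
  rw [← vel_eq cfg]; exact (cfg c).sol.bottom t ht x hx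

/-- Integrate v³ = 0 in time from η³ = x₃ = 0. -/
theorem van_flowF : Van (scale cfg) 0 (flowF cfg 2) := fun c t ht x hx => by
  have h := norm_image_sub_le_of_norm_deriv_le_segment' (f := fun s => ev (flowF cfg 2) c s x)
    (a := 0) (b := t) (C := 0) (fun s _ => (hasDerivAt_ev _ c s x).hasDerivWithinAt)
    (fun s hs => by
      have := van_vel cfg c s ⟨hs.1, hs.2.le.trans ht.2⟩ x hx
      rw [velF] at this
      rw [this, norm_zero]) t (right_mem_Icc.2 ht.1)
  rw [zero_mul, norm_le_zero_iff, sub_eq_zero] at h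
  rw [h]
  have hx' : x ∈ closedSlab := ⟨hx.ge, hx.le.trans zero_le_one⟩
  exact (congrFun ((cfg c).sol.init_position x hx') 2).trans hx

theorem flow_of_config (hT : ∀ c, (cfg c).T ≤ 1) : Flow (scale cfg) (densF hρ₀) (flowF cfg) where
  T_le := hT
  weight := hWeight_densF hρ₀ _
  rho_t := Dt_spaceF _ _
  rho_top := fun c t _ x hx => hρ₀.vanishes x hx
  rho_per := fun α c t _ x hx => by rw [ev_shift]; exact hρ₀.periodic x hx α
  dom_const := exists_hd_densF_sq_le hρ₀
  nonDeg := nonDeg_flowF cfg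
  per_grad := fun i k => per_dir_flowF cfg i _
  per_vel := fun i => per_dir_flowF cfg i _
  momentum := momentum_flowF hρ₀ cfg
  init := fun c x hx i k => grad_zero cfg c hx i k
  bottom_pos := van_flowF cfg
  bottom_vel := van_vel cfg
  reg := reg4_grad hρ₀ cfg
  vel1 := fun i j => l2_vel cfg i [j] (by simp)
  vel2 := fun i j k => l2_vel cfg i [j, k] (by simp)
  vel3 := fun i j k l => l2_vel cfg i [j, k, l] (by simp)
  acc0 := fun i => l2_acc hρ₀ cfg i [] (by simp)
  acc1 := fun i j => l2_acc hρ₀ cfg i [j] (by simp)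
  acc2 := fun i j k => l2_acc hρ₀ cfg i [j, k] (by simp)
  acc3 := fun i j k l => l2_acc hρ₀ cfg i [j, k, l] (by simp)
  acc4 := l2_acc4 hρ₀ cfg
  vel4 := intBdd_vel4 hρ₀ cfg
  curl4 := l2_curlG hρ₀ cfg

end

end VacuumEuler

/-! ### Summation over the horizontal directions, and the final polynomial bound. -/

namespace VacuumEuler

open MeasureTheory Fam

noncomputable section

variable {ρ₀ : Point → ℝ} {ι : Type*} (hρ₀ : IsVacuumDensity ρ₀) (cfg : ι → Config ρ₀)

/-! ### The estimate of the horizontal energy -/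

theorem horizF_eq_sum : horizF hρ₀ cfg = ∑ s : Fin 2 × Fin 2 × Fin 2 × Fin 2,
    ((∑ i, densF hρ₀ * (Flow.wF (flowF cfg) s.1 s.2.1 s.2.2.1 s.2.2.2 i
        * Flow.wF (flowF cfg) s.1 s.2.1 s.2.2.1 s.2.2.2 i))
      + ∑ i, ∑ k, densF hρ₀ * D k (Flow.yF (flowF cfg) s.1 s.2.1 s.2.2.1 s.2.2.2 i)
        * (densF hρ₀ * D k (Flow.yF (flowF cfg) s.1 s.2.1 s.2.2.1 s.2.2.2 i))) := by
  have h : ∀ f : Fam ι, hsqF 4 f = ∑ s : Fin 2 × Fin 2 × Fin 2 × Fin 2,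
      hd s.1 s.2.1 s.2.2.1 s.2.2.2 f ^ 2 := fun f => by
    rw [hsqF_four]
    simp only [Fintype.sum_prod_type, Fin.sum_univ_two]
    ring
  simp only [horizF, h, Flow.wF, Flow.yF, hd_D, Finset.mul_sum, Finset.sum_add_distrib]
  congr 1
  · rw [Finset.sum_comm]
    exact Finset.sum_congr rfl fun s _ => Finset.sum_congr rfl fun i _ => by ring
  · symm
    rw [Finset.sum_comm]
    refine Finset.sum_congr rfl fun i _ => ?_
    rw [Finset.sum_comm]
    exact Finset.sum_congr rfl fun k _ => Finset.sum_congr rfl fun s _ => by ring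

theorem horizontalEnergy_eq_sum (c : ι) (t : ℝ) : horizontalEnergy ρ₀ (cfg c).η t
    = ∑ s : Fin 2 × Fin 2 × Fin 2 × Fin 2,
      (Flow.kinE (densF hρ₀) (flowF cfg) s.1 s.2.1 s.2.2.1 s.2.2.2 c t
        + Flow.potE (densF hρ₀) (flowF cfg) s.1 s.2.1 s.2.2.1 s.2.2.2 c t) := by
  rw [horizontalEnergy_eq hρ₀ cfg, horizF_eq_sum, integ_sum_ev]
  exact Finset.sum_congr rfl fun s _ => integ_add_ev _ _ c t

theorem kinE_nonneg (a b e d : Fin 2) (c : ι) (t : ℝ) :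
    0 ≤ Flow.kinE (densF hρ₀) (flowF cfg) a b e d c t := integ_nonneg_ev fun x hx => by
  simp only [ev_sum, ev_mul, ev_densF]
  exact Finset.sum_nonneg fun i _ => mul_nonneg (hρ₀.pos hx).le (mul_self_nonneg _)

theorem potE_nonneg (a b e d : Fin 2) (c : ι) (t : ℝ) :
    0 ≤ Flow.potE (densF hρ₀) (flowF cfg) a b e d c t := integ_nonneg_ev fun x hx => by
  simp only [ev_sum, ev_mul]
  exact Finset.sum_nonneg fun i _ => Finset.sum_nonneg fun k _ => mul_self_nonneg _

/-- The estimate for short time intervals. -/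
theorem horizontalEnergy_le (hρ₀ : IsVacuumDensity ρ₀) (cfg : ι → Config ρ₀)
    (hT : ∀ c, (cfg c).T ≤ 1) :
    ∃ C₀ : ℝ, 0 ≤ C₀ ∧ ∃ C : ℝ, 0 ≤ C ∧ ∃ n : ℕ, ∀ c, ∀ t ∈ Icc 0 (cfg c).T, ∀ ε : ℝ, 0 < ε →
      horizontalEnergy ρ₀ (cfg c).η t ≤ energy ρ₀ (cfg c).η 0
        + ε * supOn (cfg c).T (energy ρ₀ (cfg c).η) + C₀ / ε
        + C * (scale cfg).B c ^ n * √((cfg c).T) := by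
  have hF := flow_of_config hρ₀ cfg hT
  have h := fun s : Fin 2 × Fin 2 × Fin 2 × Fin 2 =>
    hF.energy_estimate s.1 s.2.1 s.2.2.1 s.2.2.2
  choose C₀ hC₀ C hC n hn using h
  refine ⟨∑ s, C₀ s, Finset.sum_nonneg fun s _ => hC₀ s, ∑ s, C s,
    Finset.sum_nonneg fun s _ => hC s, ∑ s, n s, fun c t ht ε hε => ?_⟩
  have h0t := left_mem_Icc.2 (cfg c).pos.le
  have h1 : ∀ s, C s * (scale cfg).B c ^ n s * √((cfg c).T)
      ≤ C s * (scale cfg).B c ^ (∑ s, n s) * √((cfg c).T) := fun s =>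
    mul_le_mul_of_nonneg_right (mul_le_mul_of_nonneg_left ((scale cfg).pow_le_pow c
      (Finset.single_le_sum (fun s _ => Nat.zero_le (n s)) (Finset.mem_univ s))) (hC s))
      (Real.sqrt_nonneg _)
  have h2 : horizontalEnergy ρ₀ (cfg c).η t
      ≤ ∑ s : Fin 2 × Fin 2 × Fin 2 × Fin 2,
        (Flow.kinE (densF hρ₀) (flowF cfg) s.1 s.2.1 s.2.2.1 s.2.2.2 c 0
        + ε * Flow.potE (densF hρ₀) (flowF cfg) s.1 s.2.1 s.2.2.1 s.2.2.2 c t + C₀ s / ε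
        + C s * (scale cfg).B c ^ (∑ s, n s) * √((cfg c).T)) := by
    rw [horizontalEnergy_eq_sum hρ₀ cfg]
    exact Finset.sum_le_sum fun s _ => (hn s c t ht ε hε).trans (add_le_add_right (h1 s) _)
  have h3 : ∑ s : Fin 2 × Fin 2 × Fin 2 × Fin 2,
      Flow.kinE (densF hρ₀) (flowF cfg) s.1 s.2.1 s.2.2.1 s.2.2.2 c 0
      ≤ energy ρ₀ (cfg c).η 0 := by
    refine le_trans ?_ (horizontalEnergy_le_energy hρ₀ cfg h0t)
    rw [horizontalEnergy_eq_sum hρ₀ cfg]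
    exact Finset.sum_le_sum fun s _ => le_add_of_nonneg_right (potE_nonneg hρ₀ cfg _ _ _ _ c 0)
  have h4 : ∑ s : Fin 2 × Fin 2 × Fin 2 × Fin 2,
      Flow.potE (densF hρ₀) (flowF cfg) s.1 s.2.1 s.2.2.1 s.2.2.2 c t
      ≤ supOn (cfg c).T (energy ρ₀ (cfg c).η) := by
    refine le_trans ?_ ((horizontalEnergy_le_energy hρ₀ cfg ht).trans (energy_le_sup hρ₀ cfg ht))
    rw [horizontalEnergy_eq_sum hρ₀ cfg]
    exact Finset.sum_le_sum fun s _ => le_add_of_nonneg_left (kinE_nonneg hρ₀ cfg _ _ _ _ c t)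
  rw [Finset.sum_add_distrib, Finset.sum_add_distrib, Finset.sum_add_distrib, ← Finset.mul_sum,
    ← Finset.sum_div, ← Finset.sum_mul, ← Finset.sum_mul] at h2
  have h5 := mul_le_mul_of_nonneg_left h4 hε.le
  linarith

/-- This exchanges √T for the required T at the cost of squaring the polynomial; the constant 1 is
absorbed by M_δ. -/
theorem sqrt_mul_le (T X : ℝ) (hT : 0 ≤ T) : X * √T ≤ 1 + T * X ^ 2 := by
  have h := Real.sq_sqrt hT
  nlinarith [sq_nonneg (X * √T - 1), sq_nonneg (X * √T)]

/-- The upper bound is a polynomial in the supremum of the energy. -/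
theorem exists_polynomial_bound (hρ₀ : IsVacuumDensity ρ₀) : ∃ C₀ : ℝ, 0 ≤ C₀ ∧
    ∃ C : ℝ, 0 ≤ C ∧ ∃ n : ℕ,
    ∀ c : Config ρ₀, c.T ≤ 1 → ∀ t ∈ Icc 0 c.T, ∀ ε : ℝ, 0 < ε →
      horizontalEnergy ρ₀ c.η t ≤ energy ρ₀ c.η 0 + ε * supOn c.T (energy ρ₀ c.η) + (C₀ / ε + 1)
        + C * (1 + |c.K|) ^ n * c.T * (1 + supOn c.T (energy ρ₀ c.η)) ^ n := by
  -- The index set consists of all solutions with T ≤ 1, for all K at once, so the constants and the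
  -- exponent depend on the density only.
  obtain ⟨C₀, hC₀, C, hC, n, h⟩ := horizontalEnergy_le hρ₀
    (fun c : {c : Config ρ₀ // c.T ≤ 1} => c.1) fun c => c.2
  refine ⟨C₀, hC₀, C ^ 2, sq_nonneg C, n * 2, fun c hT t ht ε hε => ?_⟩
  refine (h ⟨c, hT⟩ t ht ε hε).trans ?_
  have h1 := sqrt_mul_le c.T (C * ((1 + |c.K|) * (1 + supOn c.T (energy ρ₀ c.η))) ^ n) c.pos.le
  have h2 := sup_energy_nonneg hρ₀ (fun c : Config ρ₀ => c) c
  have h3 : (scale fun c : {c : Config ρ₀ // c.T ≤ 1} => c.1).B ⟨c, hT⟩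
      = (1 + |c.K|) * (1 + supOn c.T (energy ρ₀ c.η)) := by
    rw [← abs_of_nonneg h2]; rfl
  rw [h3]
  have h4 : (C * ((1 + |c.K|) * (1 + supOn c.T (energy ρ₀ c.η))) ^ n) ^ 2
      = C ^ 2 * (1 + |c.K|) ^ (n * 2) * (1 + supOn c.T (energy ρ₀ c.η)) ^ (n * 2) := by
    rw [mul_pow, ← pow_mul, mul_pow]; ring
  rw [h4] at h1
  linarith

end

end VacuumEuler

theorem mainTheorem3 (ρ₀ : Point → ℝ) (hρ₀ : IsVacuumDensity ρ₀) :
    ∃ P : Polynomial ℝ, ∀ K : ℝ, ∃ C : ℝ, 0 < C ∧ ∀ δ : ℝ, 0 < δ →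
      ∃ M : Polynomial ℝ, ∀ (T : ℝ) (u₀ : Point → Vec) (η : ℝ → Point → Vec), 0 < T →
        IsSmoothSolution ρ₀ u₀ T η → SmallTime T η → (∀ m : ℕ, m ≤ 6 → velNormSq η m 0 ≤ K) →
        BddAbove (horizontalEnergy ρ₀ η '' Icc 0 T) ∧
        BddAbove (energy ρ₀ η '' Icc 0 T) ∧
        supOn T (horizontalEnergy ρ₀ η) ≤
          M.eval (energy ρ₀ η 0) + δ * supOn T (energy ρ₀ η)
            + C * T * P.eval (supOn T (energy ρ₀ η)) := by
  obtain ⟨C₀, hC₀, C, hC, n, h⟩ := exists_polynomial_bound hρ₀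
  -- The power serves T ≤ 1 and the extra X serves T ≥ 1. K enters through the factor (1 + |K|)ⁿ in
  -- the constant, and M_δ consists of E(0), the Young term C₀/δ and the 1 left by exchanging √T for
  -- T.
  refine ⟨(1 + Polynomial.X) ^ n + Polynomial.X, fun K => ⟨C * (1 + |K|) ^ n + 1, by positivity,
    fun δ hδ => ⟨Polynomial.X + Polynomial.C (C₀ / δ + 1), fun T u₀ η hT hsol hsmall hK => ?_⟩⟩⟩
  let c : Config ρ₀ := ⟨K, T, u₀, η, hT, hsol, hsmall, hK⟩
  let cfg : Config ρ₀ → Config ρ₀ := id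
  have hE : BddAbove (energy ρ₀ η '' Icc 0 T) := bddAbove_energy hρ₀ cfg c
  have hS : 0 ≤ supOn T (energy ρ₀ η) := sup_energy_nonneg hρ₀ cfg c
  have h0 : 0 ≤ energy ρ₀ η 0 := energy_nonneg hρ₀ cfg (c := c) (left_mem_Icc.2 hT.le)
  have hle : ∀ t ∈ Icc 0 T, horizontalEnergy ρ₀ η t ≤ supOn T (energy ρ₀ η) := fun t ht =>
    (horizontalEnergy_le_energy hρ₀ cfg (c := c) ht).trans (energy_le_sup hρ₀ cfg (c := c) ht)
  refine ⟨⟨_, forall_mem_image.2 hle⟩, hE, csSup_le ((nonempty_Icc.2 hT.le).image _)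
    (forall_mem_image.2 fun t ht => ?_)⟩
  simp only [Polynomial.eval_add, Polynomial.eval_pow, Polynomial.eval_one, Polynomial.eval_X,
    Polynomial.eval_C]
  generalize hSdef : supOn T (energy ρ₀ η) = S at *
  have hp : 0 ≤ (1 + S) ^ n := by positivity
  have hCK : 0 ≤ C * (1 + |K|) ^ n := by positivity
  have hq : 0 ≤ C₀ / δ := by positivity
  rcases le_total T 1 with hT1 | hT1
  · have := h c hT1 t ht δ hδ
    change _ ≤ energy ρ₀ η 0 + δ * supOn T (energy ρ₀ η) + _ + C * (1 + |K|) ^ n * T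
      * (1 + supOn T (energy ρ₀ η)) ^ n at this
    rw [hSdef] at this
    have h1 : C * (1 + |K|) ^ n * T * (1 + S) ^ n
        ≤ (C * (1 + |K|) ^ n + 1) * T * ((1 + S) ^ n + S) := by
      gcongr <;> linarith
    linarith
  -- For T ≥ 1 nothing dynamic is needed: the horizontal energy is part of E, and S ≤ T·S.
  · have h1 : 1 * S ≤ (C * (1 + |K|) ^ n + 1) * T * ((1 + S) ^ n + S) := by
      gcongr
      · nlinarith
      · linarith
    have := hle t ht
    have := mul_nonneg hδ.le hS
    linarith
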